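/- Notation. Balls $B(x,r)$ are closed Euclidean balls; $\mathrm{vol}$ is $d$-dimensional volume on $\mathcal M$; $B(x,p,q)=\int_0^x t^{p-1}(1-t)^{q-1}\,dt$ and $B(p,q)=B(1,p,q)$; $$q_d(s)=\Big(2\,\frac{B(\frac{d+1}2,\frac12)}{B(1-\frac{s^2}4,\frac{d+1}2,\frac12)}-1\Big)^{-1};\qquad \mathcal K(p,q)=p\log\frac pq+(1-p)\log\frac{1-p}{1-q}.$$ Setting. Let $\mathcal M\subset\mathbb R^D$ be a compact $d$-dimensional $C^2$ submanifold without boundary with $\mathrm{reach}(\mathcal M)\ge 1/\kappa$, $\kappa>0$. Let $\mathbb P$ be the law of $X+\xi$, where $X$ has density $f$ with respect to $\mathrm{vol}$ on $\mathcal M$ and $\|\xi\|\le r_\xi$ almost surely. Let $1<b$, $b'<2$, let $h_0>0$, $h_{l+1}=b\,h_l$, fix $k\ge 1$ and put $r=h_{k-1}$. Assume $r_\xi\le r/\max\{20,5d\}$, $r\le 1/(\max\{48,6d\}\kappa)$ and $b\le b'/\big((1+3\kappa r)(1+5r_\xi/r)\big)$. For any radius $r>0$ put $$\varepsilon_{\mathcal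 M}(r)=\frac{84\kappa(d+1)r}{(1-(b'/2)^2)^{(d+1)/2}},\qquad \varepsilon_\xi(r)=\frac{80(d+1)r_\xi/r}{(1-(b'/2)^2)^{(d+1)/2}},$$ and write $\varepsilon_{\mathcal M},\varepsilon_\xi$ for the values at $r=h_{k-1}$. Clusters. Let $C_1,\dots,C_K\subset\mathcal M$ be disjoint with $\|x-y\|\ge r+2r_\xi$ for $x,y$ in different clusters. Let $f_0>0$ be such that $\int_{B(x,r')\cap\mathcal M}f\,d\mathrm{vol}\ge f_0\,\mathrm{vol}(B(x,r')\cap\mathcal M)$ for all $x\in C_a$, all $a$ and all $r'<r$. Let $\varepsilon<1$ and $f\le(1-\varepsilon)f_0$ almost everywhere on $\mathcal M\setminus\bigcup_a C_a$. Points and sample size. Let $\|x_i-x_j\|\le h_k$, and let $x_i,x_j$ be within distance $r_\xi$ of points of two different clusters. Let $\alpha>\beta>0$, $z=\mathbb P(B(x_i,r)\cup B(x_j,r))$, and assume $$\frac n{\log n}\ge\frac{2\beta}{z^2},\qquad \varepsilon\ge\max\Big\{7(\varepsilon_{\mathcal M}+\varepsilon_\xi),\ \sqrt{\frac{2\alpha\log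 n}{z\,q_d(b)^2\,n}}\Big\}.$$ Statistic. For data $X_1,\dots,X_{n+2}$ and binary weights $w^{(l)}$, let $N^{(l+1)}_{a\vee c}$ be the number of indices $m\ne a,c$ with $w^{(l)}_{am}=1$ or $w^{(l)}_{cm}=1$, let $\widetilde\theta^{(l+1)}_{ac}$ be the number of $m\neq a,c$ with $w^{(l)}_{am}=w^{(l)}_{cm}=1$ divided by $N^{(l+1)}_{a\vee c}$, and $$T^{(l+1)}_{ac}=N^{(l+1)}_{a\vee c}\,\mathcal K(\widetilde\theta^{(l+1)}_{ac},\mathfrak q^{(l+1)}_{ac})\big(\mathbf 1(\widetilde\theta^{(l+1)}_{ac}<\mathfrak q^{(l+1)}_{ac})-\mathbf 1(\widetilde\theta^{(l+1)}_{ac}\ge\mathfrak q^{(l+1)}_{ac})\big),$$ $$\mathfrak q^{(l+1)}_{ac}=\big(1+\varepsilon_{\mathcal M}(h_l)\big)^{-1}\big(1+\varepsilon_\xi(h_l)\big)^{-1}q_d\big(\|X_a-X_c\|/g_l\big),$$ where either $g_l=h_l$ for all $l$, or $g_l=h_{l+1}$ for all $l$ (the claim is made for both conventions). The adaptive weights clustering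 algorithm with threshold $\lambda\in\mathbb R$ starts from $w^{(0)}_{ac}=\mathbf 1(\|X_a-X_c\|\le h_0)$ and sets $w^{(l+1)}_{ac}=\mathbf 1(\|X_a-X_c\|\le h_{l+1})\mathbf 1(T^{(l+1)}_{ac}\le\lambda)$ for $a\ne c$ and $w_{aa}^{(l+1)}=1$; it detects no gap in step $l+1$ if $T^{(l+1)}_{ac}\le\lambda$ for all $a\ne c$ with $\|X_a-X_c\|\le h_{l+1}$. If no gap is detected in steps $1,\dots,k-1$, then $w^{(k-1)}_{ac}=\mathbf 1(\|X_a-X_c\|\le h_{k-1})$. Theorem. Let $X_1,\dots,X_{n+2}$ be i.i.d. with law $\mathbb P$ and let $i\ne j$. If $T^{(k)}_{ij}$ is computed from the weights $w^{(k-1)}_{ac}=\mathbf 1(\|X_a-X_c\|\le h_{k-1})$ that result when no gap was detected in the previous steps, then $$\mathbb P^{\otimes(n+2)}\Big(T^{(k)}_{ij}\ge(\sqrt\alpha-\sqrt\beta)^2\log n\ \Big|\ X_i=x_i,X_j=x_j\Big)\ge 1-3n^{-\beta}.$$ Likewise, for the algorithm run with any threshold $\lambda$, the conditional probability that it detects a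 gap in one of the steps $1,\dots,k-1$ or satisfies $T^{(k)}_{ij}\ge(\sqrt\alpha-\sqrt\beta)^2\log n$ is at least $1-3n^{-\beta}$. (Conditioning means that $X_i=x_i$, $X_j=x_j$ are deterministic and the other $n$ points are i.i.d. with law $\mathbb P$.) -/

import Mathlib

open MeasureTheory Set
open scoped ENNReal

namespace AWC

/-- The incomplete beta function `B(x, p, q) = ∫₀ˣ t^(p-1) (1-t)^(q-1) dt`; the beta function
`B(p, q)` is `B(1, p, q)`. -/
noncomputable def incBeta (x p q : ℝ) : ℝ :=
  ∫ t in (0 : ℝ)..x, t ^ (p - 1) * (1 - t) ^ (q - 1)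

/-- The volume coefficient `q_d(s)` in dimension `d`: for `0 ≤ s < 2`, the ratio of the volumes of
the intersection and of the union of two balls of equal radius whose centres are `s` radii apart. -/
noncomputable def volCoef (d : ℕ) (s : ℝ) : ℝ :=
  (2 * (incBeta 1 (((d : ℝ) + 1) / 2) (1 / 2)
      / incBeta (1 - s ^ 2 / 4) (((d : ℝ) + 1) / 2) (1 / 2)) - 1)⁻¹

/-- The curvature effect `ε_M`. -/
noncomputable def epsM (d : ℕ) (κ b' r : ℝ) : ℝ :=
  84 * κ * ((d : ℝ) + 1) * r / (1 - (b' / 2) ^ 2) ^ (((d : ℝ) + 1) / 2)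

/-- The noise effect `ε_ξ`. -/
noncomputable def epsXi (d : ℕ) (rξ b' r : ℝ) : ℝ :=
  80 * ((d : ℝ) + 1) * (rξ / r) / (1 - (b' / 2) ^ 2) ^ (((d : ℝ) + 1) / 2)

/-- Kullback-Leibler divergence of two Bernoulli variables with means `p` and `q`. -/
noncomputable def bernKL (p q : ℝ) : ℝ :=
  p * Real.log (p / q) + (1 - p) * Real.log ((1 - p) / (1 - q))

section Geometry

variable {E : Type*} [NormedAddCommGroup E] [NormedSpace ℝ E]

/-- The reach of a set: the supremum of the `r ≥ 0` such that every point of the closed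
`r`-offset of `S` has exactly one nearest point in `S`. -/
noncomputable def reach (S : Set E) : ℝ≥0∞ :=
  sSup {ρ : ℝ≥0∞ | ∃ r : ℝ, 0 ≤ r ∧ ρ = ENNReal.ofReal r ∧
    ∀ y ∈ ⋃ x ∈ S, Metric.closedBall x r, ∃! x, x ∈ S ∧ ∀ x' ∈ S, dist y x ≤ dist y x'}

/-- `M` is a `d`-dimensional (embedded) `C²` submanifold without boundary: around each of its
points it is the image of a regular `C²` parametrization of an open subset of `ℝ^d` that is a
homeomorphism onto its image. -/
def IsC2Submanifold (d : ℕ) (M : Set E) : Prop :=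
  ∀ p ∈ M, ∃ (U : Set E) (V : Set (EuclideanSpace ℝ (Fin d)))
    (φ : EuclideanSpace ℝ (Fin d) → E) (ψ : E → EuclideanSpace ℝ (Fin d)),
    IsOpen U ∧ p ∈ U ∧ IsOpen V ∧ ContDiffOn ℝ 2 φ V ∧
    (∀ v ∈ V, Function.Injective (fderiv ℝ φ v)) ∧
    φ '' V = M ∩ U ∧ ContinuousOn ψ (M ∩ U) ∧ (∀ v ∈ V, ψ (φ v) = v)

end Geometry

section Algorithm

variable {E : Type*} [PseudoMetricSpace E] {N : ℕ}

/-- The adjusted volume coefficient of `x` and `y` when local clusters of radius `r` are compared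
and distances are measured in units of `ρ`. -/
noncomputable def adjVolCoef (d : ℕ) (κ rξ b' r ρ : ℝ) (x y : E) : ℝ :=
  (1 + epsM d κ b' r)⁻¹ * (1 + epsXi d rξ b' r)⁻¹ * volCoef d (dist x y / ρ)

/-- Binary weights are propositions: `w a c` means that the weight is `1`, i.e. that `X_c` belongs
to the local cluster of `X_a`. `unionMass w a b` is the empirical mass of the union. -/
noncomputable def unionMass (w : Fin N → Fin N → Prop) (a b : Fin N) : ℕ :=
  Set.ncard {c : Fin N | c ≠ a ∧ c ≠ b ∧ (w a c ∨ w b c)}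

/-- The empirical mass of the intersection of two local clusters. -/
noncomputable def interMass (w : Fin N → Fin N → Prop) (a b : Fin N) : ℕ :=
  Set.ncard {c : Fin N | c ≠ a ∧ c ≠ b ∧ (w a c ∧ w b c)}

/-- The estimated gap coefficient. -/
noncomputable def gapEst (w : Fin N → Fin N → Prop) (a b : Fin N) : ℝ :=
  (interMass w a b : ℝ) / (unionMass w a b : ℝ)

open Classical in
/-- The test statistic of `a`, `b` for previous weights `w` and volume coefficient `q`. -/
noncomputable def testStat (w : Fin N → Fin N → Prop) (q : ℝ) (a b : Fin N) : ℝ :=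
  (unionMass w a b : ℝ) * bernKL (gapEst w a b) q * (if gapEst w a b < q then 1 else -1)

/-- The non-adaptive weights of radius `r`: weight `1` iff the distance is at most `r`. -/
def ballWeight (r : ℝ) (X : Fin N → E) (a b : Fin N) : Prop :=
  dist (X a) (X b) ≤ r

/-- The weights computed by the algorithm with radii `h 0, h 1, …` and threshold `lam` on the data
`X`, after step `l`; `q l` is the volume coefficient used in step `l + 1`. -/
def weight (q : ℕ → E → E → ℝ) (h : ℕ → ℝ) (lam : ℝ) (X : Fin N → E) :
    ℕ → Fin N → Fin N → Prop
  | 0 => ballWeight (h 0) X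
  | l + 1 => fun a b => a = b ∨
      (dist (X a) (X b) ≤ h (l + 1) ∧
        testStat (weight q h lam X l) (q l (X a) (X b)) a b ≤ lam)

/-- The algorithm detects no gap in any of the steps `1, …, m`. -/
def NoGapUpTo (q : ℕ → E → E → ℝ) (h : ℕ → ℝ) (lam : ℝ) (X : Fin N → E) (m : ℕ) : Prop :=
  ∀ l < m, ∀ a b : Fin N, a ≠ b → dist (X a) (X b) ≤ h (l + 1) →
    testStat (weight q h lam X l) (q l (X a) (X b)) a b ≤ lam

end Algorithm

/-- The law of an i.i.d. sample `X_1, …, X_N` from `P` conditioned on `X_i = x` and `X_j = y`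
(`i ≠ j`): these two points are deterministic, the others are still independent with law `P`. -/
noncomputable def condSampleLaw {E : Type*} [MeasurableSpace E] {N : ℕ} (P : Measure E)
    (i j : Fin N) (x y : E) : Measure (Fin N → E) :=
  Measure.pi fun l => if l = i then Measure.dirac x else if l = j then Measure.dirac y else P

end AWC

/-!
The test compares, for two points `x`, `y` near different clusters, the share `θ` of the mass of
`B(x, r) ∪ B(y, r)` that lies in `B(x, r) ∩ B(y, r)` with the share `q` that balls in `ℝ^d` would
have. There is a deterministic and a probabilistic half.

*Geometry.* On balls around cluster points the density is at least `f₀` on average, so that each of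
the two balls has at least the mass `f₀ vol(B(c, r') ∩ M)` for a slightly smaller radius `r'` and a
nearby cluster point `c` (`le_measure_closedBall_of_thick`). By the separation, a point of a cluster
can lie in the intersection of the two balls enlarged by the noise only on one of the bounding
spheres, which are null sets of `M`; elsewhere the density is at most `(1 - ε) f₀`, so that the mass
of the intersection is at most `(1 - ε) f₀` times a volume (`measure_inter_le_of_gap`). It remains
to compare volumes on `M` with volumes in `ℝ^d`. If the reach is at least `1/κ`, a unit normal
vector `v` at `p ∈ M` satisfies `⟪v, q - p⟫ ≤ κ/2 ‖q - p‖²` for `q ∈ M` (`IsTangent.inner_le`, from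
`IsNearest.inner_le`, as small normal vectors end at points with nearest point `p`), the tangent
spaces at nearby points make a small angle (`IsTangent.angleLE`), and so the orthogonal projection
to a tangent space is, on a small ball of `M`, injective and bi-Lipschitz with constants close to
`1`, and its image contains a ball of nearly the same radius. This gives
`volume_closedBall_le_measure` and `measure_inter_closedBall_le`. The volume of the intersection of
two balls in `ℝ^d` is twice that of a cap, an integral `capInt` over slices, which is an incomplete
beta function (`volCoef_eq`), and which changes little, relative to its size, when the distance of
the centres changes little (`capInt_le_mul`). Altogether `θ ≤ (1 - ε) q_d (1 + ε_M + ε_ξ)`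
(`gapCoef_le`), which lies below the adjusted volume coefficient by at least `5/7 ε q_d`
(`adj_arith`).

*Probability.* Given `X_i = x`, `X_j = y`, the number of other points in the union is binomial, and
by Hoeffding's inequality it is at least half its expectation up to probability `n^(-β)`
(`measureReal_card_le`). Conditionally on the points in the union, the number of those in
the intersection is binomial with parameter `θ`, and exceeds its expectation by more than
`√(β N log n / 2)` with probability at most `n^(-β)` (`measureReal_card_gt`). Outside these events,
Pinsker's inequality (`two_mul_sq_le_bernKL`) turns the distance between the empirical
share and `q` into the lower bound for the statistic (`le_measureReal_testStat`). When no gap was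
detected before, the weights of the algorithm are the non-adaptive ones (`weight_eq_ballWeight`), so
that the statement on the algorithm follows from the one on the statistic.
-/

namespace AWC

open Filter Topology Metric

/-! ### Nearest points and reach -/

section Nearest

variable {E : Type*} [PseudoMetricSpace E]

/-- `p` is a nearest point of `M` to `a`. -/
def IsNearest (M : Set E) (a p : E) : Prop :=
  p ∈ M ∧ ∀ x ∈ M, dist a p ≤ dist a x

lemma IsNearest.infDist_eq {M : Set E} {a p : E} (h : IsNearest M a p) :
    infDist a M = dist a p :=
  le_antisymm (infDist_le_dist_of_mem h.1) ((le_infDist ⟨p, h.1⟩).2 fun {x} hx => h.2 x hx)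

lemma isNearest_of_infDist_eq {M : Set E} {a p : E} (hp : p ∈ M) (h : infDist a M = dist a p) :
    IsNearest M a p :=
  ⟨hp, fun _ hx => h ▸ infDist_le_dist_of_mem hx⟩

lemma exists_isNearest {M : Set E} (hM : IsCompact M) (hne : M.Nonempty) (a : E) :
    ∃ p, IsNearest M a p := by
  obtain ⟨p, hp, h⟩ := hM.exists_infDist_eq_dist hne a
  exact ⟨p, isNearest_of_infDist_eq hp h⟩

end Nearest

section Reach

variable {E : Type*} [NormedAddCommGroup E] [InnerProductSpace ℝ E]

/-- Near a point with a unique nearest point in `M`, the distance to `M` grows at a rate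
arbitrarily close to `1` when one moves away from that nearest point. -/
lemma exists_infDist_gt {M : Set E} (hM : IsCompact M) {a p : E} (hp : IsNearest M a p)
    (hpos : 0 < dist a p) (huniq : ∀ q, IsNearest M a q → q = p) {c s : ℝ} (hc : c < 1)
    (hs : 0 < s) :
    ∃ t, 0 < t ∧ t < s ∧ ∃ a', dist a' a ≤ t ∧ infDist a M + c * t < infDist a' M := by
  have hne : M.Nonempty := ⟨p, hp.1⟩
  set w : E := (dist a p)⁻¹ • (a - p) with hw
  have hwn : ‖w‖ = 1 := by
    rw [hw, norm_smul, ← dist_eq_norm, norm_inv, Real.norm_of_nonneg hpos.le,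
      inv_mul_cancel₀ hpos.ne']
  set t : ℕ → ℝ := fun n => s / ((n : ℝ) + 2) with ht
  have ht0 : Tendsto t atTop (𝓝 0) :=
    Tendsto.div_atTop tendsto_const_nhds
      (tendsto_atTop_add_const_right _ _ tendsto_natCast_atTop_atTop)
  have htpos : ∀ n, 0 < t n := fun n => by positivity
  have htlt : ∀ n, t n < s := fun n => by
    rw [ht]; simp only
    rw [div_lt_iff₀ (by positivity)]
    nlinarith [(Nat.cast_nonneg n : (0 : ℝ) ≤ n)]
  choose q hq using fun n => exists_isNearest hM hne (a + t n • w)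
  obtain ⟨q0, hq0, φ, hφ, hlim⟩ := hM.tendsto_subseq fun n => (hq n).1
  have htφ : Tendsto (fun n => t (φ n)) atTop (𝓝 0) := ht0.comp hφ.tendsto_atTop
  have ha : Tendsto (fun n => a + t (φ n) • w) atTop (𝓝 a) := by
    simpa using (tendsto_const_nhds (x := a)).add (htφ.smul_const w)
  have hq0p : q0 = p := by
    refine huniq q0 (isNearest_of_infDist_eq hq0 ?_)
    have h1 := ((continuous_infDist_pt M).tendsto a).comp ha
    have h2 := ha.dist hlim
    refine tendsto_nhds_unique h1 (h2.congr fun n => ?_)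
    exact (hq (φ n)).infDist_eq.symm
  rw [hq0p] at hlim
  -- the unit vectors from the perturbed nearest points to `a` converge to `w`
  have hlim2 : Tendsto (fun n => inner ℝ w (a - q (φ n)) / ‖a - q (φ n)‖) atTop
      (𝓝 (inner ℝ w (a - p) / ‖a - p‖)) := by
    have h1 : Tendsto (fun n => a - q (φ n)) atTop (𝓝 (a - p)) :=
      tendsto_const_nhds.sub hlim
    refine (tendsto_const_nhds.inner h1).div h1.norm ?_
    rw [← dist_eq_norm]; exact hpos.ne'
  have hval : inner ℝ w (a - p) / ‖a - p‖ = 1 := by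
    rw [hw, inner_smul_left, real_inner_self_eq_norm_sq, dist_eq_norm]
    have : ‖a - p‖ ≠ 0 := by rw [← dist_eq_norm]; exact hpos.ne'
    simp only [conj_trivial]
    field_simp
  rw [hval] at hlim2
  obtain ⟨n, hn⟩ := (hlim2.eventually (lt_mem_nhds hc)).exists
  refine ⟨t (φ n), htpos _, htlt _, a + t (φ n) • w, ?_, ?_⟩
  · rw [dist_eq_norm]
    simp [norm_smul, hwn, abs_of_pos (htpos (φ n))]
  · rw [(hq (φ n)).infDist_eq, hp.infDist_eq]
    set v := a - q (φ n) with hv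
    have hvpos : 0 < ‖v‖ := by
      rw [hv, ← dist_eq_norm]; exact hpos.trans_le (hp.2 _ (hq (φ n)).1)
    have h1 : inner ℝ (v + t (φ n) • w) v ≤ ‖v + t (φ n) • w‖ * ‖v‖ := real_inner_le_norm _ _
    rw [inner_add_left, inner_smul_left, real_inner_self_eq_norm_sq] at h1
    simp only [conj_trivial] at h1
    rw [lt_div_iff₀ hvpos] at hn
    have h2 : dist a p ≤ ‖v‖ := by rw [hv, ← dist_eq_norm]; exact hp.2 _ (hq (φ n)).1
    have h3 : dist (a + t (φ n) • w) (q (φ n)) = ‖v + t (φ n) • w‖ := by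
      rw [dist_eq_norm, hv]; congr 1; abel
    rw [h3]
    have h4 := mul_lt_mul_of_pos_left hn (htpos (φ n))
    by_contra hcon
    push Not at hcon
    have h5 : ‖v + t (φ n) • w‖ * ‖v‖ ≤ (dist a p + c * t (φ n)) * ‖v‖ :=
      mul_le_mul_of_nonneg_right hcon hvpos.le
    nlinarith

/-- If nearest points are unique on a ball that avoids `M`, then somewhere on the ball the distance
to `M` exceeds its value at the centre by the full radius. -/
lemma exists_infDist_ge [ProperSpace E] {M : Set E} (hM : IsCompact M) (hne : M.Nonempty) {y : E}
    {s : ℝ} (hs : 0 < s) (hpos : s < infDist y M)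
    (huniq : ∀ a ∈ closedBall y s, ∀ p q, IsNearest M a p → IsNearest M a q → p = q) :
    ∃ a ∈ closedBall y s, infDist y M + s ≤ infDist a M := by
  obtain ⟨a, ha, hmax⟩ := (isCompact_closedBall y s).exists_isMaxOn
    ⟨y, mem_closedBall_self hs.le⟩ (continuous_infDist_pt M).continuousOn
  refine ⟨a, ha, ?_⟩
  have key : ∀ c : ℝ, 0 < c → c < 1 → infDist y M + c * s ≤ infDist a M := by
    intro c hc0 hc
    -- an interior maximum of the penalized distance contradicts its growth at a rate above `c`
    obtain ⟨z, hz, hzmax⟩ := (isCompact_closedBall y s).exists_isMaxOn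
      ⟨y, mem_closedBall_self hs.le⟩
      (f := fun x => infDist x M - c * dist x y) (by fun_prop)
    have hz' : dist z y ≤ s := hz
    have h0 := hzmax (mem_closedBall_self hs.le)
    simp only [dist_self, mul_zero, sub_zero, mem_ofPred_eq] at h0
    rcases hz'.lt_or_eq with hlt | heq
    · exfalso
      obtain ⟨p, hp⟩ := exists_isNearest hM hne z
      have hzpos : 0 < dist z p := by
        rw [← hp.infDist_eq]
        have := infDist_le_infDist_add_dist (s := M) (x := y) (y := z)
        rw [dist_comm] at this; linarith
      obtain ⟨t, ht0, hts, a', ha', hgt⟩ := exists_infDist_gt hM hp hzpos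
        (fun q hq => huniq z hz q p hq hp) hc (sub_pos.2 hlt)
      have htri := dist_triangle a' z y
      have h1 := hzmax (show a' ∈ closedBall y s by rw [mem_closedBall]; linarith)
      simp only [mem_ofPred_eq] at h1
      nlinarith
    · rw [heq] at h0
      have := hmax hz
      simp only [mem_ofPred_eq] at this
      linarith
  by_contra hcon
  push Not at hcon
  have h1 := key (1 / 2) (by norm_num) (by norm_num)
  have h2 : (infDist a M - infDist y M) / s < 1 := by rw [div_lt_one hs]; linarith
  have h3 : 0 < (infDist a M - infDist y M) / s := by
    apply div_pos _ hs
    nlinarith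
  have h4 := key (((infDist a M - infDist y M) / s + 1) / 2) (by linarith) (by linarith)
  have h5 : (infDist a M - infDist y M) / s * s = infDist a M - infDist y M :=
    div_mul_cancel₀ _ hs.ne'
  nlinarith

/-- If nearest points are unique up to distance `r`, then a segment of proximal normals extends up
to length `r`. -/
lemma isNearest_extend [ProperSpace E] {M : Set E} (hM : IsCompact M) {r : ℝ}
    (huniq : ∀ a, infDist a M ≤ r → ∀ p q, IsNearest M a p → IsNearest M a q → p = q)
    {p u : E} (hu : ‖u‖ = 1) {t₀ : ℝ} (ht₀ : 0 < t₀) (h₀ : IsNearest M (p + t₀ • u) p)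
    (hr : 0 < r) : IsNearest M (p + r • u) p := by
  have hpM := h₀.1
  have hdist : ∀ t : ℝ, 0 ≤ t → dist (p + t • u) p = t := fun t ht => by
    simp [dist_eq_norm, norm_smul, hu, abs_of_nonneg ht]
  have hdist2 : ∀ t t' : ℝ, t ≤ t' → dist (p + t • u) (p + t' • u) = t' - t := fun t t' h => by
    rw [dist_comm, dist_eq_norm, add_sub_add_left_eq_sub, ← sub_smul, norm_smul, hu, mul_one,
      Real.norm_of_nonneg (sub_nonneg.2 h)]
  have hdown : ∀ t t' : ℝ, 0 ≤ t → t ≤ t' → infDist (p + t' • u) M = t' →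
      infDist (p + t • u) M = t := by
    intro t t' ht htt h
    apply le_antisymm
    · exact (infDist_le_dist_of_mem hpM).trans_eq (hdist t ht)
    · have := infDist_le_infDist_add_dist (s := M) (x := p + t' • u) (y := p + t • u)
      rw [dist_comm, hdist2 t t' htt] at this; linarith
  have h₀' : infDist (p + t₀ • u) M = t₀ := by rw [h₀.infDist_eq, hdist _ ht₀.le]
  set S : Set ℝ := Icc 0 r ∩ {t | infDist (p + t • u) M = t} with hS
  have hScl : IsCompact S := by
    refine isCompact_Icc.inter_right (isClosed_eq ?_ continuous_id)
    exact (continuous_infDist_pt M).comp (by fun_prop)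
  have hmem : min t₀ r ∈ S :=
    ⟨⟨(lt_min ht₀ hr).le, min_le_right _ _⟩,
      hdown _ t₀ (lt_min ht₀ hr).le (min_le_left _ _) h₀'⟩
  -- at the largest `τ ≤ r` reached by the segment, the segment could still be prolonged
  obtain ⟨τ, hτ, hmax⟩ := hScl.exists_isMaxOn ⟨_, hmem⟩ continuousOn_id
  have hτpos : 0 < τ := (lt_min ht₀ hr).trans_le (hmax hmem)
  have hτ2 : infDist (p + τ • u) M = τ := hτ.2
  rcases hτ.1.2.lt_or_eq with hlt | heq
  · exfalso
    set s := min (r - τ) τ / 2 with hs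
    have hmin : 0 < min (r - τ) τ := lt_min (by linarith) hτpos
    have hs0 : 0 < s := by positivity
    have hs1 : s ≤ (r - τ) / 2 := by rw [hs]; gcongr; exact min_le_left _ _
    have hs2 : s ≤ τ / 2 := by rw [hs]; gcongr; exact min_le_right _ _
    obtain ⟨a, ha, hage⟩ := exists_infDist_ge hM ⟨p, hpM⟩ (y := p + τ • u) hs0
      (by rw [hτ2]; linarith) (fun a ha => huniq a (by
        have h1 : dist a (p + τ • u) ≤ s := ha
        have := infDist_le_infDist_add_dist (s := M) (x := a) (y := p + τ • u)
        rw [hτ2] at this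
        linarith))
    rw [hτ2] at hage
    have h1 : dist a (p + τ • u) ≤ s := ha
    have h2 : τ + s ≤ dist a p := hage.trans (infDist_le_dist_of_mem hpM)
    -- equality in the triangle inequality forces `a` onto the ray
    have hau : a = p + (τ + s) • u := by
      set e := a - (p + τ • u) with he
      have h3 : ‖e‖ ≤ s := by rw [he, ← dist_eq_norm]; exact h1
      have h4 : τ + s ≤ ‖τ • u + e‖ := by
        have : τ • u + e = a - p := by rw [he]; abel
        rw [this, ← dist_eq_norm]; exact h2
      have h5 : ‖τ • u + e‖ ^ 2 = τ ^ 2 + 2 * τ * inner ℝ u e + ‖e‖ ^ 2 := by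
        rw [norm_add_sq_real, inner_smul_left, norm_smul, hu]
        simp only [conj_trivial, Real.norm_eq_abs, mul_one, sq_abs]; ring
      have h6 : (τ + s) ^ 2 ≤ ‖τ • u + e‖ ^ 2 := by gcongr
      have h7 : ‖e - s • u‖ ^ 2 = ‖e‖ ^ 2 - 2 * s * inner ℝ u e + s ^ 2 := by
        rw [norm_sub_sq_real, inner_smul_right, norm_smul, hu, real_inner_comm]
        simp only [Real.norm_eq_abs, mul_one, sq_abs]; ring
      have h8 : ‖e‖ ^ 2 ≤ s ^ 2 := by gcongr
      have h9 : s ≤ inner ℝ u e := by nlinarith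
      have h10 : ‖e - s • u‖ ^ 2 ≤ 0 := by nlinarith
      have h11 : e - s • u = 0 := by
        have : ‖e - s • u‖ = 0 := by nlinarith [norm_nonneg (e - s • u)]
        exact norm_eq_zero.1 this
      have h12 : a = p + τ • u + e := by rw [he]; abel
      rw [h12, sub_eq_zero.1 h11, add_smul]; abel
    rw [hau] at hage
    have hmem2 : τ + s ∈ S := by
      refine ⟨⟨by linarith, by linarith⟩, le_antisymm ?_ hage⟩
      exact (infDist_le_dist_of_mem hpM).trans_eq (hdist _ (by linarith))
    have := hmax hmem2
    simp only [id, mem_ofPred_eq] at this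
    linarith
  · rw [heq] at hτ2
    exact isNearest_of_infDist_eq hpM (by rw [hτ2, hdist _ hr.le])

/-- The uniqueness of nearest points up to the reach. -/
lemma exists_uniq_of_lt_reach {F : Type*} [NormedAddCommGroup F] [NormedSpace ℝ F] {M : Set F}
    {t : ℝ} (ht : ENNReal.ofReal t < reach M) :
    ∃ r, t < r ∧ ∀ a, infDist a M ≤ r → ∀ p q, IsNearest M a p → IsNearest M a q → p = q := by
  obtain ⟨ρ, ⟨r, hr, rfl, huniq⟩, hlt⟩ := lt_sSup_iff.1 ht
  refine ⟨r, (ENNReal.ofReal_lt_ofReal_iff' .. |>.1 hlt).1, fun a ha p q hp hq => ?_⟩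
  have : a ∈ ⋃ x ∈ M, closedBall x r :=
    mem_iUnion₂.2 ⟨p, hp.1, by rw [mem_closedBall, ← hp.infDist_eq]; exact ha⟩
  exact (huniq a this).unique hp hq

/-- The fundamental consequence of positive reach (Federer): a set of reach at least `1/κ` lies
outside of the balls of radius `1/κ` that are tangent to it at `p` along a proximal normal. -/
theorem IsNearest.inner_le [ProperSpace E] {M : Set E} (hM : IsCompact M) {κ : ℝ} (hκ : 0 < κ)
    (hreach : ENNReal.ofReal (1 / κ) ≤ reach M) {a p x : E} (hp : IsNearest M a p) (hx : x ∈ M) :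
    inner ℝ (x - p) (a - p) ≤ κ / 2 * ‖a - p‖ * ‖x - p‖ ^ 2 := by
  rcases eq_or_ne a p with rfl | hne
  · simp
  have hn : 0 < ‖a - p‖ := norm_pos_iff.2 (sub_ne_zero.2 hne)
  set u : E := ‖a - p‖⁻¹ • (a - p) with hu
  have hun : ‖u‖ = 1 := by rw [hu, norm_smul, norm_inv, norm_norm, inv_mul_cancel₀ hn.ne']
  have hau : a - p = ‖a - p‖ • u := by rw [hu, smul_smul, mul_inv_cancel₀ hn.ne', one_smul]
  have h₀ : IsNearest M (p + ‖a - p‖ • u) p := by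
    rw [← hau, add_sub_cancel]; exact hp
  -- `x` lies outside of the open ball of radius `t` around `p + t u`
  have key : ∀ t : ℝ, 0 < t → t < 1 / κ → 2 * t * inner ℝ (x - p) u ≤ ‖x - p‖ ^ 2 := by
    intro t ht htκ
    obtain ⟨r, hr, huniq⟩ := exists_uniq_of_lt_reach (t := t)
      (((ENNReal.ofReal_lt_ofReal_iff (by positivity)).2 htκ).trans_le hreach)
    have h1 := (isNearest_extend hM (r := t) (fun a ha => huniq a (ha.trans hr.le)) hun hn h₀
      ht).2 x hx
    rw [dist_comm _ p, dist_comm _ x, dist_eq_norm, dist_eq_norm, sub_add_cancel_left, norm_neg,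
      norm_smul, hun, mul_one, Real.norm_of_nonneg ht.le, ← sub_sub] at h1
    have h2 : t ^ 2 ≤ ‖x - p - t • u‖ ^ 2 := by gcongr
    rw [norm_sub_sq_real, inner_smul_right, norm_smul, hun, mul_one,
      Real.norm_of_nonneg ht.le] at h2
    linarith
  have hlim : 2 * (1 / κ) * inner ℝ (x - p) u ≤ ‖x - p‖ ^ 2 := by
    have hT : Tendsto (fun t : ℝ => 2 * t * inner ℝ (x - p) u) (𝓝[<] (1 / κ))
        (𝓝 (2 * (1 / κ) * inner ℝ (x - p) u)) := by
      apply tendsto_nhdsWithin_of_tendsto_nhds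
      exact Continuous.tendsto (by fun_prop) _
    refine le_of_tendsto hT ?_
    have hpos : (0 : ℝ) < 1 / κ := by positivity
    filter_upwards [Ioo_mem_nhdsLT hpos] with t ht using key t ht.1 ht.2
  rw [hau, inner_smul_right]
  have : inner ℝ (x - p) u ≤ κ / 2 * ‖x - p‖ ^ 2 := by
    have h3 : 2 * (1 / κ) * inner ℝ (x - p) u * (κ / 2) ≤ ‖x - p‖ ^ 2 * (κ / 2) := by gcongr
    have h4 : 2 * (1 / κ) * inner ℝ (x - p) u * (κ / 2) = inner ℝ (x - p) u := by field_simp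
    linarith
  rw [norm_smul, norm_norm, hun]
  nlinarith

/-- Nearest points depend in a Lipschitz way on the point that is projected. -/
lemma IsNearest.norm_sub_le [ProperSpace E] {M : Set E} (hM : IsCompact M) {κ : ℝ} (hκ : 0 < κ)
    (hreach : ENNReal.ofReal (1 / κ) ≤ reach M) {a b p q : E} {s : ℝ} (hp : IsNearest M a p)
    (hq : IsNearest M b q) (ha : ‖a - p‖ ≤ s) (hb : ‖b - q‖ ≤ s) :
    (1 - κ * s) * ‖p - q‖ ≤ ‖a - b‖ := by
  have h1 := hp.inner_le hM hκ hreach hq.1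
  have h2 := hq.inner_le hM hκ hreach hp.1
  have h3 : inner ℝ (p - q) (a - b) ≤ ‖p - q‖ * ‖a - b‖ := real_inner_le_norm _ _
  have h4 : inner ℝ (p - q) (a - b) = ‖p - q‖ ^ 2 - inner ℝ (q - p) (a - p)
      - inner ℝ (p - q) (b - q) := by
    have : a - b = (p - q) + (a - p) - (b - q) := by abel
    rw [this, inner_sub_right, inner_add_right, real_inner_self_eq_norm_sq,
      ← neg_sub q p, inner_neg_left (q - p) (a - p)]
    ring
  rw [norm_sub_rev q p] at h1
  have h5 : κ / 2 * ‖a - p‖ * ‖p - q‖ ^ 2 ≤ κ / 2 * s * ‖p - q‖ ^ 2 := by gcongr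
  have h6 : κ / 2 * ‖b - q‖ * ‖p - q‖ ^ 2 ≤ κ / 2 * s * ‖p - q‖ ^ 2 := by gcongr
  rcases (norm_nonneg (p - q)).eq_or_lt with h0 | h0
  · rw [← h0]; simp
  · have : ‖p - q‖ * ((1 - κ * s) * ‖p - q‖) ≤ ‖p - q‖ * ‖a - b‖ := by nlinarith
    exact le_of_mul_le_mul_left this h0

end Reach

/-! ### Tangent spaces of a submanifold -/

section Tangent

variable {E : Type*} [NormedAddCommGroup E] [InnerProductSpace ℝ E]

/-- `T` is the tangent space at `p` of the `d`-dimensional `C²` submanifold `M`, computed in some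
regular parametrization `φ` of `M` around `p`. -/
def IsTangent (d : ℕ) (M : Set E) (p : E) (T : Submodule ℝ E) : Prop :=
  ∃ (U : Set E) (V : Set (EuclideanSpace ℝ (Fin d)))
    (φ : EuclideanSpace ℝ (Fin d) → E) (ψ : E → EuclideanSpace ℝ (Fin d))
    (v : EuclideanSpace ℝ (Fin d)),
    IsOpen U ∧ p ∈ U ∧ IsOpen V ∧ ContDiffOn ℝ 2 φ V ∧
    (∀ v ∈ V, Function.Injective (fderiv ℝ φ v)) ∧
    φ '' V = M ∩ U ∧ ContinuousOn ψ (M ∩ U) ∧ (∀ v ∈ V, ψ (φ v) = v) ∧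
    v ∈ V ∧ φ v = p ∧ T = LinearMap.range (fderiv ℝ φ v : EuclideanSpace ℝ (Fin d) →ₗ[ℝ] E)

lemma IsC2Submanifold.exists_isTangent {d : ℕ} {M : Set E} (hM : IsC2Submanifold d M) {p : E}
    (hp : p ∈ M) : ∃ T, IsTangent d M p T := by
  obtain ⟨U, V, φ, ψ, hU, hpU, hV, hφ, hinj, him, hψ, hψφ⟩ := hM p hp
  obtain ⟨v, hv, hvp⟩ : p ∈ φ '' V := him ▸ ⟨hp, hpU⟩
  exact ⟨_, U, V, φ, ψ, v, hU, hpU, hV, hφ, hinj, him, hψ, hψφ, hv, hvp, rfl⟩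

lemma IsTangent.finrank_eq {d : ℕ} {M : Set E} {p : E} {T : Submodule ℝ E}
    (hT : IsTangent d M p T) : Module.finrank ℝ T = d := by
  obtain ⟨U, V, φ, ψ, v, hU, hpU, hV, hφ, hinj, him, hψ, hψφ, hv, hvp, rfl⟩ := hT
  rw [LinearMap.finrank_range_of_inj (hinj v hv), finrank_euclideanSpace_fin]

lemma IsTangent.finiteDimensional {d : ℕ} {M : Set E} {p : E} {T : Submodule ℝ E}
    (hT : IsTangent d M p T) : FiniteDimensional ℝ T := by
  obtain ⟨U, V, φ, ψ, v, hU, hpU, hV, hφ, hinj, him, hψ, hψφ, hv, hvp, rfl⟩ := hT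
  infer_instance

lemma exists_lower_bound_of_injective {F : Type*} [NormedAddCommGroup F] [NormedSpace ℝ F]
    [FiniteDimensional ℝ F] (A : F →L[ℝ] E) (hA : Function.Injective A) :
    ∃ c, 0 < c ∧ ∀ w, c * ‖w‖ ≤ ‖A w‖ := by
  obtain ⟨K, hK, h⟩ := LinearMap.exists_antilipschitzWith (A : F →ₗ[ℝ] E)
    (LinearMap.ker_eq_bot.2 hA)
  refine ⟨(K : ℝ)⁻¹, by positivity, fun w => ?_⟩
  have h1 := h.le_mul_norm_sub 0 w
  simp only [neg_zero, zero_add, map_zero, ContinuousLinearMap.coe_coe] at h1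
  have hK' : (0 : ℝ) < K := hK
  rw [inv_mul_le_iff₀ hK']
  exact h1

/-- Every normal vector of a `C²` submanifold is, after shrinking, a proximal normal. -/
lemma IsTangent.exists_isNearest {d : ℕ} {M : Set E} {p : E} {T : Submodule ℝ E}
    (hT : IsTangent d M p T) {u : E} (hu : u ∈ Tᗮ) :
    ∃ t : ℝ, 0 < t ∧ IsNearest M (p + t • u) p := by
  obtain ⟨U, V, φ, ψ, v₀, hU, hpU, hV, hφ, hinj, him, hψ, hψφ, hv₀, hvp, rfl⟩ := hT
  have hpM : p ∈ M ∩ U := him ▸ ⟨v₀, hv₀, hvp⟩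
  set A := fderiv ℝ φ v₀ with hA
  obtain ⟨c, hc, hcA⟩ := exists_lower_bound_of_injective A (hinj v₀ hv₀)
  have hAt : ContDiffAt ℝ 2 φ v₀ := hφ.contDiffAt (hV.mem_nhds hv₀)
  obtain ⟨K, W, hW, hLip⟩ := (hAt.fderiv_right (m := 1) (by norm_num)).exists_lipschitzOnWith
  obtain ⟨δ, hδ, hball⟩ := Metric.mem_nhds_iff.1 (inter_mem hW (hV.mem_nhds hv₀))
  -- Taylor's formula with a quadratic remainder
  have htaylor : ∀ v ∈ ball v₀ δ, ‖φ v - φ v₀ - A (v - v₀)‖ ≤ K * ‖v - v₀‖ ^ 2 := by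
    intro v hv
    have hsub : closedBall v₀ ‖v - v₀‖ ⊆ W ∩ V := fun x hx => hball (by
      rw [mem_ball] at hv ⊢; rw [mem_closedBall, ← dist_eq_norm] at hx; linarith)
    have := Convex.norm_image_sub_le_of_norm_fderiv_le' (𝕜 := ℝ) (f := φ) (φ := A)
      (C := K * ‖v - v₀‖) (s := closedBall v₀ ‖v - v₀‖) (x := v₀) (y := v)
      (fun x hx => (hφ.contDiffAt (hV.mem_nhds (hsub hx).2)).differentiableAt (by norm_num))
      (fun x hx => (hLip.norm_sub_le (hsub hx).1
        (hsub (mem_closedBall_self (norm_nonneg _))).1).trans (by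
          rw [mem_closedBall, dist_eq_norm] at hx; gcongr))
      (convex_closedBall _ _) (mem_closedBall_self (norm_nonneg _))
      (by rw [mem_closedBall, dist_eq_norm])
    calc _ ≤ _ := this
      _ = _ := by ring
  -- the second entry makes the Taylor remainder at most half of the linear term
  set δ' := min δ (c / (2 * (K + 1))) with hδ'
  have hδ'0 : 0 < δ' := by positivity
  have hcont : ∀ᶠ x in 𝓝[M ∩ U] p, ψ x ∈ ball v₀ δ' := by
    have h1 := hψ p hpM
    rw [ContinuousWithinAt, ← hvp, hψφ v₀ hv₀, hvp] at h1
    exact h1 (ball_mem_nhds v₀ hδ'0)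
  rw [nhdsWithin_inter_of_mem' (mem_nhdsWithin_of_mem_nhds (hU.mem_nhds hpU))] at hcont
  have hUev : ∀ᶠ x in 𝓝[M] p, x ∈ U := mem_nhdsWithin_of_mem_nhds (hU.mem_nhds hpU)
  obtain ⟨ρ, hρ, hρsub⟩ := Metric.mem_nhdsWithin_iff.1 (hcont.and hUev)
  set C : ℝ := K * ‖u‖ * (2 / c) ^ 2 with hC
  have hC0 : 0 ≤ C := by positivity
  have hnear : ∀ x ∈ M, dist x p < ρ → inner ℝ (x - p) u ≤ C * ‖x - p‖ ^ 2 := by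
    intro x hx hxρ
    obtain ⟨hxψ, hxU⟩ := hρsub ⟨hxρ, hx⟩
    obtain ⟨v, hv, rfl⟩ : x ∈ φ '' V := him ▸ ⟨hx, hxU⟩
    have hxψ' : ψ (φ v) ∈ ball v₀ δ' := hxψ
    rw [hψφ v hv, mem_ball, dist_eq_norm] at hxψ'
    have h1 := htaylor v (by
      rw [mem_ball, dist_eq_norm]; exact hxψ'.trans_le (min_le_left _ _))
    rw [hvp] at h1
    have h2 : ‖v - v₀‖ * (2 * (K + 1)) ≤ c := by
      rw [← le_div_iff₀ (by positivity)]; exact (hxψ'.trans_le (min_le_right _ _)).le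
    have h3 := hcA (v - v₀)
    have h4 : ‖A (v - v₀)‖ ≤ ‖φ v - p‖ + ‖φ v - p - A (v - v₀)‖ := by
      have := norm_sub_le (φ v - p) (φ v - p - A (v - v₀))
      rwa [sub_sub_cancel] at this
    have h5 : ‖v - v₀‖ ≤ 2 / c * ‖φ v - p‖ := by
      have hKn : (0 : ℝ) ≤ K := K.2
      have : c / 2 * ‖v - v₀‖ ≤ ‖φ v - p‖ := by nlinarith [norm_nonneg (v - v₀)]
      calc ‖v - v₀‖ = 2 / c * (c / 2 * ‖v - v₀‖) := by field_simp
        _ ≤ _ := by gcongr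
    have h6 : inner ℝ (A (v - v₀)) u = 0 :=
      (Submodule.mem_orthogonal _ u).1 hu _ ⟨v - v₀, rfl⟩
    calc inner ℝ (φ v - p) u = inner ℝ (φ v - p - A (v - v₀)) u := by
          rw [inner_sub_left (φ v - p), h6, sub_zero]
      _ ≤ ‖φ v - p - A (v - v₀)‖ * ‖u‖ := real_inner_le_norm _ _
      _ ≤ K * (2 / c * ‖φ v - p‖) ^ 2 * ‖u‖ := by
          gcongr; exact h1.trans (by gcongr)
      _ = _ := by rw [hC]; ring
  -- the first entry deals with the points of `M` near `p`, the second with the others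
  refine ⟨min (1 / (2 * (C + 1))) (ρ / (2 * (‖u‖ + 1))), by positivity, hpM.1, fun x hx => ?_⟩
  set t := min (1 / (2 * (C + 1))) (ρ / (2 * (‖u‖ + 1))) with ht
  have ht0 : 0 < t := by positivity
  have hd1 : dist (p + t • u) p = ‖t • u‖ := by simp [dist_eq_norm]
  have hd2 : dist (p + t • u) x = ‖(x - p) - t • u‖ := by
    rw [dist_comm, dist_eq_norm]; congr 1; abel
  rw [hd1, hd2]
  rcases lt_or_ge (dist x p) ρ with h | h
  · have h1 := hnear x hx h
    have h2 : ‖x - p - t • u‖ ^ 2 = ‖x - p‖ ^ 2 - 2 * (t * inner ℝ (x - p) u) + ‖t • u‖ ^ 2 := by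
      rw [norm_sub_sq_real, inner_smul_right]
    have h3 : t * (2 * (C + 1)) ≤ 1 := by
      rw [← le_div_iff₀ (by positivity)]; exact min_le_left _ _
    have h4 : t * inner ℝ (x - p) u ≤ t * (C * ‖x - p‖ ^ 2) := by gcongr
    refine le_of_sq_le_sq ?_ (norm_nonneg _)
    nlinarith [sq_nonneg ‖x - p‖]
  · have h1 : t * (2 * (‖u‖ + 1)) ≤ ρ := by
      rw [← le_div_iff₀ (by positivity)]; exact min_le_right _ _
    have h2 : ‖t • u‖ = t * ‖u‖ := by rw [norm_smul, Real.norm_of_nonneg ht0.le]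
    have h3 := norm_sub_norm_le (x - p) (t • u)
    rw [dist_eq_norm] at h
    nlinarith

/-- Around every point of `M`, the tangent vectors of `M` are uniformly well approximated by chords
of `M` of every small length. -/
lemma IsC2Submanifold.exists_chord {d : ℕ} {M : Set E} (hM : IsC2Submanifold d M) {p : E}
    (hp : p ∈ M) {η : ℝ} (hη : 0 < η) :
    ∃ W ∈ 𝓝 p, ∃ s₀, 0 < s₀ ∧ ∀ p' ∈ W ∩ M, ∃ T, IsTangent d M p' T ∧
      ∀ e ∈ T, ‖e‖ = 1 → ∀ s, 0 < s → s < s₀ → ∃ z ∈ M, ‖z - p' - s • e‖ ≤ η * s := by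
  obtain ⟨U, V, φ, ψ, hU, hpU, hV, hφ, hinj, him, hψ, hψφ⟩ := hM p hp
  obtain ⟨v₀, hv₀, hvp⟩ : p ∈ φ '' V := him ▸ ⟨hp, hpU⟩
  set A := fderiv ℝ φ v₀ with hA
  obtain ⟨c, hc, hcA⟩ := exists_lower_bound_of_injective A (hinj v₀ hv₀)
  set η₀ := min (c / 2) (η * c / 4) with hη₀
  have hη₀0 : 0 < η₀ := by positivity
  have hcontd : ContinuousAt (fderiv ℝ φ) v₀ :=
    ((hφ.contDiffAt (hV.mem_nhds hv₀)).fderiv_right (m := 1) (by norm_num)).continuousAt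
  have hev : ∀ᶠ v in 𝓝 v₀, ‖fderiv ℝ φ v - A‖ ≤ η₀ ∧ v ∈ V := by
    filter_upwards [hcontd (closedBall_mem_nhds _ hη₀0), hV.mem_nhds hv₀] with v h1 h2
    exact ⟨by rw [← dist_eq_norm]; exact h1, h2⟩
  obtain ⟨δ, hδ, hball⟩ := Metric.mem_nhds_iff.1 hev
  have hψp : ContinuousWithinAt ψ (M ∩ U) p := hψ p ⟨hp, hpU⟩
  have hcont : ∀ᶠ x in 𝓝[M] p, ψ x ∈ ball v₀ (δ / 2) ∧ x ∈ U := by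
    have h1 : ∀ᶠ x in 𝓝[M ∩ U] p, ψ x ∈ ball v₀ (δ / 2) := by
      rw [ContinuousWithinAt, ← hvp, hψφ v₀ hv₀, hvp] at hψp
      exact hψp (ball_mem_nhds v₀ (by positivity))
    rw [nhdsWithin_inter_of_mem' (mem_nhdsWithin_of_mem_nhds (hU.mem_nhds hpU))] at h1
    exact h1.and (mem_nhdsWithin_of_mem_nhds (hU.mem_nhds hpU))
  obtain ⟨W, hW, hWsub⟩ := mem_nhdsWithin_iff_exists_mem_nhds_inter.1 hcont
  refine ⟨W, hW, δ * c / 4, by positivity, fun p' hp' => ?_⟩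
  obtain ⟨hψp', hp'U⟩ := hWsub hp'
  obtain ⟨v, hv, rfl⟩ : p' ∈ φ '' V := him ▸ ⟨hp'.2, hp'U⟩
  have hvb : ψ (φ v) ∈ ball v₀ (δ / 2) := hψp'
  rw [hψφ v hv, mem_ball, dist_eq_norm] at hvb
  refine ⟨_, ⟨U, V, φ, ψ, v, hU, hp'U, hV, hφ, hinj, him, hψ, hψφ, hv, rfl, rfl⟩, ?_⟩
  rintro e ⟨w, hw⟩ he s hs hs₀
  replace hw : fderiv ℝ φ v w = e := hw
  have hvη := (hball (show v ∈ ball v₀ δ by rw [mem_ball, dist_eq_norm]; linarith)).1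
  have hdiff : ‖(fderiv ℝ φ v - A) w‖ ≤ η₀ * ‖w‖ :=
    ((fderiv ℝ φ v - A).le_opNorm w).trans (by gcongr)
  -- the inverse of the derivative is bounded uniformly near `v₀`
  have hwn : ‖w‖ ≤ 2 / c := by
    have h1 : ‖A w‖ ≤ ‖e‖ + ‖(fderiv ℝ φ v - A) w‖ := by
      rw [sub_apply, hw] at *
      have := norm_sub_le e (e - A w)
      rwa [sub_sub_cancel] at this
    have h2 := hcA w
    have h3 : η₀ * ‖w‖ ≤ c / 2 * ‖w‖ := by gcongr; exact min_le_left _ _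
    rw [le_div_iff₀ hc]
    nlinarith
  have hsw : ‖s • w‖ < δ / 2 := by
    rw [norm_smul, Real.norm_of_nonneg hs.le]
    calc s * ‖w‖ ≤ s * (2 / c) := by gcongr
      _ < δ * c / 4 * (2 / c) := by gcongr
      _ = δ / 2 := by field_simp; norm_num
  have hmem : v + s • w ∈ ball v₀ δ := by
    rw [mem_ball, dist_eq_norm]
    have := norm_add_le (v - v₀) (s • w)
    rw [sub_add_eq_add_sub] at this
    linarith
  have hmv : v ∈ ball v₀ δ := by rw [mem_ball, dist_eq_norm]; linarith
  refine ⟨φ (v + s • w), (him.subset ⟨_, (hball hmem).2, rfl⟩).1, ?_⟩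
  have h1 := Convex.norm_image_sub_le_of_norm_fderiv_le' (𝕜 := ℝ) (f := φ) (φ := A)
      (C := η₀) (s := ball v₀ δ) (x := v) (y := v + s • w)
      (fun x hx => (hφ.contDiffAt (hV.mem_nhds (hball hx).2)).differentiableAt (by norm_num))
      (fun x hx => (hball hx).1) (convex_ball _ _) hmv hmem
  rw [add_sub_cancel_left] at h1
  have h2 : φ (v + s • w) - φ v - s • e
      = (φ (v + s • w) - φ v - A (s • w)) - s • (fderiv ℝ φ v - A) w := by
    rw [sub_apply, hw, map_smul, smul_sub]; abel
  rw [h2]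
  have h3 := norm_sub_le (φ (v + s • w) - φ v - A (s • w)) (s • (fderiv ℝ φ v - A) w)
  rw [norm_smul s, Real.norm_of_nonneg hs.le] at h3
  rw [norm_smul, Real.norm_of_nonneg hs.le] at h1
  have h4 : s * ‖(fderiv ℝ φ v - A) w‖ ≤ s * (η₀ * ‖w‖) := by gcongr
  have h5 : η₀ * (s * ‖w‖) ≤ (η * c / 4) * (s * (2 / c)) := by
    gcongr; exact min_le_right _ _
  have h6 : (η * c / 4) * (s * (2 / c)) = η * s / 2 := by field_simp; norm_num
  nlinarith

/-- A linear map that is onto on the tangent space maps `M` onto a neighbourhood of the image of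
the point. -/
lemma IsTangent.nhds_le_map {d : ℕ} {M : Set E} {p : E} {T : Submodule ℝ E}
    (hT : IsTangent d M p T) {F : Type*} [NormedAddCommGroup F] [NormedSpace ℝ F] [CompleteSpace F]
    [CompleteSpace E] (B : E →L[ℝ] F) (hB : ∀ y, ∃ e ∈ T, B e = y) :
    𝓝 (B p) ≤ map B (𝓝[M] p) := by
  obtain ⟨U, V, φ, ψ, v, hU, hpU, hV, hφ, hinj, him, hψ, hψφ, hv, hvp, rfl⟩ := hT
  have hAt : ContDiffAt ℝ 2 φ v := hφ.contDiffAt (hV.mem_nhds hv)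
  have h1 := (B.hasStrictFDerivAt.comp v (hAt.hasStrictFDerivAt (by norm_num)))
  have h2 := h1.map_nhds_eq_of_surj (by
    rw [LinearMap.range_eq_top]
    intro y
    obtain ⟨e, ⟨w, hw⟩, he⟩ := hB y
    exact ⟨w, by rw [← he, ← hw]; rfl⟩)
  have h3 : Tendsto φ (𝓝 v) (𝓝[M] p) := by
    refine tendsto_nhdsWithin_iff.2 ⟨hvp ▸ hAt.continuousAt, ?_⟩
    filter_upwards [hV.mem_nhds hv] with x hx using (him.subset ⟨x, hx, rfl⟩).1
  rw [← hvp]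
  calc 𝓝 (B (φ v)) = map (B ∘ φ) (𝓝 v) := h2.symm
    _ = map B (map φ (𝓝 v)) := Filter.map_map.symm
    _ ≤ _ := by rw [hvp]; exact map_mono h3

end Tangent

/-! ### Angles between tangent spaces -/

section Angle

variable {E : Type*} [NormedAddCommGroup E] [InnerProductSpace ℝ E]

/-- The sine of the angle by which the subspace `T'` leaves the subspace `T` is at most `a`: the
normal vectors of `T` and the vectors of `T'` satisfy the Cauchy-Schwarz inequality with the
additional factor `a`. -/
def AngleLE (T T' : Submodule ℝ E) (a : ℝ) : Prop :=
  ∀ u ∈ Tᗮ, ∀ e ∈ T', inner ℝ e u ≤ a * (‖e‖ * ‖u‖)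

lemma AngleLE.mono {T T' : Submodule ℝ E} {a a' : ℝ} (h : AngleLE T T' a) (ha : a ≤ a') :
    AngleLE T T' a' :=
  fun u hu e he => (h u hu e he).trans (by gcongr)

lemma exists_orthogonal_decomposition [FiniteDimensional ℝ E] (T : Submodule ℝ E) (e : E) :
    ∃ y ∈ T, ∃ z ∈ Tᗮ, e = y + z ∧ inner ℝ y z = 0 ∧ ‖e‖ ^ 2 = ‖y‖ ^ 2 + ‖z‖ ^ 2 ∧
      ‖y‖ ≤ ‖e‖ ∧ ‖z‖ ≤ ‖e‖ := by
  obtain ⟨y, hy, z, hz, rfl⟩ := T.exists_add_mem_mem_orthogonal e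
  have hyz : inner ℝ y z = 0 := (Submodule.mem_orthogonal _ z).1 hz y hy
  have hsq : ‖y + z‖ ^ 2 = ‖y‖ ^ 2 + ‖z‖ ^ 2 := by
    rw [norm_add_sq_real, hyz]; ring
  refine ⟨y, hy, z, hz, rfl, hyz, hsq, ?_, ?_⟩
  · exact le_of_sq_le_sq (by nlinarith [sq_nonneg ‖z‖]) (norm_nonneg _)
  · exact le_of_sq_le_sq (by nlinarith [sq_nonneg ‖y‖]) (norm_nonneg _)

lemma AngleLE.trans [FiniteDimensional ℝ E] {T T' T'' : Submodule ℝ E} {a a' : ℝ}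
    (h : AngleLE T T' a) (h' : AngleLE T' T'' a') (ha : 0 ≤ a) (ha' : 0 ≤ a') :
    AngleLE T T'' (a + a') := by
  intro u hu e he
  obtain ⟨y, hy, z, hz, rfl, hyz, hsq, hyn, -⟩ := exists_orthogonal_decomposition T' e
  have h1 := h u hu y hy
  have h2 := h' z hz _ he
  rw [inner_add_left, hyz, zero_add, real_inner_self_eq_norm_sq] at h2
  have hzn : ‖z‖ ≤ a' * ‖y + z‖ := by
    rcases (norm_nonneg z).eq_or_lt with h0 | h0
    · rw [← h0]; positivity
    · have : ‖z‖ * ‖z‖ ≤ ‖z‖ * (a' * ‖y + z‖) := by nlinarith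
      exact le_of_mul_le_mul_left this h0
  have h3 : inner ℝ z u ≤ ‖z‖ * ‖u‖ := real_inner_le_norm _ _
  rw [inner_add_left]
  have h4 : a * (‖y‖ * ‖u‖) ≤ a * (‖y + z‖ * ‖u‖) := by gcongr
  have h5 : ‖z‖ * ‖u‖ ≤ a' * ‖y + z‖ * ‖u‖ := by gcongr
  nlinarith

variable [FiniteDimensional ℝ E] {d : ℕ} {M : Set E} {κ : ℝ}

/-- A set of positive reach deviates from its tangent spaces at most quadratically. -/
lemma IsTangent.inner_le (hM : IsCompact M) (hκ : 0 < κ)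
    (hreach : ENNReal.ofReal (1 / κ) ≤ reach M) {p x u : E} {T : Submodule ℝ E}
    (hT : IsTangent d M p T) (hx : x ∈ M) (hu : u ∈ Tᗮ) :
    inner ℝ (x - p) u ≤ κ / 2 * ‖u‖ * ‖x - p‖ ^ 2 := by
  obtain ⟨t, ht, hnear⟩ := hT.exists_isNearest hu
  have h := hnear.inner_le hM hκ hreach hx
  rw [add_sub_cancel_left, inner_smul_right, norm_smul, Real.norm_of_nonneg ht.le] at h
  have : t * inner ℝ (x - p) u ≤ t * (κ / 2 * ‖u‖ * ‖x - p‖ ^ 2) := by nlinarith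
  exact le_of_mul_le_mul_left this ht

/-- Tangent spaces at points at distance at most `s` make an angle of order `κ s`, provided the
second one is well approximated by chords of length about `s`. -/
lemma angleLE_of_chord {p p' : E} {T T' : Submodule ℝ E} (hp' : p' ∈ M) (hκ : 0 < κ)
    (hT : ∀ x ∈ M, ∀ u ∈ Tᗮ, inner ℝ (x - p) u ≤ κ / 2 * ‖u‖ * ‖x - p‖ ^ 2)
    (hT' : ∀ x ∈ M, ∀ u ∈ T'ᗮ, inner ℝ (x - p') u ≤ κ / 2 * ‖u‖ * ‖x - p'‖ ^ 2)
    {s : ℝ} (hs : 0 < s) (hps : ‖p - p'‖ ≤ s)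
    (hchord : ∀ e ∈ T', ‖e‖ = 1 → ∃ z ∈ M, ‖z - p' - s • e‖ ≤ 1 / 10 * s) :
    AngleLE T T' (4 * κ * s) := by
  intro u hu e he
  -- `y` is the tangential part, with respect to `T'`, of the normal vector `y + n` of `T`
  obtain ⟨y, hy, n, hn, rfl, hyn, -, -, -⟩ := exists_orthogonal_decomposition T' u
  have hen : inner ℝ e n = 0 := (Submodule.mem_orthogonal _ n).1 hn e he
  suffices h : ‖y‖ ≤ 4 * κ * s * ‖y + n‖ by
    have h1 : inner ℝ e y ≤ ‖e‖ * ‖y‖ := real_inner_le_norm _ _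
    rw [inner_add_right, hen, add_zero]
    have h2 : ‖e‖ * ‖y‖ ≤ ‖e‖ * (4 * κ * s * ‖y + n‖) := by gcongr
    nlinarith
  rcases (norm_nonneg y).eq_or_lt with h0 | h0
  · rw [← h0]; positivity
  set e₀ : E := ‖y‖⁻¹ • y with he₀
  have he₀n : ‖e₀‖ = 1 := by rw [he₀, norm_smul, norm_inv, norm_norm, inv_mul_cancel₀ h0.ne']
  have he₀T : e₀ ∈ T' := T'.smul_mem _ hy
  -- test both quadratic estimates with the end point `z` of a chord in the direction of `y`
  obtain ⟨z, hz, hzd⟩ := hchord e₀ he₀T he₀n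
  set w := z - p' - s • e₀ with hw
  obtain ⟨τ, hτ, ν, hν, hwdec, hτν, -, hτn, hνn⟩ := exists_orthogonal_decomposition T' w
  have hzp' : z - p' = s • e₀ + τ + ν := by rw [add_assoc, ← hwdec, hw]; abel
  have hse : ‖s • e₀‖ = s := by rw [norm_smul, he₀n, mul_one, Real.norm_of_nonneg hs.le]
  have hzpn : ‖z - p'‖ ≤ 11 / 10 * s := by
    have : z - p' = s • e₀ + w := by rw [hw]; abel
    rw [this]
    have := norm_add_le (s • e₀) w
    linarith
  -- the chord is tangential to `T'` up to second order
  have hν1 : ‖ν‖ ≤ κ / 2 * (11 / 10 * s) ^ 2 := by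
    have h1 := hT' z hz ν hν
    have h2 : inner ℝ (z - p') ν = ‖ν‖ ^ 2 := by
      rw [hzp', inner_add_left, inner_add_left, inner_smul_left, hτν,
        (Submodule.mem_orthogonal _ ν).1 hν e₀ he₀T, real_inner_self_eq_norm_sq]
      ring
    rw [h2] at h1
    have h3 : κ / 2 * ‖ν‖ * ‖z - p'‖ ^ 2 ≤ κ / 2 * ‖ν‖ * (11 / 10 * s) ^ 2 := by gcongr
    rcases (norm_nonneg ν).eq_or_lt with h4 | h4
    · rw [← h4]; positivity
    · have : ‖ν‖ * ‖ν‖ ≤ ‖ν‖ * (κ / 2 * (11 / 10 * s) ^ 2) := by nlinarith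
      exact le_of_mul_le_mul_left this h4
  have hyz : inner ℝ (z - p') (y + n) = s * ‖y‖ + inner ℝ τ y + inner ℝ ν (y + n) := by
    have h1 : inner ℝ e₀ (y + n) = ‖y‖ := by
      rw [inner_add_right, (Submodule.mem_orthogonal _ n).1 hn e₀ he₀T, he₀, inner_smul_left,
        real_inner_self_eq_norm_sq]
      simp only [conj_trivial, add_zero]
      field_simp
    have h2 : inner ℝ τ n = 0 := (Submodule.mem_orthogonal _ n).1 hn τ hτ
    rw [hzp', inner_add_left, inner_add_left, inner_smul_left, h1, inner_add_right τ, h2]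
    simp
  have h1 := hT z hz _ hu
  have h2 := hT p' hp' _ (Submodule.neg_mem _ hu)
  rw [norm_neg, inner_neg_right, norm_sub_rev] at h2
  have h3 : inner ℝ (z - p') (y + n) = inner ℝ (z - p) (y + n) - inner ℝ (p' - p) (y + n) := by
    rw [← inner_sub_left]; congr 1; abel
  have hzp : ‖z - p‖ ≤ 21 / 10 * s := by
    have : z - p = (z - p') - (p - p') := by abel
    rw [this]
    have := norm_sub_le (z - p') (p - p')
    linarith
  have h4 : κ / 2 * ‖y + n‖ * ‖z - p‖ ^ 2 ≤ κ / 2 * ‖y + n‖ * (21 / 10 * s) ^ 2 := by gcongr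
  have h5 : κ / 2 * ‖y + n‖ * ‖p - p'‖ ^ 2 ≤ κ / 2 * ‖y + n‖ * s ^ 2 := by gcongr
  have h6 : -(‖τ‖ * ‖y‖) ≤ inner ℝ τ y := (abs_le.1 (abs_real_inner_le_norm _ _)).1
  have h7 : -(‖ν‖ * ‖y + n‖) ≤ inner ℝ ν (y + n) := (abs_le.1 (abs_real_inner_le_norm _ _)).1
  have h8 : ‖τ‖ * ‖y‖ ≤ 1 / 10 * s * ‖y‖ := by gcongr; exact hτn.trans hzd
  have h9 : ‖ν‖ * ‖y + n‖ ≤ κ / 2 * (11 / 10 * s) ^ 2 * ‖y + n‖ := by gcongr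
  have h10 : (9 / 10 * s) * ‖y‖ ≤ (9 / 10 * s) * (4 * κ * s * ‖y + n‖) := by
    have : 0 ≤ κ * s ^ 2 * ‖y + n‖ := by positivity
    nlinarith
  exact le_of_mul_le_mul_left h10 (by positivity)

/-- The tangent spaces of a compact `C²` submanifold of reach at least `1/κ` rotate, at small
scales, with speed of order `κ`. -/
lemma exists_angleLE (hMc : IsCompact M) (hM : IsC2Submanifold d M) (hκ : 0 < κ)
    (hreach : ENNReal.ofReal (1 / κ) ≤ reach M) :
    ∃ ρ, 0 < ρ ∧ ∀ p ∈ M, ∀ p' ∈ M, ‖p - p'‖ < ρ → ∀ T T', IsTangent d M p T →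
      IsTangent d M p' T' → AngleLE T T' (4 * κ * ‖p - p'‖) := by
  have hloc : ∀ y : M, ∃ W : Set E, IsOpen W ∧ (y : E) ∈ W ∧ ∀ p ∈ W ∩ M, ∀ p' ∈ W ∩ M,
      ∃ T', IsTangent d M p' T' ∧ ∀ T, IsTangent d M p T → AngleLE T T' (4 * κ * ‖p - p'‖) := by
    intro y
    obtain ⟨W, hW, s₀, hs₀, h⟩ := hM.exists_chord y.2 (η := 1 / 10) (by norm_num)
    have hW' : W ∩ ball (y : E) (s₀ / 2) ∈ 𝓝 (y : E) :=
      inter_mem hW (ball_mem_nhds _ (by positivity))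
    obtain ⟨W', hW'sub, hW'o, hyW'⟩ := _root_.mem_nhds_iff.1 hW'
    refine ⟨W', hW'o, hyW', fun p hp p' hp' => ?_⟩
    obtain ⟨T', hT', hch⟩ := h p' ⟨(hW'sub hp'.1).1, hp'.2⟩
    refine ⟨T', hT', fun T hT u hu e he => ?_⟩
    have hlt : ‖p - p'‖ < s₀ := by
      have h1 := (hW'sub hp.1).2
      have h2 := (hW'sub hp'.1).2
      rw [mem_ball] at h1 h2
      rw [← dist_eq_norm]
      have := dist_triangle_right p p' y
      linarith
    -- the chords must have positive length, also if `p = p'`; hence the limit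
    have hT1 : Tendsto (fun s : ℝ => 4 * κ * s * (‖e‖ * ‖u‖)) (𝓝[>] ‖p - p'‖)
        (𝓝 (4 * κ * ‖p - p'‖ * (‖e‖ * ‖u‖))) := by
      apply tendsto_nhdsWithin_of_tendsto_nhds
      exact Continuous.tendsto (by fun_prop) _
    refine ge_of_tendsto hT1 ?_
    filter_upwards [Ioo_mem_nhdsGT hlt] with s hs
    have hs0 : 0 < s := (norm_nonneg _).trans_lt hs.1
    exact angleLE_of_chord hp'.2 hκ (fun x hx u hu => hT.inner_le hMc hκ hreach hx hu)
      (fun x hx u hu => hT'.inner_le hMc hκ hreach hx hu) hs0 hs.1.le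
      (fun e he hen => hch e he hen s hs0 hs.2) u hu e he
  choose W hWo hWy hW using hloc
  obtain ⟨ρ, hρ, hcov⟩ := lebesgue_number_lemma_of_metric hMc hWo
    (fun y hy => mem_iUnion.2 ⟨⟨y, hy⟩, hWy _⟩)
  have hex : ∀ p ∈ M, ∀ p' ∈ M, ‖p - p'‖ < ρ → ∃ T', IsTangent d M p' T' ∧
      ∀ T, IsTangent d M p T → AngleLE T T' (4 * κ * ‖p - p'‖) := by
    intro p hp p' hp' hpp
    obtain ⟨y, hy⟩ := hcov p hp
    exact hW y p ⟨hy (mem_ball_self hρ), hp⟩ p'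
      ⟨hy (by rwa [mem_ball, dist_comm, dist_eq_norm]), hp'⟩
  -- in particular the tangent space at a point is unique
  have huniq : ∀ p ∈ M, ∀ T T', IsTangent d M p T → IsTangent d M p T' → T = T' := by
    intro p hp
    obtain ⟨T₀, hT₀, h₀⟩ := hex p hp p hp (by simpa using hρ)
    have hT₀' : ∀ T, IsTangent d M p T → T₀ = T := by
      intro T hT
      have h1 := h₀ T hT
      refine Submodule.eq_of_le_of_finrank_eq ?_ (hT₀.finrank_eq.trans hT.finrank_eq.symm)
      intro e he
      rw [← T.orthogonal_orthogonal, Submodule.mem_orthogonal']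
      intro u hu
      have h2 := h1 u hu e he
      have h3 := h1 _ (Submodule.neg_mem _ hu) e he
      rw [inner_neg_right] at h3
      simp only [sub_self, norm_zero, mul_zero, zero_mul] at h2 h3
      linarith
    intro T T' hT hT'
    rw [← hT₀' T hT, ← hT₀' T' hT']
  refine ⟨ρ, hρ, fun p hp p' hp' hpp T T' hT hT' => ?_⟩
  obtain ⟨T'', hT'', h⟩ := hex p hp p' hp' hpp
  rw [huniq p' hp' T' T'' hT' hT'']
  exact h T hT

/-- Tangent spaces of a compact `C²` submanifold of reach at least `1/κ`: the sine of the angle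
between those at `p` and `q` is at most `5 κ ‖p - q‖`. The bound is integrated along the projection
to `M` of the segment from `p` to `q`. -/
theorem IsTangent.angleLE (hMc : IsCompact M) (hM : IsC2Submanifold d M) (hκ : 0 < κ)
    (hreach : ENNReal.ofReal (1 / κ) ≤ reach M) {p q : E} (hp : p ∈ M) (hq : q ∈ M)
    (hpq : κ * ‖p - q‖ ≤ 1 / 4) {T T' : Submodule ℝ E} (hT : IsTangent d M p T)
    (hT' : IsTangent d M q T') : AngleLE T T' (5 * κ * ‖p - q‖) := by
  obtain ⟨ρ, hρ, hloc⟩ := exists_angleLE hMc hM hκ hreach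
  -- project equidistant points of the segment, dense enough for the local estimate
  obtain ⟨N, hN⟩ := exists_nat_gt (8 / 7 * ‖p - q‖ / ρ)
  have hN0 : (0 : ℝ) < N := lt_of_le_of_lt (by positivity) hN
  set a : ℕ → E := fun i => p + ((i : ℝ) / N) • (q - p) with ha
  choose γ hγ using fun i => AWC.exists_isNearest hMc ⟨p, hp⟩ (a i)
  have hγ0 : γ 0 = p := by
    have h1 := (hγ 0).2 p hp
    simp only [ha, Nat.cast_zero, zero_div, zero_smul, add_zero, dist_self] at h1
    exact (dist_le_zero.1 h1).symm
  have hγN : γ N = q := by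
    have h1 := (hγ N).2 q hq
    have h2 : a N = q := by simp [ha, hN0.ne']
    rw [h2, dist_self] at h1
    exact (dist_le_zero.1 h1).symm
  have hdist : ∀ i, i ≤ N → ‖a i - γ i‖ ≤ ‖p - q‖ / 2 := by
    intro i hi
    have hi' : (i : ℝ) / N ≤ 1 := by
      rw [div_le_one hN0]; exact_mod_cast hi
    have hi0 : 0 ≤ (i : ℝ) / N := by positivity
    rcases le_total ((i : ℝ) / N) (1 / 2) with h | h
    · have h1 := (hγ i).2 p hp
      rw [dist_eq_norm, dist_eq_norm, ha] at h1
      simp only [add_sub_cancel_left] at h1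
      rw [norm_smul, Real.norm_of_nonneg hi0, norm_sub_rev q p] at h1
      nlinarith [norm_nonneg (p - q)]
    · have h1 := (hγ i).2 q hq
      have h2 : a i - q = (1 - (i : ℝ) / N) • (p - q) := by
        rw [ha, sub_smul, one_smul]; simp only [smul_sub]; abel
      rw [dist_eq_norm, dist_eq_norm, h2, norm_smul, Real.norm_of_nonneg (by linarith)] at h1
      nlinarith [norm_nonneg (p - q)]
  -- the projection is Lipschitz with constant `1 / (1 - κ ‖p - q‖ / 2) ≤ 8 / 7` along the segment
  have hstep : ∀ i, i < N → ‖γ i - γ (i + 1)‖ ≤ 8 / 7 * ‖p - q‖ / N := by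
    intro i hi
    have h1 := (hγ i).norm_sub_le hMc hκ hreach (hγ (i + 1)) (hdist i hi.le) (hdist (i + 1) hi)
    have h2 : ‖a i - a (i + 1)‖ = ‖p - q‖ / N := by
      have : a i - a (i + 1) = (1 / (N : ℝ)) • (p - q) := by
        simp only [ha]
        rw [add_sub_add_left_eq_sub, ← sub_smul, ← neg_sub p q, smul_neg, ← neg_smul]
        congr 1; push_cast; ring
      rw [this, norm_smul, Real.norm_of_nonneg (by positivity)]; ring
    rw [h2] at h1
    have h3 : 7 / 8 * ‖γ i - γ (i + 1)‖ ≤ ‖p - q‖ / N := by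
      refine le_trans ?_ h1
      gcongr; linarith
    have h4 : 8 / 7 * ‖p - q‖ / N = 8 / 7 * (‖p - q‖ / N) := by ring
    rw [h4]; linarith
  have hℓ : 8 / 7 * ‖p - q‖ / N < ρ := by
    rw [div_lt_iff₀ hρ] at hN
    rw [div_lt_iff₀ hN0]; linarith
  have hchain : ∀ i, i ≤ N → ∀ T'', IsTangent d M (γ i) T'' →
      AngleLE T T'' ((i : ℝ) * (4 * κ * (8 / 7 * ‖p - q‖ / N))) := by
    intro i
    induction i with
    | zero =>
      intro _ T'' hT''
      rw [hγ0] at hT''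
      have := hloc p hp p hp (by simpa using hρ) T T'' hT hT''
      simpa using this
    | succ i ih =>
      intro hi T'' hT''
      obtain ⟨T₁, hT₁⟩ := hM.exists_isTangent (hγ i).1
      have h1 := ih (by omega) T₁ hT₁
      have h2 := (hloc _ (hγ i).1 _ (hγ (i + 1)).1 ((hstep i hi).trans_lt hℓ) _ _ hT₁ hT'').mono
        (mul_le_mul_of_nonneg_left (hstep i hi) (by positivity))
      refine (h1.trans h2 (by positivity) (by positivity)).mono (le_of_eq ?_)
      push_cast; ring
  refine (hchain N le_rfl T' (hγN ▸ hT')).mono ?_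
  have : (N : ℝ) * (4 * κ * (8 / 7 * ‖p - q‖ / N)) = 32 / 7 * κ * ‖p - q‖ := by
    field_simp; ring
  rw [this]
  gcongr; norm_num

end Angle

open scoped Pointwise

/-! ### Projection to a tangent space -/

section Frame

variable {E : Type*} [NormedAddCommGroup E] [InnerProductSpace ℝ E] {d : ℕ}

/-- `B` gives the orthonormal coordinates of the orthogonal projection to the `d`-dimensional
subspace `T`, and `N` is the orthogonal projection to the complement of `T`. -/
structure IsFrame (T : Submodule ℝ E) (B : E →L[ℝ] EuclideanSpace ℝ (Fin d)) (N : E →L[ℝ] E) :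
    Prop where
  norm_sq : ∀ x, ‖x‖ ^ 2 = ‖B x‖ ^ 2 + ‖N x‖ ^ 2
  mem_orthogonal : ∀ x, N x ∈ Tᗮ
  sub_mem : ∀ x, x - N x ∈ T

lemma exists_isFrame [FiniteDimensional ℝ E] {T : Submodule ℝ E} (hT : Module.finrank ℝ T = d) :
    ∃ (B : E →L[ℝ] EuclideanSpace ℝ (Fin d)) (N : E →L[ℝ] E), IsFrame T B N := by
  subst hT
  refine ⟨((stdOrthonormalBasis ℝ T).repr.toContinuousLinearEquiv :
    T →L[ℝ] EuclideanSpace ℝ (Fin (Module.finrank ℝ T))).comp T.orthogonalProjectionOnto,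
    Tᗮ.starProjection, ?_, ?_, ?_⟩
  · intro x
    rw [Submodule.norm_sq_eq_add_norm_sq_starProjection x T]
    congr 2
    rw [Submodule.starProjection_apply]
    exact ((stdOrthonormalBasis ℝ T).repr.norm_map _).symm
  · intro x; exact Submodule.starProjection_apply_mem _ _
  · intro x
    have h := Submodule.sub_starProjection_mem_orthogonal (K := Tᗮ) x
    rwa [T.orthogonal_orthogonal] at h

namespace IsFrame

variable {T : Submodule ℝ E} {B : E →L[ℝ] EuclideanSpace ℝ (Fin d)} {N : E →L[ℝ] E}

lemma norm_le (h : IsFrame T B N) (x : E) : ‖B x‖ ≤ ‖x‖ :=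
  le_of_sq_le_sq (by rw [h.norm_sq x]; nlinarith [sq_nonneg ‖N x‖]) (norm_nonneg _)

lemma norm_le_add (h : IsFrame T B N) (x : E) : ‖x‖ ≤ ‖B x‖ + ‖N x‖ :=
  le_of_sq_le_sq (by
    rw [h.norm_sq x]; nlinarith [mul_nonneg (norm_nonneg (B x)) (norm_nonneg (N x))])
    (by positivity)

lemma inner_normal (h : IsFrame T B N) (x : E) : inner ℝ x (N x) = ‖N x‖ ^ 2 := by
  have h1 : inner ℝ (x - N x) (N x) = 0 :=
    (Submodule.mem_orthogonal _ _).1 (h.mem_orthogonal x) _ (h.sub_mem x)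
  rw [inner_sub_left, real_inner_self_eq_norm_sq] at h1
  linarith

lemma norm_le_mul {σ : ℝ} (hσ : 0 ≤ σ) (hσ1 : σ ≤ 1 / 2) (h : IsFrame T B N) {x : E}
    (hx : ‖N x‖ ≤ σ * ‖x‖) : ‖x‖ ≤ (1 + σ) * ‖B x‖ := by
  refine le_of_sq_le_sq ?_ (by positivity)
  have h1 := h.norm_sq x
  have h2 : ‖N x‖ ^ 2 ≤ (σ * ‖x‖) ^ 2 := by gcongr
  have h3 : (1 - σ ^ 2) * ‖x‖ ^ 2 ≤ ‖B x‖ ^ 2 := by nlinarith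
  have h4 : 1 ≤ (1 + σ) ^ 2 * (1 - σ ^ 2) := by nlinarith [pow_nonneg hσ 3, mul_nonneg hσ hσ]
  calc ‖x‖ ^ 2 ≤ ((1 + σ) ^ 2 * (1 - σ ^ 2)) * ‖x‖ ^ 2 := by nlinarith [sq_nonneg ‖x‖]
    _ = (1 + σ) ^ 2 * ((1 - σ ^ 2) * ‖x‖ ^ 2) := by ring
    _ ≤ (1 + σ) ^ 2 * ‖B x‖ ^ 2 := by gcongr
    _ = _ := by ring

/-- A frame of `T` is onto on every subspace of the same dimension that makes an acute angle
with `T`. -/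
lemma surjective_of_angleLE (h : IsFrame T B N) {T' : Submodule ℝ E}
    [FiniteDimensional ℝ T'] (hd : Module.finrank ℝ T' = d) {a : ℝ} (ha : a < 1)
    (hT' : AngleLE T T' a) (y : EuclideanSpace ℝ (Fin d)) : ∃ e ∈ T', B e = y := by
  have hinj : Function.Injective ((B : E →ₗ[ℝ] EuclideanSpace ℝ (Fin d)).domRestrict T') := by
    rw [← LinearMap.ker_eq_bot, LinearMap.ker_eq_bot']
    rintro ⟨e, he⟩ h0
    have h0' : B e = 0 := h0
    have h1 := h.norm_sq e
    rw [h0', norm_zero] at h1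
    have h3 := hT' _ (h.mem_orthogonal e) e he
    rw [h.inner_normal] at h3
    have h4 : ‖e‖ = ‖N e‖ := by
      rw [← abs_of_nonneg (norm_nonneg e), ← abs_of_nonneg (norm_nonneg (N e)),
        ← sq_eq_sq_iff_abs_eq_abs]
      linarith
    rw [← h4] at h3
    have h5 : ‖e‖ = 0 := by
      by_contra hne
      have : 0 < ‖e‖ := lt_of_le_of_ne (norm_nonneg _) (Ne.symm hne)
      nlinarith [mul_pos this this]
    exact Subtype.ext (norm_eq_zero.1 h5)
  obtain ⟨⟨e, he⟩, hey⟩ := (LinearMap.injective_iff_surjective_of_finrank_eq_finrank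
    (by rw [hd, finrank_euclideanSpace_fin])).1 hinj y
  exact ⟨e, he, hey⟩

variable [FiniteDimensional ℝ E] {M : Set E} {κ : ℝ} {p : E}

lemma norm_normal_sub_le (hMc : IsCompact M) (hκ : 0 < κ)
    (hreach : ENNReal.ofReal (1 / κ) ≤ reach M) (hT : IsTangent d M p T) (h : IsFrame T B N)
    {x : E} (hx : x ∈ M) : ‖N (x - p)‖ ≤ κ / 2 * ‖x - p‖ ^ 2 := by
  have h1 := hT.inner_le hMc hκ hreach hx (h.mem_orthogonal (x - p))
  rw [h.inner_normal] at h1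
  rcases (norm_nonneg (N (x - p))).eq_or_lt with h0 | h0
  · rw [← h0]; positivity
  · have : ‖N (x - p)‖ * ‖N (x - p)‖ ≤ ‖N (x - p)‖ * (κ / 2 * ‖x - p‖ ^ 2) := by nlinarith
    exact le_of_mul_le_mul_left this h0

/-- Near `p`, a submanifold of positive reach is the graph over its tangent space at `p` of a map
with a small Lipschitz constant. -/
lemma norm_normal_le_mul (hMc : IsCompact M) (hM : IsC2Submanifold d M) (hκ : 0 < κ)
    (hreach : ENNReal.ofReal (1 / κ) ≤ reach M) (hp : p ∈ M) (hT : IsTangent d M p T)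
    (h : IsFrame T B N) {R : ℝ} (hR : κ * R ≤ 1 / 4) {x y : E} (hx : x ∈ M) (hy : y ∈ M)
    (hxR : ‖x - p‖ ≤ R) (hyR : ‖y - p‖ ≤ R) : ‖N (x - y)‖ ≤ 6 * κ * R * ‖x - y‖ := by
  obtain ⟨T', hT'⟩ := hM.exists_isTangent hy
  have hang := hT.angleLE hMc hM hκ hreach hp hy (by
    rw [norm_sub_rev]; exact (mul_le_mul_of_nonneg_left hyR hκ.le).trans hR) hT'
  -- split the normal part of `x - y` along the tangent space at `y`: its tangential part `a` is
  -- small since the angle is, and its normal part `n` sees `x - y` only to second order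
  set z := N (x - y) with hz
  have hzT : z ∈ Tᗮ := h.mem_orthogonal _
  obtain ⟨a, ha, n, hn, hzan, han, -, han1, han2⟩ := exists_orthogonal_decomposition T' z
  have h1 : ‖a‖ ≤ 5 * κ * R * ‖z‖ := by
    have h2 := hang z hzT a ha
    have h3 : inner ℝ a z = ‖a‖ ^ 2 := by
      rw [hzan, inner_add_right, han, add_zero, real_inner_self_eq_norm_sq]
    rw [h3, norm_sub_rev] at h2
    have h4 : 5 * κ * ‖y - p‖ * (‖a‖ * ‖z‖) ≤ 5 * κ * R * (‖a‖ * ‖z‖) := by gcongr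
    rcases (norm_nonneg a).eq_or_lt with h0 | h0
    · rw [← h0]
      have : 0 ≤ R := (norm_nonneg _).trans hyR
      positivity
    · have : ‖a‖ * ‖a‖ ≤ ‖a‖ * (5 * κ * R * ‖z‖) := by nlinarith
      exact le_of_mul_le_mul_left this h0
  have hxy : ‖x - y‖ ≤ 2 * R := by
    have := norm_sub_le (x - p) (y - p)
    rw [sub_sub_sub_cancel_right] at this; linarith
  have h5 : inner ℝ (x - y) n ≤ κ * R * ‖z‖ * ‖x - y‖ := by
    calc _ ≤ κ / 2 * ‖n‖ * ‖x - y‖ ^ 2 := hT'.inner_le hMc hκ hreach hx hn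
      _ = κ / 2 * ‖n‖ * (‖x - y‖ * ‖x - y‖) := by ring
      _ ≤ κ / 2 * ‖z‖ * (2 * R * ‖x - y‖) := by gcongr
      _ = _ := by ring
  have h6 : inner ℝ (x - y) a ≤ ‖x - y‖ * (5 * κ * R * ‖z‖) :=
    (real_inner_le_norm _ _).trans (by gcongr)
  have h7 : inner ℝ (x - y) z = ‖z‖ ^ 2 := h.inner_normal _
  have h8 : inner ℝ (x - y) z = inner ℝ (x - y) a + inner ℝ (x - y) n := by
    rw [← inner_add_right, ← hzan]
  rcases (norm_nonneg z).eq_or_lt with h0 | h0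
  · rw [← h0]
    have : 0 ≤ R := (norm_nonneg _).trans hyR
    positivity
  · have : ‖z‖ * ‖z‖ ≤ ‖z‖ * (6 * κ * R * ‖x - y‖) := by nlinarith
    exact le_of_mul_le_mul_left this h0

/-- The projection of `M ∩ B(p, r)` to the tangent space at `p` covers a ball of nearly the same
radius. -/
lemma closedBall_subset_image (hMc : IsCompact M) (hM : IsC2Submanifold d M) (hκ : 0 < κ)
    (hreach : ENNReal.ofReal (1 / κ) ≤ reach M) (hp : p ∈ M) (hT : IsTangent d M p T)
    (h : IsFrame T B N) {r : ℝ} (hr0 : 0 < r) (hr : κ * r ≤ 1 / 8) :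
    closedBall (B p) (r * (1 - κ * r)) ⊆ B '' (M ∩ closedBall p r) := by
  intro v hv
  have hv' : ‖v - B p‖ ≤ r * (1 - κ * r) := by rw [← dist_eq_norm]; exact hv
  set S := B '' (M ∩ closedBall p r) with hS
  have hSc : IsClosed S :=
    ((hMc.inter_right isClosed_closedBall).image B.continuous).isClosed
  -- continuity method along the segment from `B p` to `v`: its part in the image is closed, and
  -- open since the projection is a submersion at points of `M` in the interior of the ball
  set c : ℝ → EuclideanSpace ℝ (Fin d) := fun t => B p + t • (v - B p) with hc
  have hcc : Continuous c := by fun_prop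
  have hκr : 0 < κ * r := by positivity
  have key : (1 : ℝ) ∈ c ⁻¹' S := by
    refine IsClosed.mem_of_ge_of_forall_exists_gt (a := 0)
      ((hSc.preimage hcc).inter isClosed_Icc) ?_ zero_le_one ?_
    · refine ⟨p, ⟨hp, mem_closedBall_self hr0.le⟩, ?_⟩
      simp [hc]
    · rintro t ⟨⟨x, ⟨hxM, hxr⟩, hxt⟩, ht0, ht1⟩
      have hxr' : ‖x - p‖ ≤ r := by rw [← dist_eq_norm]; exact hxr
      have hB : ‖B (x - p)‖ ≤ r * (1 - κ * r) := by
        rw [map_sub, hxt, hc]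
        simp only [add_sub_cancel_left]
        rw [norm_smul, Real.norm_of_nonneg ht0]
        nlinarith [norm_nonneg (v - B p)]
      have hN : ‖N (x - p)‖ ≤ κ / 2 * r ^ 2 :=
        (norm_normal_sub_le hMc hκ hreach hT h hxM).trans (by gcongr)
      have hlt : ‖x - p‖ < r := by
        have h1 := h.norm_le_add (x - p)
        nlinarith [mul_pos hκr hr0]
      obtain ⟨T', hT'⟩ := hM.exists_isTangent hxM
      have hang := (hT.angleLE hMc hM hκ hreach hp hxM (by
        rw [norm_sub_rev]
        have := mul_le_mul_of_nonneg_left hxr' hκ.le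
        linarith) hT').mono (a' := 5 / 8) (by
        rw [norm_sub_rev]
        have := mul_le_mul_of_nonneg_left hxr' hκ.le
        linarith)
      have := hT'.finiteDimensional
      have hmap := hT'.nhds_le_map B
        (fun y => h.surjective_of_angleLE hT'.finrank_eq (by norm_num) hang y)
      have hSn : S ∈ 𝓝 (B x) := by
        refine hmap ?_
        rw [mem_map]
        have hb : ball p r ∈ 𝓝 x := isOpen_ball.mem_nhds (by rw [mem_ball, dist_eq_norm]; exact hlt)
        filter_upwards [self_mem_nhdsWithin, mem_nhdsWithin_of_mem_nhds hb] with y hy1 hy2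
        exact ⟨y, ⟨hy1, ball_subset_closedBall hy2⟩, rfl⟩
      rw [hxt] at hSn
      have hev : ∀ᶠ t' in 𝓝[>] t, c t' ∈ S :=
        mem_nhdsWithin_of_mem_nhds (hcc.continuousAt hSn)
      obtain ⟨t', h1, h2⟩ := (hev.and (Ioo_mem_nhdsGT ht1)).exists
      exact ⟨t', h1, h2.1, h2.2.le⟩
  have : c 1 = v := by simp [hc]
  rw [← this]; exact key

end IsFrame

end Frame

/-! ### Volumes of balls in a submanifold of positive reach -/

section Volume

lemma lipschitzOnWith_euclideanHausdorffMeasure_image_le {X Y : Type*} [EMetricSpace X]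
    [EMetricSpace Y] [MeasurableSpace X] [BorelSpace X] [MeasurableSpace Y] [BorelSpace Y]
    {K : NNReal} {f : X → Y} {s : Set X} (h : LipschitzOnWith K f s) (d : ℕ) :
    Measure.euclideanHausdorffMeasure d (f '' s)
      ≤ (K : ℝ≥0∞) ^ d * Measure.euclideanHausdorffMeasure d s := by
  simp_rw [Measure.euclideanHausdorffMeasure_def, Measure.smul_apply, ENNReal.smul_def, smul_eq_mul]
  have := h.hausdorffMeasure_image_le (d := (d : ℝ)) (Nat.cast_nonneg d)
  rw [ENNReal.rpow_natCast] at this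
  calc _ ≤ _ := mul_le_mul_right this _
    _ = _ := by ring

/-- If `v` and `t v`, `t < 1`, are both projections of points at distance `R` from `p`, then their
normal parts `n`, `n'` differ too much for the graph of a map with Lipschitz constant `σ`. -/
lemma radial_arith {β n n' σ R t : ℝ} (hσ : 0 ≤ σ) (hσ1 : σ ≤ 1 / 2) (hR : 0 < R)
    (ht0 : 1 / 2 ≤ t) (ht1 : t < 1) (hβ0 : 0 ≤ β) (hn0 : 0 ≤ n) (hn0' : 0 ≤ n')
    (h1 : R ^ 2 = β ^ 2 + n ^ 2) (h2 : R ^ 2 = (t * β) ^ 2 + n' ^ 2) (hn : n ≤ σ * R)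
    (hn' : n' ≤ σ * R) (hnn : n' - n ≤ σ * ((1 + σ) * ((1 - t) * β))) : False := by
  have hb : 0 ≤ (1 - t) * β := mul_nonneg (by linarith) hβ0
  have hn4 : n' - n ≤ 1 / 2 * ((1 + 1 / 2) * ((1 - t) * β)) := hnn.trans (by gcongr)
  have hσR : σ * R ≤ 1 / 2 * R := by gcongr
  have hn5 : n ≤ 1 / 2 * R := hn.trans hσR
  have hn5' : n' ≤ 1 / 2 * R := hn'.trans hσR
  have hn6 : n ^ 2 ≤ (1 / 2 * R) ^ 2 := by gcongr
  have hβR : (4 / 5 * R) ^ 2 < β ^ 2 := by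
    have : 0 < R ^ 2 := by positivity
    nlinarith
  have hβR' : 4 / 5 * R < β := lt_of_pow_lt_pow_left₀ 2 hβ0 hβR
  have hβpos : 0 < β := by linarith
  have h6 : ((1 - t) * β) * ((1 + t) * β) = (n' - n) * (n' + n) := by linarith
  have h7 : (n' - n) * (n' + n) ≤ (1 / 2 * ((1 + 1 / 2) * ((1 - t) * β))) * R := by
    calc (n' - n) * (n' + n) ≤ (1 / 2 * ((1 + 1 / 2) * ((1 - t) * β))) * (n' + n) := by gcongr
      _ ≤ _ := by gcongr; linarith
  have h9 : ((1 - t) * β) * ((1 + t) * β) ≤ ((1 - t) * β) * (3 / 4 * R) := by linarith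
  have h10 := le_of_mul_le_mul_left h9 (mul_pos (by linarith) hβpos)
  have h11 : (1 + 1 / 2) * β ≤ (1 + t) * β := by gcongr
  linarith

/-- A bounded measurable set that meets every ray from the origin in at most one point (to within a
factor of `2`) is a null set, since it has infinitely many disjoint dilates within a bounded set. -/
lemma volume_eq_zero_of_radial {d : ℕ} {A : Set (EuclideanSpace ℝ (Fin d))} (hA : MeasurableSet A)
    (hb : Bornology.IsBounded A)
    (h : ∀ v ∈ A, ∀ t : ℝ, 1 / 2 ≤ t → t < 1 → t • v ∉ A) : volume A = 0 := by
  by_contra hne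
  set t : ℕ → ℝ := fun n => 1 / 2 + 1 / 2 * (1 / ((n : ℝ) + 1)) with ht
  have ht0 : ∀ n, 1 / 2 < t n := fun n => by
    have : (0 : ℝ) < 1 / 2 * (1 / ((n : ℝ) + 1)) := by positivity
    simp only [ht]; linarith
  have ht1 : ∀ n, t n ≤ 1 := fun n => by
    have : 1 / ((n : ℝ) + 1) ≤ 1 := by
      rw [div_le_one (by positivity)]; linarith [(Nat.cast_nonneg n : (0 : ℝ) ≤ n)]
    simp only [ht]; linarith
  have hanti : StrictAnti t := by
    intro m n hmn
    have : 1 / ((n : ℝ) + 1) < 1 / ((m : ℝ) + 1) := by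
      have : (m : ℝ) < n := by exact_mod_cast hmn
      gcongr
    simp only [ht]; linarith
  have haux : ∀ m n, m < n → Disjoint (t m • A) (t n • A) := by
    intro m n hmn
    rw [Set.disjoint_left]
    rintro _ ⟨v, hv, rfl⟩ ⟨v', hv', heq⟩
    simp only at heq
    have hm := ht0 m
    have hn := ht0 n
    have hlt := hanti hmn
    have hm0 : t m ≠ 0 := by linarith
    refine h v' hv' (t n / t m) ?_ ?_ ?_
    · rw [le_div_iff₀ (by linarith)]; nlinarith [ht1 m]
    · rw [div_lt_one (by linarith)]; exact hlt
    · rw [div_eq_inv_mul, mul_smul, heq, smul_smul, inv_mul_cancel₀ hm0, one_smul]; exact hv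
  have hdisj : Pairwise (Function.onFun Disjoint fun n => t n • A) := by
    intro m n hmn
    rcases lt_or_gt_of_ne hmn with hlt | hlt
    · exact haux m n hlt
    · exact (haux n m hlt).symm
  obtain ⟨R, hR⟩ := hb.subset_closedBall 0
  have hsub : (⋃ n, t n • A) ⊆ closedBall 0 R := by
    refine iUnion_subset fun n => ?_
    rintro _ ⟨v, hv, rfl⟩
    have h1 := hR hv
    simp only [mem_closedBall, dist_zero_right] at h1 ⊢
    rw [norm_smul, Real.norm_of_nonneg (by linarith [ht0 n])]
    nlinarith [ht1 n, norm_nonneg v, ht0 n]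
  have hsum := tsum_meas_le_meas_iUnion_of_disjoint (volume : Measure (EuclideanSpace ℝ (Fin d)))
    (fun n => hA.const_smul₀ (t n)) hdisj
  have hlow : ∑' _ : ℕ, ENNReal.ofReal ((1 / 2) ^ d) * volume A ≤ ∑' n, volume (t n • A) := by
    refine ENNReal.tsum_le_tsum fun n => ?_
    rw [Measure.addHaar_smul, finrank_euclideanSpace_fin]
    gcongr
    rw [abs_of_nonneg (by have := ht0 n; positivity)]
    have := ht0 n
    gcongr
  rw [ENNReal.tsum_const_eq_top_of_ne_zero (mul_ne_zero (by simp) hne)] at hlow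
  have hfin : volume (closedBall (0 : EuclideanSpace ℝ (Fin d)) R) < ⊤ :=
    measure_closedBall_lt_top
  exact absurd ((hlow.trans hsum).trans (measure_mono hsub)) (not_le.2 hfin)

variable {E : Type*} [NormedAddCommGroup E] [InnerProductSpace ℝ E] [MeasurableSpace E]
  [BorelSpace E] {d : ℕ} {T : Submodule ℝ E} {B : E →L[ℝ] EuclideanSpace ℝ (Fin d)} {N : E →L[ℝ] E}

lemma IsFrame.volume_image_le (h : IsFrame T B N) (S : Set E) :
    volume (B '' S) ≤ Measure.euclideanHausdorffMeasure d S := by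
  have hLip : LipschitzOnWith 1 B S := by
    refine LipschitzOnWith.of_dist_le_mul fun x _ y _ => ?_
    rw [dist_eq_norm, dist_eq_norm, ← map_sub, NNReal.coe_one, one_mul]
    exact h.norm_le _
  have h1 := lipschitzOnWith_euclideanHausdorffMeasure_image_le hLip d
  rw [EuclideanSpace.euclideanHausdorffMeasure_eq_volume] at h1
  simpa using h1

variable [FiniteDimensional ℝ E] {M : Set E} {κ : ℝ} {p : E}

/-- The projection to the tangent space at `p` hardly decreases the volume of subsets
of `M ∩ B(p, R)`. -/
lemma IsFrame.measure_le (hMc : IsCompact M) (hM : IsC2Submanifold d M) (hκ : 0 < κ)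
    (hreach : ENNReal.ofReal (1 / κ) ≤ reach M) (hp : p ∈ M) (hT : IsTangent d M p T)
    (h : IsFrame T B N) {R : ℝ} (hR0 : 0 ≤ R) (hR : 6 * κ * R ≤ 1 / 2) {S : Set E}
    (hS : S ⊆ M ∩ closedBall p R) :
    Measure.euclideanHausdorffMeasure d S
      ≤ ENNReal.ofReal ((1 + 6 * κ * R) ^ d) * volume (B '' S) := by
  have hσ : 0 ≤ 6 * κ * R := by positivity
  have hlow : ∀ x ∈ S, ∀ y ∈ S, ‖x - y‖ ≤ (1 + 6 * κ * R) * ‖B x - B y‖ := by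
    intro x hx y hy
    rw [← map_sub]
    refine h.norm_le_mul hσ hR (h.norm_normal_le_mul hMc hM hκ hreach hp hT (by linarith)
      (hS hx).1 (hS hy).1 ?_ ?_)
    · rw [← dist_eq_norm]; exact (hS hx).2
    · rw [← dist_eq_norm]; exact (hS hy).2
  have hinv : ∀ x ∈ S, Function.invFunOn B S (B x) = x := by
    intro x hx
    have hmem : B x ∈ B '' S := ⟨x, hx, rfl⟩
    have h1 := Function.invFunOn_mem hmem
    have h2 := Function.invFunOn_eq hmem
    have h3 := hlow _ h1 x hx
    rw [h2, sub_self, norm_zero, mul_zero] at h3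
    exact sub_eq_zero.1 (norm_le_zero_iff.1 h3)
  have hLip : LipschitzOnWith (1 + 6 * κ * R).toNNReal (Function.invFunOn B S) (B '' S) := by
    refine LipschitzOnWith.of_dist_le_mul ?_
    rintro _ ⟨x, hx, rfl⟩ _ ⟨y, hy, rfl⟩
    rw [hinv x hx, hinv y hy, dist_eq_norm, dist_eq_norm, Real.coe_toNNReal _ (by positivity)]
    exact hlow x hx y hy
  have h1 := lipschitzOnWith_euclideanHausdorffMeasure_image_le hLip d
  have h2 : Function.invFunOn B S '' (B '' S) = S := by
    rw [image_image]
    calc _ = id '' S := image_congr fun x hx => hinv x hx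
      _ = S := image_id S
  rw [h2, EuclideanSpace.euclideanHausdorffMeasure_eq_volume] at h1
  refine h1.trans (le_of_eq ?_)
  rw [ENNReal.ofReal_pow (by positivity)]
  rfl

/-- Lower bound for the volume of the balls of a submanifold of positive reach. -/
theorem volume_closedBall_le_measure (hMc : IsCompact M) (hM : IsC2Submanifold d M) (hκ : 0 < κ)
    (hreach : ENNReal.ofReal (1 / κ) ≤ reach M) (hp : p ∈ M) {r : ℝ} (hr0 : 0 < r)
    (hr : κ * r ≤ 1 / 8) :
    volume (closedBall (0 : EuclideanSpace ℝ (Fin d)) (r * (1 - κ * r)))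
      ≤ Measure.euclideanHausdorffMeasure d (M ∩ closedBall p r) := by
  obtain ⟨T, hT⟩ := hM.exists_isTangent hp
  obtain ⟨B, N, h⟩ := exists_isFrame hT.finrank_eq
  calc _ = volume (closedBall (B p) (r * (1 - κ * r))) :=
        (Measure.addHaar_closedBall_center _ _ _).symm
    _ ≤ volume (B '' (M ∩ closedBall p r)) :=
        measure_mono (h.closedBall_subset_image hMc hM hκ hreach hp hT hr0 hr)
    _ ≤ _ := h.volume_image_le _

/-- Upper bound for the volume of the intersection of two balls of a submanifold of positive
reach: the comparison is with balls in `ℝ^d` whose centres are almost as far apart. -/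
theorem measure_inter_closedBall_le (hMc : IsCompact M) (hM : IsC2Submanifold d M) (hκ : 0 < κ)
    (hreach : ENNReal.ofReal (1 / κ) ≤ reach M) {q : E} (hp : p ∈ M) (hq : q ∈ M) {R : ℝ}
    (hR0 : 0 ≤ R) (hR : 6 * κ * R ≤ 1 / 2) :
    ∃ a : EuclideanSpace ℝ (Fin d), ‖p - q‖ - κ / 2 * ‖p - q‖ ^ 2 ≤ ‖a‖ ∧
      Measure.euclideanHausdorffMeasure d (M ∩ (closedBall p R ∩ closedBall q R))
        ≤ ENNReal.ofReal ((1 + 6 * κ * R) ^ d) * volume (closedBall 0 R ∩ closedBall a R) := by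
  obtain ⟨T, hT⟩ := hM.exists_isTangent hp
  obtain ⟨B, N, h⟩ := exists_isFrame hT.finrank_eq
  refine ⟨B q - B p, ?_, ?_⟩
  · rw [← map_sub, norm_sub_rev p q]
    have h1 := h.norm_le_add (q - p)
    have h2 := h.norm_normal_sub_le hMc hκ hreach hT hq
    linarith
  · refine (h.measure_le hMc hM hκ hreach hp hT hR0 hR (S := M ∩ (closedBall p R ∩ closedBall q R))
      (fun x hx => ⟨hx.1, hx.2.1⟩)).trans ?_
    refine mul_le_mul_right ?_ _
    calc volume (B '' (M ∩ (closedBall p R ∩ closedBall q R)))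
        ≤ volume ((fun x => -B p + x) ⁻¹' (closedBall 0 R ∩ closedBall (B q - B p) R)) := by
          refine measure_mono ?_
          rintro _ ⟨x, ⟨-, hx1, hx2⟩, rfl⟩
          rw [mem_closedBall, dist_eq_norm] at hx1 hx2
          have e1 : -B p + B x = B (x - p) := by rw [map_sub, neg_add_eq_sub]
          have e2 : -B p + B x - (B q - B p) = B (x - q) := by rw [map_sub]; abel
          refine ⟨mem_closedBall_zero_iff.2 ?_, mem_closedBall_iff_norm.2 ?_⟩
          · beta_reduce; rw [e1]; exact (h.norm_le _).trans hx1
          · beta_reduce; rw [e2]; exact (h.norm_le _).trans hx2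
      _ = _ := measure_preimage_add _ _ _

/-- The spheres `M ∩ S(p, R)` are null sets, since their projections to the tangent space at `p`
have no two points `v`, `t v` with `1/2 ≤ t < 1`. -/
theorem measure_inter_sphere_eq_zero (hMc : IsCompact M) (hM : IsC2Submanifold d M) (hκ : 0 < κ)
    (hreach : ENNReal.ofReal (1 / κ) ≤ reach M) (hp : p ∈ M) {R : ℝ} (hR0 : 0 < R)
    (hR : 6 * κ * R ≤ 1 / 2) :
    Measure.euclideanHausdorffMeasure d (M ∩ sphere p R) = 0 := by
  obtain ⟨T, hT⟩ := hM.exists_isTangent hp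
  obtain ⟨B, N, h⟩ := exists_isFrame hT.finrank_eq
  have hσ : 0 ≤ 6 * κ * R := by positivity
  set σ := 6 * κ * R with hσd
  refine le_antisymm ?_ zero_le
  refine (h.measure_le hMc hM hκ hreach hp hT hR0.le hR (S := M ∩ sphere p R)
      (fun x hx => ⟨hx.1, sphere_subset_closedBall hx.2⟩)).trans ?_
  have himg : B '' (M ∩ sphere p R)
      = (fun x => -B p + x) ⁻¹' ((fun x => B (x - p)) '' (M ∩ sphere p R)) := by
    ext y
    constructor
    · rintro ⟨x, hx, rfl⟩
      exact ⟨x, hx, by simp [sub_eq_neg_add]⟩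
    · rintro ⟨x, hx, hxy⟩
      refine ⟨x, hx, ?_⟩
      simp only [map_sub] at hxy
      rw [sub_eq_neg_add] at hxy
      exact add_left_cancel hxy
  have hcomp : IsCompact ((fun x => B (x - p)) '' (M ∩ sphere p R)) :=
    (hMc.inter_right isClosed_sphere).image (by fun_prop)
  rw [himg, measure_preimage_add, volume_eq_zero_of_radial hcomp.measurableSet hcomp.isBounded,
    mul_zero]
  rintro _ ⟨x, ⟨hxM, hxR⟩, rfl⟩ t ht0 ht1 ⟨x', ⟨hxM', hxR'⟩, hxx'⟩
  simp only at hxx'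
  rw [mem_sphere, dist_eq_norm] at hxR hxR'
  have h1 := h.norm_sq (x - p)
  have h2 := h.norm_sq (x' - p)
  rw [hxR] at h1
  rw [hxR', hxx', norm_smul, Real.norm_of_nonneg (by linarith)] at h2
  have hflat := h.norm_normal_le_mul hMc hM hκ hreach hp hT (R := R) (by linarith) hxM hxM'
    hxR.le hxR'.le
  have hB : ‖B (x - x')‖ = (1 - t) * ‖B (x - p)‖ := by
    have : B (x - x') = (1 - t) • B (x - p) := by
      rw [sub_smul, one_smul, ← hxx', ← map_sub]; congr 1; abel
    rw [this, norm_smul, Real.norm_of_nonneg (by linarith)]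
  have hxx := h.norm_le_mul hσ hR hflat
  rw [hB] at hxx
  have hn1 : ‖N (x - p)‖ ≤ σ * R := by
    have := h.norm_normal_le_mul hMc hM hκ hreach hp hT (R := R) (by linarith) hxM hp
      hxR.le (by simpa using hR0.le)
    rwa [hxR] at this
  have hn2 : ‖N (x' - p)‖ ≤ σ * R := by
    have := h.norm_normal_le_mul hMc hM hκ hreach hp hT (R := R) (by linarith) hxM' hp
      hxR'.le (by simpa using hR0.le)
    rwa [hxR'] at this
  have hn3 : ‖N (x' - p)‖ - ‖N (x - p)‖ ≤ ‖N (x - x')‖ := by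
    have := norm_sub_norm_le (N (x' - p)) (N (x - p))
    rwa [← map_sub, sub_sub_sub_cancel_right, ← neg_sub x x', map_neg, norm_neg] at this
  exact radial_arith hσ hR hR0 ht0 ht1 (norm_nonneg _) (norm_nonneg _) (norm_nonneg _) h1 h2 hn1 hn2
    (hn3.trans (hflat.trans (by gcongr)))

end Volume

/-! ### Caps of balls and the volume coefficient -/

section Cap

/-- `∫_h^1 (1-t²)^(k/2) dt`: the volume of the cap `{x ∈ B(0,1) : x₀ ≥ h}` of the unit ball in
dimension `k + 1`, in units of the volume of the unit ball in dimension `k`. -/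
noncomputable def capInt (k : ℕ) (h : ℝ) : ℝ := ∫ t in h..1, √(1 - t ^ 2) ^ k

lemma continuous_slice (k : ℕ) : Continuous fun t : ℝ => √(1 - t ^ 2) ^ k := by fun_prop

lemma intervalIntegrable_slice (k : ℕ) (a b : ℝ) :
    IntervalIntegrable (fun t : ℝ => √(1 - t ^ 2) ^ k) volume a b :=
  (continuous_slice k).intervalIntegrable _ _

lemma slice_le_one (k : ℕ) (t : ℝ) : √(1 - t ^ 2) ^ k ≤ 1 :=
  pow_le_one₀ (Real.sqrt_nonneg _) (Real.sqrt_le_one.2 (by nlinarith [sq_nonneg t]))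

lemma capInt_antitone (k : ℕ) {h h' : ℝ} (hh : h ≤ h') : capInt k h' ≤ capInt k h := by
  have h1 := intervalIntegral.integral_add_adjacent_intervals
    (intervalIntegrable_slice k h h') (intervalIntegrable_slice k h' 1)
  have h2 : 0 ≤ ∫ t in h..h', √(1 - t ^ 2) ^ k :=
    intervalIntegral.integral_nonneg hh fun t _ => by positivity
  simp only [capInt]; linarith

lemma capInt_le_add (k : ℕ) {h h' : ℝ} (hh : h ≤ h') : capInt k h ≤ capInt k h' + (h' - h) := by
  have h1 := intervalIntegral.integral_add_adjacent_intervals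
    (intervalIntegrable_slice k h h') (intervalIntegrable_slice k h' 1)
  have h2 : ∫ t in h..h', √(1 - t ^ 2) ^ k ≤ ∫ _ in h..h', (1 : ℝ) :=
    intervalIntegral.integral_mono_on hh (intervalIntegrable_slice k _ _)
      intervalIntegrable_const fun t _ => slice_le_one k t
  rw [intervalIntegral.integral_const, smul_eq_mul, mul_one] at h2
  simp only [capInt]; linarith

lemma slice_eq_rpow (k : ℕ) {x : ℝ} (hx : 0 ≤ x) : √x ^ k = x ^ ((k : ℝ) / 2) := by
  rw [Real.sqrt_eq_rpow, ← Real.rpow_natCast, ← Real.rpow_mul hx]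
  congr 1; ring

/-- The weight `t ≤ 1` makes the integrand explicitly integrable. -/
lemma le_capInt (k : ℕ) {h : ℝ} (h0 : 0 ≤ h) (h1 : h ≤ 1) :
    (1 - h ^ 2) ^ (((k : ℝ) + 2) / 2) / ((k : ℝ) + 2) ≤ capInt k h := by
  have hder : ∀ t ∈ uIcc h 1, HasDerivAt
      (fun t : ℝ => -((1 - t ^ 2) ^ (((k : ℝ) + 2) / 2) / ((k : ℝ) + 2)))
      (t * √(1 - t ^ 2) ^ k) t := by
    intro t ht
    rw [uIcc_of_le h1] at ht
    have ht2 : 0 ≤ 1 - t ^ 2 := by nlinarith [ht.1, ht.2]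
    have hp : (1 : ℝ) ≤ ((k : ℝ) + 2) / 2 := by
      rw [le_div_iff₀ (by norm_num)]; linarith [(Nat.cast_nonneg k : (0 : ℝ) ≤ k)]
    have hd : HasDerivAt (fun t : ℝ => -((1 - t ^ 2) ^ (((k : ℝ) + 2) / 2) / ((k : ℝ) + 2))) _ t :=
      ((((hasDerivAt_pow 2 t).const_sub 1).rpow_const (Or.inr hp)).div_const ((k : ℝ) + 2)).neg
    refine hd.congr_deriv ?_
    rw [slice_eq_rpow k ht2]
    have : ((k : ℝ) + 2) / 2 - 1 = (k : ℝ) / 2 := by ring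
    have hk : ((k : ℝ) + 2) ≠ 0 := by positivity
    rw [this]
    field_simp
    norm_num
  have hint : IntervalIntegrable (fun t : ℝ => t * √(1 - t ^ 2) ^ k) volume h 1 :=
    Continuous.intervalIntegrable (by fun_prop) _ _
  have heq := intervalIntegral.integral_eq_sub_of_hasDerivAt hder hint
  have hk : (((k : ℝ) + 2) / 2) ≠ 0 := by positivity
  have hz : (1 - (1 : ℝ) ^ 2) ^ (((k : ℝ) + 2) / 2) = 0 := by
    rw [one_pow, sub_self, Real.zero_rpow hk]
  simp only [hz, zero_div, neg_zero, sub_neg_eq_add, zero_add] at heq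
  rw [← heq]
  refine intervalIntegral.integral_mono_on h1 hint (intervalIntegrable_slice k _ _) fun t ht => ?_
  have : 0 ≤ √(1 - t ^ 2) ^ k := by positivity
  nlinarith [ht.1, ht.2]

lemma capInt_pos (k : ℕ) {h : ℝ} (h0 : 0 ≤ h) (h1 : h < 1) : 0 < capInt k h := by
  refine lt_of_lt_of_le ?_ (le_capInt k h0 h1.le)
  have : 0 < 1 - h ^ 2 := by nlinarith
  positivity

/-- The substitution `x = 1 - t²` in the incomplete beta function. -/
lemma incBeta_eq (k : ℕ) {h : ℝ} (h0 : 0 ≤ h) (h1 : h ≤ 1) :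
    incBeta (1 - h ^ 2) ((((k + 1 : ℕ) : ℝ) + 1) / 2) (1 / 2) = 2 * capInt k h := by
  set g : ℝ → ℝ := fun x => x ^ (((((k + 1 : ℕ) : ℝ) + 1) / 2) - 1) * (1 - x) ^ ((1 / 2 : ℝ) - 1)
    with hg
  have hexp : ((((k + 1 : ℕ) : ℝ) + 1) / 2) - 1 = (k : ℝ) / 2 := by push_cast; ring
  have hgi : IntegrableOn g (Icc 0 1) := by
    rw [integrableOn_Icc_iff_integrableOn_Ioc,
      ← intervalIntegrable_iff_integrableOn_Ioc_of_le zero_le_one]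
    have h2 : IntervalIntegrable (fun x : ℝ => x ^ ((1 / 2 : ℝ) - 1)) volume 0 1 :=
      intervalIntegral.intervalIntegrable_rpow' (by norm_num)
    have h3 := (h2.comp_sub_left 1).symm
    simp only [sub_zero, sub_self] at h3
    refine h3.continuousOn_mul (Continuous.continuousOn ?_)
    exact continuous_id.rpow_const fun x => Or.inr (by rw [hexp]; positivity)
  set f : ℝ → ℝ := fun t => 1 - t ^ 2 with hf
  have hfim : f '' uIcc h 1 ⊆ Icc 0 1 := by
    rintro _ ⟨t, ht, rfl⟩
    rw [uIcc_of_le h1] at ht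
    simp only [hf]
    exact ⟨by nlinarith [ht.1, ht.2], by nlinarith [sq_nonneg t]⟩
  have hcomp : ∀ t ∈ Ioc h 1, (g ∘ f) t * (-(2 * t)) = -2 * √(1 - t ^ 2) ^ k := by
    intro t ht
    have ht0 : 0 < t := h0.trans_lt ht.1
    have ht2 : 0 ≤ 1 - t ^ 2 := by nlinarith [ht.2]
    simp only [Function.comp, hg, hf, hexp]
    rw [slice_eq_rpow k ht2, sub_sub_cancel]
    have : (t ^ 2) ^ ((1 / 2 : ℝ) - 1) = t⁻¹ := by
      rw [← Real.rpow_natCast, ← Real.rpow_mul ht0.le, ← Real.rpow_neg_one]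
      congr 1; norm_num
    rw [this]; field_simp
  have hsub := intervalIntegral.integral_comp_mul_deriv''' (a := h) (b := 1) (f := f)
    (f' := fun t => -(2 * t)) (g := g) (by fun_prop)
    (fun t _ => by
      have h2 : HasDerivAt f _ t := (hasDerivAt_pow 2 t).const_sub 1
      exact (h2.congr_deriv (by norm_num)).hasDerivWithinAt)
    (by
      rintro x ⟨t, ht, rfl⟩
      rw [min_eq_left h1, max_eq_right h1] at ht
      have ht0 : 0 < t := h0.trans_lt ht.1
      refine ContinuousAt.continuousWithinAt ?_
      refine ContinuousAt.mul ?_ ?_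
      · exact continuousAt_id.rpow_const (Or.inr (by rw [hexp]; positivity))
      · refine (continuousAt_const.sub continuousAt_id).rpow_const (Or.inl ?_)
        change (1 : ℝ) - (1 - t ^ 2) ≠ 0
        rw [sub_sub_cancel]; positivity)
    (hgi.mono_set hfim)
    (by
      rw [uIcc_of_le h1, integrableOn_Icc_iff_integrableOn_Ioc,
        integrableOn_congr_fun hcomp measurableSet_Ioc]
      exact (Continuous.integrableOn_Ioc (by fun_prop)))
  have hleft : ∫ x in h..1, (g ∘ f) x * (-(2 * x)) = -2 * capInt k h := by
    rw [capInt, ← intervalIntegral.integral_const_mul,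
      intervalIntegral.integral_of_le h1, intervalIntegral.integral_of_le h1]
    exact setIntegral_congr_fun measurableSet_Ioc hcomp
  rw [hleft] at hsub
  have hf1 : f 1 = 0 := by simp [hf]
  rw [hf1, intervalIntegral.integral_symm] at hsub
  have : incBeta (1 - h ^ 2) ((((k + 1 : ℕ) : ℝ) + 1) / 2) (1 / 2) = ∫ x in (0 : ℝ)..f h, g x := rfl
  rw [this]; linarith

/-- The volume coefficient is the ratio of the volumes of the intersection and of the union of two
unit balls in `ℝ^(k+1)`. -/
lemma volCoef_eq (k : ℕ) {s : ℝ} (h0 : 0 ≤ s) (h1 : s < 2) :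
    volCoef (k + 1) s = capInt k (s / 2) / (2 * capInt k 0 - capInt k (s / 2)) := by
  have e1 : (1 : ℝ) - s ^ 2 / 4 = 1 - (s / 2) ^ 2 := by ring
  have e2 := incBeta_eq k (h := 0) le_rfl zero_le_one
  rw [zero_pow two_ne_zero, sub_zero] at e2
  rw [volCoef, e1, incBeta_eq k (by positivity) (by linarith), e2]
  have h2 := capInt_pos k (h := s / 2) (by positivity) (by linarith)
  have h3 := capInt_antitone k (h := 0) (h' := s / 2) (by positivity)
  have h4 : 2 * capInt k 0 - capInt k (s / 2) ≠ 0 := by linarith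
  rw [← inv_div]
  field_simp

lemma volCoef_pos (k : ℕ) {s : ℝ} (h0 : 0 ≤ s) (h1 : s < 2) : 0 < volCoef (k + 1) s := by
  rw [volCoef_eq k h0 h1]
  have h2 := capInt_pos k (h := s / 2) (by positivity) (by linarith)
  have h3 := capInt_antitone k (h := 0) (h' := s / 2) (by positivity)
  exact div_pos h2 (by linarith)

lemma volCoef_le_one (k : ℕ) {s : ℝ} (h0 : 0 ≤ s) (h1 : s < 2) : volCoef (k + 1) s ≤ 1 := by
  rw [volCoef_eq k h0 h1]
  have h2 := capInt_pos k (h := s / 2) (by positivity) (by linarith)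
  have h3 := capInt_antitone k (h := 0) (h' := s / 2) (by positivity)
  rw [div_le_one (by linarith)]; linarith

lemma volCoef_antitone (k : ℕ) {s s' : ℝ} (h0 : 0 ≤ s) (hss : s ≤ s') (h1 : s' < 2) :
    volCoef (k + 1) s' ≤ volCoef (k + 1) s := by
  rw [volCoef_eq k h0 (by linarith), volCoef_eq k (h0.trans hss) h1]
  have h2 := capInt_pos k (h := s' / 2) (by linarith) (by linarith)
  have h3 := capInt_antitone k (h := s / 2) (h' := s' / 2) (by linarith)
  have h4 := capInt_antitone k (h := 0) (h' := s / 2) (by linarith)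
  have h5 := capInt_pos k (h := s / 2) (by linarith) (by linarith)
  gcongr
  linarith

end Cap

/-! ### The intersection of two balls in Euclidean space -/

section Slicing

variable {k : ℕ}

/-- Slicing of the unit ball of dimension `k + 1` by the first coordinate. -/
lemma volume_slab (h : ℝ) :
    volume {x : EuclideanSpace ℝ (Fin (k + 1)) | ‖x‖ ≤ 1 ∧ h ≤ x 0}
      = ∫⁻ t in Ici h, volume {y : EuclideanSpace ℝ (Fin k) | ‖y‖ ^ 2 ≤ 1 - t ^ 2} := by
  have hmp := (volume_preserving_piFinSuccAbove (fun _ : Fin (k + 1) => ℝ) 0).comp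
    (EuclideanSpace.volume_preserving_symm_measurableEquiv_toLp (Fin (k + 1)))
  have hmp2 := EuclideanSpace.volume_preserving_symm_measurableEquiv_toLp (Fin k)
  set A : Set (ℝ × (Fin k → ℝ)) := {z | h ≤ z.1 ∧ ∑ i, z.2 i ^ 2 ≤ 1 - z.1 ^ 2} with hA
  have hAm : MeasurableSet A := by
    have : A = {z | h ≤ z.1} ∩ {z | ∑ i, z.2 i ^ 2 ≤ 1 - z.1 ^ 2} := rfl
    rw [this]
    exact (measurableSet_le (by fun_prop) (by fun_prop)).inter
      (measurableSet_le (by fun_prop) (by fun_prop))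
  have h1 := hmp.measure_preimage hAm.nullMeasurableSet
  have h2 : (⇑(MeasurableEquiv.piFinSuccAbove (fun _ : Fin (k + 1) => ℝ) 0) ∘
      ⇑(MeasurableEquiv.toLp 2 (Fin (k + 1) → ℝ)).symm) ⁻¹' A
      = {x : EuclideanSpace ℝ (Fin (k + 1)) | ‖x‖ ≤ 1 ∧ h ≤ x 0} := by
    ext x
    have hx : ‖x‖ ≤ 1 ↔ ∑ i : Fin k, x (Fin.succ i) ^ 2 ≤ 1 - x 0 ^ 2 := by
      rw [← sq_le_one_iff₀ (norm_nonneg x), EuclideanSpace.norm_sq_eq, Fin.sum_univ_succ]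
      simp only [Real.norm_eq_abs, sq_abs]
      constructor <;> intro h <;> linarith
    change (h ≤ x 0 ∧ ∑ i : Fin k, x (Fin.succ i) ^ 2 ≤ 1 - x 0 ^ 2) ↔ ‖x‖ ≤ 1 ∧ h ≤ x 0
    rw [hx, and_comm]
  rw [← h2, h1, Measure.volume_eq_prod, Measure.prod_apply hAm,
    ← lintegral_indicator measurableSet_Ici]
  refine lintegral_congr fun t => ?_
  by_cases ht : h ≤ t
  · rw [indicator_of_mem (show t ∈ Ici h from ht)]
    have hm : MeasurableSet (Prod.mk t ⁻¹' A) := measurable_prodMk_left hAm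
    rw [← hmp2.measure_preimage hm.nullMeasurableSet]
    congr 1
    ext y
    rw [mem_ofPred_eq, EuclideanSpace.norm_sq_eq]
    simp only [Real.norm_eq_abs, sq_abs]
    change (h ≤ t ∧ ∑ i : Fin k, y i ^ 2 ≤ 1 - t ^ 2) ↔ _
    simp [ht]
  · rw [indicator_of_notMem (show t ∉ Ici h from ht)]
    have : Prod.mk t ⁻¹' A = ∅ := by
      ext y; simp [hA, ht]
    rw [this, measure_empty]

lemma volume_slice {t : ℝ} (ht : t ^ 2 ≤ 1) :
    volume {y : EuclideanSpace ℝ (Fin k) | ‖y‖ ^ 2 ≤ 1 - t ^ 2}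
      = ENNReal.ofReal (√(1 - t ^ 2) ^ k) *
        volume (closedBall (0 : EuclideanSpace ℝ (Fin k)) 1) := by
  have h1 : {y : EuclideanSpace ℝ (Fin k) | ‖y‖ ^ 2 ≤ 1 - t ^ 2} = closedBall 0 √(1 - t ^ 2) := by
    ext y
    rw [mem_ofPred_eq, mem_closedBall, dist_zero_right, Real.le_sqrt (norm_nonneg _)]
    linarith
  rw [h1, Measure.addHaar_closedBall' _ _ (Real.sqrt_nonneg _), finrank_euclideanSpace_fin]

lemma volume_slice_eq_zero {t : ℝ} (ht : 1 < t ^ 2) :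
    volume {y : EuclideanSpace ℝ (Fin k) | ‖y‖ ^ 2 ≤ 1 - t ^ 2} = 0 := by
  convert measure_empty (μ := (volume : Measure (EuclideanSpace ℝ (Fin k))))
  ext y
  simp only [mem_ofPred_eq, mem_empty_iff_false, iff_false, not_le]
  nlinarith [sq_nonneg ‖y‖]

lemma lintegral_slice {h : ℝ} (h0 : -1 ≤ h) (h1 : h ≤ 1) :
    ∫⁻ t in Ici h, volume {y : EuclideanSpace ℝ (Fin k) | ‖y‖ ^ 2 ≤ 1 - t ^ 2}
      = ENNReal.ofReal (capInt k h) * volume (closedBall (0 : EuclideanSpace ℝ (Fin k)) 1) := by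
  have e1 : Ici h = Icc h 1 ∪ Ioi 1 := by
    ext t; simp only [mem_Ici, mem_union, mem_Icc, mem_Ioi]
    constructor
    · intro ht; rcases le_or_gt t 1 with h | h <;> tauto
    · rintro (h | h) <;> linarith
  have hdisj : Disjoint (Icc h 1) (Ioi (1 : ℝ)) := by
    rw [Set.disjoint_left]; rintro t ⟨-, ht⟩ ht'; exact absurd ht (not_le.2 ht')
  rw [e1, lintegral_union measurableSet_Ioi hdisj,
    setLIntegral_congr_fun measurableSet_Ioi (g := fun _ => 0) (fun t ht =>
      volume_slice_eq_zero (by have : (1 : ℝ) < t := ht; nlinarith)),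
    setLIntegral_congr_fun measurableSet_Icc (g := fun t => ENNReal.ofReal (√(1 - t ^ 2) ^ k) *
        volume (closedBall (0 : EuclideanSpace ℝ (Fin k)) 1)) (fun t ht =>
      volume_slice (by nlinarith [ht.1, ht.2])), lintegral_zero, add_zero,
    lintegral_mul_const _ (by fun_prop)]
  congr 1
  rw [capInt, intervalIntegral.integral_of_le h1, ← integral_Icc_eq_integral_Ioc,
    ofReal_integral_eq_lintegral_ofReal]
  · exact (continuous_slice k).integrableOn_Icc
  · exact ae_of_all _ fun t => by positivity

lemma capInt_neg_one (k : ℕ) : capInt k (-1) = 2 * capInt k 0 := by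
  have h1 := intervalIntegral.integral_add_adjacent_intervals
    (intervalIntegrable_slice k (-1) 0) (intervalIntegrable_slice k 0 1)
  have h2 := intervalIntegral.integral_comp_neg (a := 0) (b := 1) (fun t : ℝ => √(1 - t ^ 2) ^ k)
  simp only [even_two, Even.neg_pow, neg_zero] at h2
  simp only [capInt]
  linarith

/-- The volume of a spherical cap in direction `e`. -/
lemma volume_cap {e : EuclideanSpace ℝ (Fin (k + 1))} (he : ‖e‖ = 1) {h : ℝ} (h0 : -1 ≤ h)
    (h1 : h ≤ 1) : volume {x : EuclideanSpace ℝ (Fin (k + 1)) | ‖x‖ ≤ 1 ∧ h ≤ inner ℝ e x}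
      = ENNReal.ofReal (capInt k h) * volume (closedBall (0 : EuclideanSpace ℝ (Fin k)) 1) := by
  set e₀ : EuclideanSpace ℝ (Fin (k + 1)) := EuclideanSpace.single 0 1 with he₀
  have hn : ‖e‖ = ‖e₀‖ := by rw [he, he₀]; simp
  -- the reflection that maps `e` to the first basis vector
  set ρ := (Submodule.span ℝ {e - e₀})ᗮ.reflection with hρ
  have hρe : ρ e = e₀ := Submodule.reflection_sub hn
  have hmp := ρ.measurePreserving
  rw [← lintegral_slice h0 h1, ← volume_slab h]
  have hm : MeasurableSet {x : EuclideanSpace ℝ (Fin (k + 1)) | ‖x‖ ≤ 1 ∧ h ≤ x 0} := by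
    have : {x : EuclideanSpace ℝ (Fin (k + 1)) | ‖x‖ ≤ 1 ∧ h ≤ x 0}
      = {x | ‖x‖ ≤ 1} ∩ {x | h ≤ x 0} := rfl
    rw [this]
    exact (measurableSet_le (by fun_prop) (by fun_prop)).inter
      (measurableSet_le (by fun_prop) (by fun_prop))
  rw [← hmp.measure_preimage hm.nullMeasurableSet]
  congr 1
  ext x
  have : inner ℝ e x = (ρ x) 0 := by
    rw [← ρ.inner_map_map e x, hρe, he₀, EuclideanSpace.inner_single_left]
    simp
  simp only [mem_ofPred_eq, mem_preimage, this, LinearIsometryEquiv.norm_map]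

lemma volume_closedBall_eq_capInt : volume (closedBall (0 : EuclideanSpace ℝ (Fin (k + 1))) 1)
      = ENNReal.ofReal (2 * capInt k 0) * volume (closedBall (0 : EuclideanSpace ℝ (Fin k)) 1) := by
  have he : ‖(EuclideanSpace.single 0 1 : EuclideanSpace ℝ (Fin (k + 1)))‖ = 1 := by simp
  rw [← capInt_neg_one, ← volume_cap he le_rfl (by norm_num)]
  congr 1
  ext x
  simp only [mem_closedBall, dist_zero_right, mem_ofPred_eq]
  constructor
  · intro hx
    refine ⟨hx, ?_⟩
    have := (abs_le.1 (abs_real_inner_le_norm (EuclideanSpace.single 0 1) x)).1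
    rw [he, one_mul] at this
    linarith
  · exact fun h => h.1

/-- The intersection of two unit balls is contained in two caps. -/
lemma volume_lens_le {a : EuclideanSpace ℝ (Fin (k + 1))} {s : ℝ} (hs0 : 0 ≤ s) (hs2 : s ≤ 2)
    (hsa : s ≤ ‖a‖) : volume (closedBall 0 1 ∩ closedBall a 1)
      ≤ ENNReal.ofReal (capInt k (s / 2) / capInt k 0) *
        volume (closedBall (0 : EuclideanSpace ℝ (Fin (k + 1))) 1) := by
  obtain ⟨e, he, hae⟩ : ∃ e : EuclideanSpace ℝ (Fin (k + 1)), ‖e‖ = 1 ∧ a = ‖a‖ • e := by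
    rcases eq_or_ne a 0 with rfl | hne
    · exact ⟨EuclideanSpace.single 0 1, by simp, by simp⟩
    · have : ‖a‖ ≠ 0 := norm_ne_zero_iff.2 hne
      refine ⟨‖a‖⁻¹ • a, ?_, ?_⟩
      · rw [norm_smul, norm_inv, norm_norm, inv_mul_cancel₀ this]
      · rw [smul_smul, mul_inv_cancel₀ this, one_smul]
  set A := {x : EuclideanSpace ℝ (Fin (k + 1)) | ‖x‖ ≤ 1 ∧ s / 2 ≤ inner ℝ e x} with hA
  have hAv : volume A = _ := volume_cap he (by linarith) (by linarith : s / 2 ≤ 1)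
  have hea : inner ℝ e a = ‖a‖ := by
    conv_lhs => rw [hae]
    rw [inner_smul_right, real_inner_self_eq_norm_sq, he]; ring
  have hAm : MeasurableSet A := by
    have : A = {x | ‖x‖ ≤ 1} ∩ {x | s / 2 ≤ inner ℝ e x} := rfl
    rw [this]
    exact (measurableSet_le (by fun_prop) (by fun_prop)).inter
      (measurableSet_le (by fun_prop) (by fun_prop))
  have hsub : closedBall 0 1 ∩ closedBall a 1 ⊆ A ∪ (fun x => a - x) ⁻¹' A := by
    rintro x ⟨hx1, hx2⟩
    rw [mem_closedBall, dist_zero_right] at hx1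
    rw [mem_closedBall, dist_comm, dist_eq_norm] at hx2
    rcases le_total (s / 2) (inner ℝ e x) with h | h
    · exact Or.inl ⟨hx1, h⟩
    · refine Or.inr ⟨hx2, ?_⟩
      rw [inner_sub_right, hea]; linarith
  have hv2 : volume ((fun x => a - x) ⁻¹' A) = volume A :=
    (Measure.measurePreserving_sub_left volume a).measure_preimage hAm.nullMeasurableSet
  have hc0 : 0 < capInt k 0 := capInt_pos k le_rfl one_pos
  have hc1 : 0 ≤ capInt k (s / 2) := by
    refine le_trans ?_ (capInt_antitone k (by linarith : s / 2 ≤ 1))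
    simp [capInt]
  calc volume (closedBall 0 1 ∩ closedBall a 1) ≤ volume A + volume A := by
        refine (measure_mono hsub).trans ((measure_union_le _ _).trans ?_)
        rw [hv2]
    _ = _ := by
      rw [hAv, volume_closedBall_eq_capInt, ← add_mul, ← ENNReal.ofReal_add hc1 hc1, ← mul_assoc,
        ← ENNReal.ofReal_mul (by positivity)]
      congr 2
      field_simp; ring

open scoped Pointwise in
/-- The volume of the intersection of two balls of radius `R` in `ℝ^(k+1)` whose centres are at
least `s R` apart. -/
lemma volume_lens_radius_le {a : EuclideanSpace ℝ (Fin (k + 1))} {R s : ℝ} (hR : 0 < R)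
    (hs0 : 0 ≤ s) (hs2 : s ≤ 2) (hsa : s * R ≤ ‖a‖) :
    volume (closedBall 0 R ∩ closedBall a R)
      ≤ ENNReal.ofReal (capInt k (s / 2) / capInt k 0 * R ^ (k + 1)) *
        volume (closedBall (0 : EuclideanSpace ℝ (Fin (k + 1))) 1) := by
  have hset : closedBall 0 R ∩ closedBall a R = R • (closedBall 0 1 ∩ closedBall (R⁻¹ • a) 1) := by
    rw [Set.smul_set_inter₀ hR.ne', smul_closedBall' hR.ne', smul_closedBall' hR.ne', smul_zero,
      smul_smul, mul_inv_cancel₀ hR.ne', one_smul, mul_one, Real.norm_of_nonneg hR.le]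
  have h1 := volume_lens_le (a := R⁻¹ • a) hs0 hs2 (by
    rw [norm_smul, norm_inv, Real.norm_of_nonneg hR.le, le_inv_mul_iff₀ hR]; linarith)
  have hc0 : 0 < capInt k 0 := capInt_pos k le_rfl one_pos
  rw [hset, Measure.addHaar_smul, finrank_euclideanSpace_fin, abs_of_nonneg (by positivity),
    mul_comm _ (R ^ (k + 1)), ENNReal.ofReal_mul (by positivity), mul_assoc]
  gcongr

end Slicing

/-! ### Pinsker's inequality -/

section Divergence

/-- Pinsker's inequality for Bernoulli variables. -/
lemma two_mul_sq_le_bernKL {p q : ℝ} (hp : 0 ≤ p) (hpq : p < q) (hq : q < 1) :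
    2 * (q - p) ^ 2 ≤ bernKL p q := by
  -- the difference of the two sides, up to a constant, as a function of `q`; it is monotone
  set H : ℝ → ℝ := fun x => -(p * Real.log x) - (1 - p) * Real.log (1 - x) - 2 * (x - p) ^ 2
    with hH
  have hlogc : ContinuousOn (fun x => p * Real.log x) (Icc p q) := by
    rcases hp.eq_or_lt with h0 | h0
    · simp only [← h0, zero_mul]; exact continuousOn_const
    · exact continuousOn_const.mul (Real.continuousOn_log.mono fun x hx => by
        have : 0 < x := h0.trans_le hx.1
        exact this.ne')
  have hlogc' : ContinuousOn (fun x => (1 - p) * Real.log (1 - x)) (Icc p q) :=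
    continuousOn_const.mul (ContinuousOn.log (by fun_prop) fun x hx => by
      have : x ≤ q := hx.2
      linarith)
  have hder : ∀ x ∈ interior (Icc p q), HasDerivAt H
      (-(p * x⁻¹) - (1 - p) * (-1 / (1 - x)) - 2 * (2 * (x - p))) x := by
    intro x hx
    rw [interior_Icc] at hx
    have hx0 : x ≠ 0 := (hp.trans_lt hx.1).ne'
    have hx1 : 1 - x ≠ 0 := by linarith [hx.2]
    have h1 := ((Real.hasDerivAt_log hx0).const_mul p).neg
    have h2 := (((hasDerivAt_id x).const_sub 1).log hx1).const_mul (1 - p)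
    have h3 := (((hasDerivAt_id x).sub_const p).pow 2).const_mul 2
    refine ((h1.sub h2).sub h3).congr_deriv ?_
    simp
  have hmono : MonotoneOn H (Icc p q) := by
    refine monotoneOn_of_deriv_nonneg (convex_Icc p q) ?_ ?_ ?_
    · exact (hlogc.neg.sub hlogc').sub (by fun_prop)
    · exact fun x hx => (hder x hx).differentiableAt.differentiableWithinAt
    · intro x hx
      rw [(hder x hx).deriv]
      rw [interior_Icc] at hx
      have hx0 : 0 < x := hp.trans_lt hx.1
      have hx1 : 0 < 1 - x := by linarith [hx.2]
      have : -(p * x⁻¹) - (1 - p) * (-1 / (1 - x)) - 2 * (2 * (x - p))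
          = (x - p) * (1 - 2 * x) ^ 2 / (x * (1 - x)) := by
        field_simp; ring
      rw [this]
      have : 0 ≤ x - p := by linarith [hx.1]
      positivity
  have h := hmono (left_mem_Icc.2 hpq.le) (right_mem_Icc.2 hpq.le) hpq.le
  simp only [hH, sub_self] at h
  have hq0 : q ≠ 0 := (hp.trans_lt hpq).ne'
  have e1 : p * Real.log (p / q) = p * Real.log p - p * Real.log q := by
    rcases hp.eq_or_lt with h0 | h0
    · rw [← h0]; ring
    · rw [Real.log_div h0.ne' hq0]; ring
  have e2 : Real.log ((1 - p) / (1 - q)) = Real.log (1 - p) - Real.log (1 - q) :=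
    Real.log_div (by linarith) (by linarith)
  rw [bernKL, e1, e2]
  nlinarith

end Divergence

/-! ### Concentration of the empirical masses -/

section Concentration

/-- Hoeffding's lemma for a Bernoulli variable. -/
lemma bernoulli_mgf_le {θ : ℝ} (h0 : 0 ≤ θ) (h1 : θ ≤ 1) (t : ℝ) :
    θ * Real.exp (t * (1 - θ)) + (1 - θ) * Real.exp (t * (0 - θ)) ≤ Real.exp (t ^ 2 / 8) := by
  set μ : Measure ℝ := ENNReal.ofReal θ • Measure.dirac 1 + ENNReal.ofReal (1 - θ) • Measure.dirac 0
    with hμ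
  have hprob : IsProbabilityMeasure μ := ⟨by
    simp [hμ, ← ENNReal.ofReal_add h0 (sub_nonneg.2 h1)]⟩
  have hint : ∀ F : ℝ → ℝ, ∫ x, F x ∂μ = θ * F 1 + (1 - θ) * F 0 := by
    intro F
    rw [hμ, integral_add_measure, integral_smul_measure, integral_smul_measure, integral_dirac,
      integral_dirac, ENNReal.toReal_ofReal h0, ENNReal.toReal_ofReal (sub_nonneg.2 h1)]
    · simp
    · exact (integrable_dirac (by simp)).smul_measure (by simp)
    · exact (integrable_dirac (by simp)).smul_measure (by simp)
  have h := ProbabilityTheory.hasSubgaussianMGF_of_mem_Icc (μ := μ) (X := fun x : ℝ => x)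
    (a := 0) (b := 1) aemeasurable_id' (by
      rw [hμ, ae_add_measure_iff]
      constructor
      · refine Measure.ae_smul_measure ?_ _
        rw [ae_dirac_eq]; simp
      · refine Measure.ae_smul_measure ?_ _
        rw [ae_dirac_eq]; simp)
  have h2 := h.mgf_le t
  rw [hint] at h2
  rw [ProbabilityTheory.mgf, hint] at h2
  simp only [mul_one, mul_zero, add_zero] at h2
  refine h2.trans (Real.exp_le_exp.2 (le_of_eq ?_))
  simp
  ring

variable {E : Type*} [MeasurableSpace E] {ι : Type*} [Fintype ι]

/-- The exponential Markov inequality for a product of functions of independent variables. -/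
lemma mul_measureReal_pi_le_prod (ν : ι → Measure E) [∀ i, IsProbabilityMeasure (ν i)]
    {g : ι → E → ℝ} (hg0 : ∀ i x, 0 ≤ g i x) (hgi : ∀ i, Integrable (g i) (ν i)) {c : ℝ}
    (hc : 0 ≤ c) {S : Set (ι → E)} (hS : ∀ X ∈ S, c ≤ ∏ i, g i (X i)) :
    c * (Measure.pi ν).real S ≤ ∏ i, ∫ x, g i x ∂(ν i) := by
  have hint : Integrable (fun X : ι → E => ∏ i, g i (X i)) (Measure.pi ν) :=
    Integrable.fintype_prod hgi
  have h1 := mul_meas_ge_le_integral_of_nonneg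
    (ae_of_all _ fun X => Finset.prod_nonneg fun i _ => hg0 i (X i)) hint c
  rw [integral_fintype_prod_eq_prod] at h1
  refine le_trans ?_ h1
  gcongr
  · exact measure_ne_top _ _
  · exact fun X hX => hS X hX

variable {P : Measure E} [IsProbabilityMeasure P]

lemma integral_ite_two {U : Set E} [DecidablePred (· ∈ U)] (hU : MeasurableSet U) (a b : ℝ) :
    ∫ x, (if x ∈ U then a else b) ∂P = P.real U * a + (1 - P.real U) * b := by
  have : (fun x => if x ∈ U then a else b)
      = fun x => U.indicator (fun _ => a) x + Uᶜ.indicator (fun _ => b) x := by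
    ext x; by_cases hx : x ∈ U <;> simp [hx]
  rw [this, integral_add ((integrable_const _).indicator hU)
    ((integrable_const _).indicator hU.compl), integral_indicator_const _ hU,
    integral_indicator_const _ hU.compl, probReal_compl_eq_one_sub hU]
  simp

open Classical in
/-- Hoeffding's lower bound for the number of sample points in `U`. -/
lemma measureReal_card_le (ν : ι → Measure E) [∀ i, IsProbabilityMeasure (ν i)]
    {J : Finset ι} (hJ : ∀ i ∈ J, ν i = P) {U : Set E} (hU : MeasurableSet U) {t : ℝ}
    (ht : 0 ≤ t) (hJ0 : 0 < J.card) :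
    (Measure.pi ν).real {X | ((J.filter fun i => X i ∈ U).card : ℝ) ≤ J.card * P.real U - t}
      ≤ Real.exp (-(2 * t ^ 2 / J.card)) := by
  have hn : (0 : ℝ) < J.card := by exact_mod_cast hJ0
  set z := P.real U with hz
  set n : ℝ := (J.card : ℝ) with hnd
  -- the optimal exponent in the Chernoff bound
  set lam : ℝ := 4 * t / n with hlam
  set g : ι → E → ℝ := fun i x => if i ∈ J then
    (if x ∈ U then Real.exp (-lam * (1 - z)) else Real.exp (-lam * (0 - z))) else 1 with hg
  have hgm : ∀ i, Measurable (g i) := fun i => by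
    by_cases hi : i ∈ J
    · simp only [hg, hi, if_true]
      exact Measurable.ite hU measurable_const measurable_const
    · simp only [hg, hi, if_false]; exact measurable_const
  have hgi : ∀ i, Integrable (g i) (ν i) := fun i => by
    refine Integrable.of_bound (hgm i).aestronglyMeasurable
      (max 1 (max (Real.exp (-lam * (1 - z))) (Real.exp (-lam * (0 - z)))))
      (ae_of_all _ fun x => ?_)
    simp only [hg]
    split_ifs <;> simp
  have hmar := mul_measureReal_pi_le_prod ν (g := g) (fun i x => by
      simp only [hg]; split_ifs <;> positivity) hgi (c := Real.exp (lam * t)) (by positivity)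
    (S := {X | ((J.filter fun i => X i ∈ U).card : ℝ) ≤ n * z - t}) (by
      intro X hX
      have hX' : ((J.filter fun i => X i ∈ U).card : ℝ) ≤ n * z - t := hX
      have h1 : ∏ i, g i (X i) = ∏ i ∈ J, Real.exp (-lam * ((if X i ∈ U then 1 else 0) - z)) := by
        rw [← Finset.prod_subset (Finset.subset_univ J)]
        · refine Finset.prod_congr rfl fun i hi => ?_
          simp only [hg, hi, if_true]
          split_ifs <;> rfl
        · intro i _ hi; simp only [hg, hi, if_false]
      rw [h1, ← Real.exp_sum, ← Finset.mul_sum, Finset.sum_sub_distrib, Finset.sum_boole,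
        Finset.sum_const, nsmul_eq_mul]
      refine Real.exp_le_exp.2 ?_
      have hl : 0 ≤ lam := by positivity
      nlinarith)
  have hprod : ∏ i, ∫ x, g i x ∂(ν i) ≤ Real.exp (n * (lam ^ 2 / 8)) := by
    rw [← Finset.prod_subset (Finset.subset_univ J)]
    · calc ∏ i ∈ J, ∫ x, g i x ∂(ν i) ≤ ∏ _i ∈ J, Real.exp (lam ^ 2 / 8) := by
            refine Finset.prod_le_prod (fun i _ => integral_nonneg fun x => by
              simp only [hg, Pi.zero_apply]; split_ifs <;> positivity) fun i hi => ?_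
            simp only [hg, hi, if_true, hJ i hi]
            rw [integral_ite_two hU]
            have := bernoulli_mgf_le (θ := z) measureReal_nonneg measureReal_le_one (-lam)
            rwa [neg_sq] at this
        _ = _ := by rw [Finset.prod_const, ← Real.exp_nat_mul]
    · intro i _ hi; simp [hg, hi]
  have h2 := hmar.trans hprod
  rw [← le_div_iff₀' (Real.exp_pos _), ← Real.exp_sub] at h2
  refine h2.trans (Real.exp_le_exp.2 (le_of_eq ?_))
  rw [hlam]; field_simp; ring

open Classical in
/-- On the event that the sample points in `U` are exactly those with index in `K`, Hoeffding's
upper bound for the number of those in `A`. The factor `exp (-c)` multiplies the probability of the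
event, so that the bounds can be summed over `K`. -/
lemma measureReal_card_gt_of_eq (ν : ι → Measure E) [∀ i, IsProbabilityMeasure (ν i)]
    {J K : Finset ι} (hJ : ∀ i ∈ J, ν i = P) (hK : K ⊆ J) {A U : Set E} (hA : MeasurableSet A)
    (hU : MeasurableSet U) (hAU : A ⊆ U) {θ : ℝ} (hθ0 : 0 ≤ θ) (hθ1 : θ ≤ 1)
    (hθ : P.real A = P.real U * θ) {c : ℝ} (hc : 0 ≤ c) :
    (Measure.pi ν).real {X | J.filter (fun i => X i ∈ U) = K ∧
        θ * K.card + √(K.card * c / 2) < ((J.filter fun i => X i ∈ A).card : ℝ)}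
      ≤ (P.real U ^ K.card * (1 - P.real U) ^ (J.card - K.card)) * Real.exp (-c) := by
  set z := P.real U with hz
  have hz0 : 0 ≤ z := measureReal_nonneg
  have hz1 : 0 ≤ 1 - z := sub_nonneg.2 measureReal_le_one
  have hfilter : ∀ X : ι → E, J.filter (fun i => X i ∈ U) = K →
      J.filter (fun i => X i ∈ A) = K.filter (fun i => X i ∈ A) := by
    intro X hX
    ext i
    rw [← hX]
    simp only [Finset.mem_filter]
    exact ⟨fun h => ⟨⟨h.1, hAU h.2⟩, h.2⟩, fun h => ⟨h.1.1, h.2⟩⟩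
  rcases K.card.eq_zero_or_pos with hK0 | hK0
  · have hempty : {X : ι → E | J.filter (fun i => X i ∈ U) = K ∧
        θ * K.card + √(K.card * c / 2) < ((J.filter fun i => X i ∈ A).card : ℝ)} = ∅ := by
      ext X
      simp only [mem_ofPred_eq, mem_empty_iff_false, iff_false, not_and, not_lt]
      intro hX
      rw [hfilter X hX, Finset.card_eq_zero.1 hK0]
      simp
    rw [hempty, measureReal_empty]; positivity
  have hn : (0 : ℝ) < K.card := by exact_mod_cast hK0
  set n : ℝ := (K.card : ℝ) with hnd
  set τ := √(n * c / 2) with hτ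
  have hτ0 : 0 ≤ τ := Real.sqrt_nonneg _
  have hτsq : τ ^ 2 = n * c / 2 := Real.sq_sqrt (by positivity)
  set lam : ℝ := 4 * τ / n with hlam
  -- the product of these functions is the exponential weight of the deviation on the event that
  -- exactly the points with index in `K` lie in `U`, and vanishes on the complement
  set g : ι → E → ℝ := fun i x =>
    if i ∈ K then (if x ∈ A then Real.exp (lam * (1 - θ)) else
      if x ∈ U then Real.exp (lam * (0 - θ)) else 0)
    else if i ∈ J then (if x ∈ U then 0 else 1) else 1 with hg
  have hgm : ∀ i, Measurable (g i) := fun i => by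
    by_cases hi : i ∈ K
    · simp only [hg, hi, if_true]
      exact Measurable.ite hA measurable_const (Measurable.ite hU measurable_const measurable_const)
    · by_cases hi' : i ∈ J
      · simp only [hg, hi, hi', if_false, if_true]
        exact Measurable.ite hU measurable_const measurable_const
      · simp only [hg, hi, hi', if_false]; exact measurable_const
  have hg0 : ∀ i x, 0 ≤ g i x := fun i x => by
    simp only [hg]; split_ifs <;> positivity
  have hgi : ∀ i, Integrable (g i) (ν i) := fun i => by
    refine Integrable.of_bound (hgm i).aestronglyMeasurable
      (max 1 (max (Real.exp (lam * (1 - θ))) (Real.exp (lam * (0 - θ)))))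
      (ae_of_all _ fun x => ?_)
    simp only [hg]
    split_ifs <;> simp
  have hmar := mul_measureReal_pi_le_prod ν hg0 hgi (c := Real.exp (lam * τ)) (by positivity)
    (S := {X | J.filter (fun i => X i ∈ U) = K ∧
        θ * n + τ < ((J.filter fun i => X i ∈ A).card : ℝ)}) (by
      rintro X ⟨hX1, hX2⟩
      have hXU : ∀ i ∈ J, (X i ∈ U ↔ i ∈ K) := fun i hi => by
        rw [← hX1]; simp [hi]
      rw [hfilter X hX1] at hX2
      have h1 : ∏ i, g i (X i) = ∏ i ∈ K, Real.exp (lam * ((if X i ∈ A then 1 else 0) - θ)) := by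
        rw [← Finset.prod_subset (Finset.subset_univ K)]
        · refine Finset.prod_congr rfl fun i hi => ?_
          have hiU := (hXU i (hK hi)).2 hi
          simp only [hg, hi, if_true, hiU]
          split_ifs <;> rfl
        · intro i _ hi
          by_cases hi' : i ∈ J
          · have hiU : X i ∉ U := fun h => hi ((hXU i hi').1 h)
            simp only [hg, hi, hi', hiU, if_false, if_true]
          · simp only [hg, hi, hi', if_false]
      rw [h1, ← Real.exp_sum, ← Finset.mul_sum, Finset.sum_sub_distrib, Finset.sum_boole,
        Finset.sum_const, nsmul_eq_mul]
      refine Real.exp_le_exp.2 ?_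
      have hl : 0 ≤ lam := by positivity
      refine mul_le_mul_of_nonneg_left ?_ hl
      linarith)
  have hprod : ∏ i, ∫ x, g i x ∂(ν i)
      ≤ (z * Real.exp (lam ^ 2 / 8)) ^ K.card * (1 - z) ^ (J.card - K.card) := by
    rw [← Finset.prod_subset (Finset.subset_univ J) (fun i _ hi => by
      have : i ∉ K := fun h => hi (hK h)
      simp [hg, hi, this]), ← Finset.prod_sdiff hK, mul_comm]
    refine mul_le_mul ?_ ?_ (Finset.prod_nonneg fun i _ => integral_nonneg (hg0 i)) (by positivity)
    · rw [← Finset.prod_const]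
      refine Finset.prod_le_prod (fun i _ => integral_nonneg (hg0 i)) fun i hi => ?_
      have hsplit : ∀ x, g i x = (if x ∈ A then
          (Real.exp (lam * (1 - θ)) - Real.exp (lam * (0 - θ))) else 0)
          + (if x ∈ U then Real.exp (lam * (0 - θ)) else 0) := by
        intro x
        simp only [hg, hi, if_true]
        by_cases hx : x ∈ A
        · simp [hx, hAU hx]
        · simp [hx]
      have hi1 : Integrable (fun x => if x ∈ A then
          (Real.exp (lam * (1 - θ)) - Real.exp (lam * (0 - θ))) else 0) P :=
        Integrable.of_bound (Measurable.ite hA measurable_const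
          measurable_const).aestronglyMeasurable
          |Real.exp (lam * (1 - θ)) - Real.exp (lam * (0 - θ))| (ae_of_all _ fun x => by
            split_ifs <;> simp)
      have hi2 : Integrable (fun x => if x ∈ U then Real.exp (lam * (0 - θ)) else 0) P :=
        Integrable.of_bound (Measurable.ite hU measurable_const
          measurable_const).aestronglyMeasurable
          (Real.exp (lam * (0 - θ))) (ae_of_all _ fun x => by
            split_ifs <;> simp [Real.exp_nonneg])
      simp_rw [hsplit]
      rw [hJ i (hK hi), integral_add hi1 hi2, integral_ite_two hA, integral_ite_two hU, hθ]
      have := bernoulli_mgf_le hθ0 hθ1 lam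
      calc _ = z * (θ * Real.exp (lam * (1 - θ)) + (1 - θ) * Real.exp (lam * (0 - θ))) := by ring
        _ ≤ _ := by gcongr
    · rw [← Finset.card_sdiff_of_subset hK, ← Finset.prod_const]
      refine Finset.prod_le_prod (fun i _ => integral_nonneg (hg0 i)) fun i hi => ?_
      obtain ⟨hi1, hi2⟩ := Finset.mem_sdiff.1 hi
      simp only [hg, hi1, hi2, if_false, if_true]
      rw [hJ i hi1, integral_ite_two hU]
      simp [hz]
  have h2 := hmar.trans hprod
  rw [← le_div_iff₀' (Real.exp_pos _)] at h2
  refine h2.trans (le_of_eq ?_)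
  rw [mul_pow, ← Real.exp_nat_mul, ← hnd, mul_right_comm, mul_div_assoc, ← Real.exp_sub]
  congr 2
  have : lam ^ 2 = 16 * τ ^ 2 / n ^ 2 := by rw [hlam]; ring
  have h3 : lam * τ = 4 * τ ^ 2 / n := by rw [hlam]; ring
  rw [this, h3, hτsq]
  field_simp
  ring

open Classical in
/-- Among the sample points in `U`, a random number, the frequency of those in `A ⊆ U` exceeds its
conditional probability `θ` only slightly. -/
lemma measureReal_card_gt (ν : ι → Measure E) [∀ i, IsProbabilityMeasure (ν i)]
    {J : Finset ι} (hJ : ∀ i ∈ J, ν i = P) {A U : Set E} (hA : MeasurableSet A)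
    (hU : MeasurableSet U) (hAU : A ⊆ U) {θ : ℝ} (hθ0 : 0 ≤ θ) (hθ1 : θ ≤ 1)
    (hθ : P.real A = P.real U * θ) {c : ℝ} (hc : 0 ≤ c) :
    (Measure.pi ν).real {X | θ * ((J.filter fun i => X i ∈ U).card : ℝ)
          + √(((J.filter fun i => X i ∈ U).card : ℝ) * c / 2)
        < ((J.filter fun i => X i ∈ A).card : ℝ)} ≤ Real.exp (-c) := by
  have hsub : {X : ι → E | θ * ((J.filter fun i => X i ∈ U).card : ℝ)
          + √(((J.filter fun i => X i ∈ U).card : ℝ) * c / 2)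
        < ((J.filter fun i => X i ∈ A).card : ℝ)} ⊆ ⋃ K ∈ J.powerset,
      {X | J.filter (fun i => X i ∈ U) = K ∧
        θ * K.card + √(K.card * c / 2) < ((J.filter fun i => X i ∈ A).card : ℝ)} := by
    intro X hX
    exact mem_iUnion₂.2 ⟨J.filter (fun i => X i ∈ U),
      Finset.mem_powerset.2 (Finset.filter_subset _ _), rfl, hX⟩
  calc _ ≤ (Measure.pi ν).real (⋃ K ∈ J.powerset, {X | J.filter (fun i => X i ∈ U) = K ∧
        θ * K.card + √(K.card * c / 2) < ((J.filter fun i => X i ∈ A).card : ℝ)}) :=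
        measureReal_mono hsub (measure_ne_top _ _)
    _ ≤ ∑ K ∈ J.powerset, (Measure.pi ν).real {X | J.filter (fun i => X i ∈ U) = K ∧
        θ * K.card + √(K.card * c / 2) < ((J.filter fun i => X i ∈ A).card : ℝ)} :=
        measureReal_biUnion_finset_le _ _
    _ ≤ ∑ K ∈ J.powerset, (P.real U ^ K.card * (1 - P.real U) ^ (J.card - K.card))
          * Real.exp (-c) := Finset.sum_le_sum fun K hK =>
        measureReal_card_gt_of_eq ν hJ (Finset.mem_powerset.1 hK) hA hU hAU hθ0 hθ1 hθ hc
    _ = Real.exp (-c) := by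
      -- the binomial theorem: the events over which one sums have total probability `1`
      rw [← Finset.sum_mul, Finset.sum_pow_mul_eq_add_pow]
      simp

end Concentration

/-! ### The test statistic on a typical sample -/

section Statistic

/-- If the empirical gap coefficient is close to `θ`, and `θ` is well below `q`, then the test
statistic is large. -/
lemma le_testStat {N : ℕ} {w : Fin N → Fin N → Prop} {i j : Fin N} {q θ α β L m : ℝ} (hq : q < 1)
    (hβ : 0 < β) (hαβ : β < α) (hL : 0 < L) (hm : 0 < m) (hmN : m / 2 ≤ unionMass w i j)
    (hθq : √(α * L / m) ≤ q - θ)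
    (hS : (interMass w i j : ℝ) ≤ θ * unionMass w i j + √(unionMass w i j * (β * L) / 2)) :
    (√α - √β) ^ 2 * L ≤ testStat w q i j := by
  set M : ℝ := (unionMass w i j : ℝ) with hM
  have hM0 : 0 < M := by linarith
  have hp0 : 0 ≤ gapEst w i j := by unfold gapEst; positivity
  set x := √(L / (2 * M)) with hx
  have hx0 : 0 < x := Real.sqrt_pos.2 (by positivity)
  have hx2 : x ^ 2 = L / (2 * M) := Real.sq_sqrt (by positivity)
  have h1 : √(M * (β * L) / 2) = M * (√β * x) := by
    rw [← Real.sqrt_mul hβ.le, ← Real.sqrt_sq hM0.le, ← Real.sqrt_mul (by positivity),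
      Real.sqrt_sq hM0.le]
    congr 1; field_simp
  have h2 : gapEst w i j ≤ θ + √β * x := by
    rw [gapEst, ← hM, div_le_iff₀ hM0]
    rw [h1] at hS; linarith
  have h3 : √α * x ≤ q - θ := by
    refine le_trans ?_ hθq
    rw [← Real.sqrt_mul (by linarith)]
    refine Real.sqrt_le_sqrt ?_
    rw [mul_div_assoc]
    have : 0 < α := by linarith
    gcongr
    linarith
  have hab : 0 < √α - √β := sub_pos.2 (Real.sqrt_lt_sqrt hβ.le hαβ)
  have h4 : (√α - √β) * x ≤ q - gapEst w i j := by linarith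
  have h5 : gapEst w i j < q := by linarith [mul_pos hab hx0]
  have h6 := two_mul_sq_le_bernKL hp0 h5 hq
  rw [testStat, if_pos h5, mul_one, ← hM]
  have h7 : ((√α - √β) * x) ^ 2 ≤ (q - gapEst w i j) ^ 2 := by gcongr
  calc (√α - √β) ^ 2 * L = M * (2 * ((√α - √β) * x) ^ 2) := by
        rw [mul_pow, hx2]; field_simp
    _ ≤ M * bernKL (gapEst w i j) q := by gcongr; linarith

variable {E : Type*} [PseudoMetricSpace E] {N : ℕ}

open Classical in
lemma unionMass_ballWeight {r : ℝ} {X : Fin N → E} {i j : Fin N} {U : Set E}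
    (hU : closedBall (X i) r ∪ closedBall (X j) r = U) :
    unionMass (ballWeight r X) i j = ((Finset.univ.filter fun c => c ≠ i ∧ c ≠ j).filter
      fun c => X c ∈ U).card := by
  subst hU
  rw [unionMass, ← Set.ncard_coe_finset]
  congr 1
  ext c
  simp [ballWeight, dist_comm, and_assoc]

open Classical in
lemma interMass_ballWeight {r : ℝ} {X : Fin N → E} {i j : Fin N} {U : Set E}
    (hU : closedBall (X i) r ∩ closedBall (X j) r = U) :
    interMass (ballWeight r X) i j = ((Finset.univ.filter fun c => c ≠ i ∧ c ≠ j).filter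
      fun c => X c ∈ U).card := by
  subst hU
  rw [interMass, ← Set.ncard_coe_finset]
  congr 1
  ext c
  simp [ballWeight, dist_comm, and_assoc]

lemma card_filter_ne_ne {n : ℕ} {i j : Fin (n + 2)} (hij : i ≠ j) :
    (Finset.univ.filter fun c => c ≠ i ∧ c ≠ j).card = n := by
  have : (Finset.univ.filter fun c => c ≠ i ∧ c ≠ j) = (Finset.univ.erase i).erase j := by
    ext c; simp [and_comm]
  rw [this, Finset.card_erase_of_mem (by simp [hij.symm]), Finset.card_erase_of_mem (by simp)]
  simp

/-- If no gap is detected up to step `m`, the weights are the non-adaptive ones. -/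
lemma weight_eq_ballWeight {q : ℕ → E → E → ℝ} {h : ℕ → ℝ} {lam : ℝ} {X : Fin N → E} {m : ℕ}
    (hm : 0 ≤ h m) (hX : NoGapUpTo q h lam X m) : weight q h lam X m = ballWeight (h m) X := by
  cases m with
  | zero => rfl
  | succ l =>
    ext a b
    simp only [weight, ballWeight]
    constructor
    · rintro (rfl | ⟨h1, -⟩)
      · rwa [dist_self]
      · exact h1
    · intro h1
      rcases eq_or_ne a b with hab | hab
      · exact Or.inl hab
      · exact Or.inr ⟨h1, hX l (Nat.lt_succ_self l) a b hab h1⟩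

end Statistic

section Sample

variable {E : Type*} [PseudoMetricSpace E] [MeasurableSpace E] [OpensMeasurableSpace E]
  [MeasurableSingletonClass E] {P : Measure E} [IsProbabilityMeasure P]

/-- The probability that the test statistic of two sample points at `x` and `y` is large, when the
conditional probability `θ` of the intersection of their balls given the union is well
below `q`. -/
theorem le_measureReal_testStat {n : ℕ} {i j : Fin (n + 2)} (hij : i ≠ j) {x y : E} {r : ℝ}
    {q : E → E → ℝ} {z θ α β : ℝ} (hβ : 0 < β) (hαβ : β < α) (hz0 : 0 < z)
    (hz : z = P.real (closedBall x r ∪ closedBall y r)) (hθ0 : 0 ≤ θ) (hθ1 : θ ≤ 1)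
    (hθ : P.real (closedBall x r ∩ closedBall y r) = z * θ)
    (hn : 2 * β / z ^ 2 ≤ (n : ℝ) / Real.log n) (hq : q x y < 1)
    (hθq : √(α * Real.log n / (n * z)) ≤ q x y - θ) :
    1 - 3 * (n : ℝ) ^ (-β) ≤ (condSampleLaw P i j x y).real
      {X | (√α - √β) ^ 2 * Real.log n ≤ testStat (ballWeight r X) (q (X i) (X j)) i j} := by
  classical
  -- in particular `n ≥ 2`: otherwise `n / log n` is `0` by convention
  have hpos : 0 < (n : ℝ) / Real.log n := lt_of_lt_of_le (by positivity) hn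
  have hn0 : (0 : ℝ) < n := by
    rcases (Nat.cast_nonneg n : (0 : ℝ) ≤ n).eq_or_lt with h | h
    · rw [← h] at hpos; simp at hpos
    · exact h
  set L := Real.log n with hL
  have hL0 : 0 < L := by
    rcases lt_trichotomy L 0 with h | h | h
    · exact absurd hpos (not_lt.2 (div_nonpos_of_nonneg_of_nonpos hn0.le h.le))
    · rw [h] at hpos; simp at hpos
    · exact h
  set ν : Fin (n + 2) → Measure E :=
    fun l => if l = i then Measure.dirac x else if l = j then Measure.dirac y else P with hν
  have hνp : ∀ l, IsProbabilityMeasure (ν l) := fun l => by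
    simp only [hν]; split_ifs <;> infer_instance
  have hμ : condSampleLaw P i j x y = Measure.pi ν := rfl
  set J : Finset (Fin (n + 2)) := Finset.univ.filter fun c => c ≠ i ∧ c ≠ j with hJ
  have hJc : J.card = n := card_filter_ne_ne hij
  have hJν : ∀ l ∈ J, ν l = P := fun l hl => by
    simp only [hJ, Finset.mem_filter, Finset.mem_univ, true_and] at hl
    simp [hν, hl.1, hl.2]
  have hUm : MeasurableSet (closedBall x r ∪ closedBall y r) :=
    measurableSet_closedBall.union measurableSet_closedBall
  have hAm : MeasurableSet (closedBall x r ∩ closedBall y r) :=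
    measurableSet_closedBall.inter measurableSet_closedBall
  have hAU : closedBall x r ∩ closedBall y r ⊆ closedBall x r ∪ closedBall y r :=
    fun p hp => Or.inl hp.1
  generalize hU : closedBall x r ∪ closedBall y r = U at hz hUm hAU
  generalize hA : closedBall x r ∩ closedBall y r = A at hθ hAm hAU
  have hexp : Real.exp (-(β * L)) = (n : ℝ) ^ (-β) := by
    rw [Real.rpow_def_of_pos hn0]; congr 1; ring
  -- the deviation of the mass of the union that has probability at most `n^(-β)`
  set t := √(β * n * L / 2) with ht
  have ht2 : t ^ 2 = β * n * L / 2 := Real.sq_sqrt (by positivity)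
  have htz : t ≤ n * z / 2 := by
    refine Real.sqrt_le_iff.2 ⟨by positivity, ?_⟩
    rw [div_le_div_iff₀ (by positivity) hL0] at hn
    nlinarith
  set bad0 : Set (Fin (n + 2) → E) := {X | ¬ (X i = x ∧ X j = y)} with hb0
  set bad1 : Set (Fin (n + 2) → E) :=
    {X | ((J.filter fun l => X l ∈ U).card : ℝ) ≤ J.card * P.real U - t} with hb1
  set bad2 : Set (Fin (n + 2) → E) := {X | θ * ((J.filter fun l => X l ∈ U).card : ℝ)
          + √(((J.filter fun l => X l ∈ U).card : ℝ) * (β * L) / 2)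
        < ((J.filter fun l => X l ∈ A).card : ℝ)} with hb2
  have hp0 : (Measure.pi ν).real bad0 = 0 := by
    have hi : ∀ᵐ X ∂(Measure.pi ν), X i = x := by
      have h1 : ∀ᵐ p ∂(ν i), p = x := by simp [hν, ae_dirac_eq]
      exact Measure.tendsto_eval_ae_ae.eventually h1
    have hj : ∀ᵐ X ∂(Measure.pi ν), X j = y := by
      have h1 : ∀ᵐ p ∂(ν j), p = y := by simp [hν, ae_dirac_eq, hij.symm]
      exact Measure.tendsto_eval_ae_ae.eventually h1
    have h2 : Measure.pi ν bad0 = 0 := hi.and hj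
    rw [measureReal_def, h2, ENNReal.toReal_zero]
  have hp1 : (Measure.pi ν).real bad1 ≤ (n : ℝ) ^ (-β) := by
    refine (measureReal_card_le ν hJν hUm (t := t) (Real.sqrt_nonneg _) ?_).trans ?_
    · rw [hJc]; exact_mod_cast hn0
    · rw [← hexp, hJc, ht2]
      refine Real.exp_le_exp.2 (le_of_eq ?_)
      field_simp
  have hp2 : (Measure.pi ν).real bad2 ≤ (n : ℝ) ^ (-β) := by
    rw [← hexp]
    exact measureReal_card_gt ν hJν hAm hUm hAU hθ0 hθ1 (by rw [hθ, hz]) (by positivity)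
  set S : Set (Fin (n + 2) → E) :=
    {X | (√α - √β) ^ 2 * L ≤ testStat (ballWeight r X) (q (X i) (X j)) i j} with hS
  have hsub : Sᶜ ⊆ bad0 ∪ (bad1 ∪ bad2) := by
    intro X hX
    by_contra hcon
    rw [mem_union, mem_union, not_or, not_or] at hcon
    obtain ⟨h0, h1, h2⟩ := hcon
    simp only [hb0, mem_ofPred_eq, not_not] at h0
    simp only [hb1, mem_ofPred_eq, not_le] at h1
    simp only [hb2, mem_ofPred_eq, not_lt] at h2
    refine hX ?_
    rw [hS, mem_ofPred_eq]
    have hum := unionMass_ballWeight (X := X) (i := i) (j := j) (r := r) (U := U)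
      (by rw [h0.1, h0.2, hU])
    have him := interMass_ballWeight (X := X) (i := i) (j := j) (r := r) (U := A)
      (by rw [h0.1, h0.2, hA])
    rw [hJc, ← hz] at h1
    rw [h0.1, h0.2]
    refine le_testStat (m := n * z) (θ := θ) hq hβ hαβ hL0 (by positivity) ?_ hθq ?_
    · rw [hum]; linarith
    · rw [hum, him]; exact h2
  have hcompl : (Measure.pi ν).real Sᶜ ≤ 2 * (n : ℝ) ^ (-β) := by
    calc (Measure.pi ν).real Sᶜ ≤ (Measure.pi ν).real (bad0 ∪ (bad1 ∪ bad2)) :=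
          measureReal_mono hsub (measure_ne_top _ _)
      _ ≤ (Measure.pi ν).real bad0 + ((Measure.pi ν).real bad1 + (Measure.pi ν).real bad2) :=
          (measureReal_union_le _ _).trans (by gcongr; exact measureReal_union_le _ _)
      _ ≤ _ := by linarith
  have huniv : (1 : ℝ) ≤ (Measure.pi ν).real S + (Measure.pi ν).real Sᶜ := by
    have := measureReal_union_le (μ := Measure.pi ν) S Sᶜ
    rwa [union_compl_self, probReal_univ] at this
  have hnn : 0 ≤ (n : ℝ) ^ (-β) := by positivity
  rw [hμ]
  linarith

end Sample

/-! ### Bounds for the gap coefficient -/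

section Arithmetic

/-- Upper bound for the share `a / (p₁ + p₂ - a)` of the intersection, when `a` is the mass of the
intersection of two balls of masses `p₁`, `p₂`. Here `F` is the mass of a ball in the Euclidean
model, `ρ` the share of one ball that lies in the other, and `u`, `v` measure the effects of
curvature and noise. -/
lemma gap_arith {F a p₁ p₂ ρ u v ε : ℝ} (hF : 0 < F) (hρ0 : 0 < ρ) (hρ1 : ρ ≤ 1)
    (hu : 0 ≤ u) (hv : 0 ≤ v) (hε : 7 * (84 * u + 80 * v) ≤ ε) (hε1 : ε < 1)
    (ha : a ≤ (1 - ε) * F * (ρ * (1 + 10 * u + 7 * v)))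
    (h₁ : F * (1 - 2 * u - 2 * v) ≤ p₁) (h₂ : F * (1 - 2 * u - 2 * v) ≤ p₂) :
    0 < p₁ + p₂ - a ∧
      a / (p₁ + p₂ - a) ≤ (1 - ε) * (ρ / (2 - ρ)) * (1 + (84 * u + 80 * v)) := by
  set w := 1 + 10 * u + 7 * v with hw
  set t := 2 * (1 - 2 * u - 2 * v) - ρ * w with ht
  have hε0 : 0 ≤ ε := by linarith
  have hw0 : 0 < w := by positivity
  have hw2 : ρ * w ≤ ρ + (10 * u + 7 * v) := by rw [hw]; nlinarith
  have ht1 : (2 - ρ) * (1 - 14 * u - 11 * v) ≤ t := by rw [ht]; nlinarith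
  have h6 : 0 < 1 - 14 * u - 11 * v := by linarith
  have ht0 : 0 < t := lt_of_lt_of_le (mul_pos (by linarith) h6) ht1
  have hFρw : 0 ≤ F * (ρ * w) := by positivity
  have ha' : a ≤ F * (ρ * w) := by nlinarith
  have hden : F * t ≤ p₁ + p₂ - a := by rw [ht]; linarith
  have hpos : 0 < p₁ + p₂ - a := lt_of_lt_of_le (mul_pos hF ht0) hden
  refine ⟨hpos, ?_⟩
  have key : w * (2 - ρ) ≤ (1 + (84 * u + 80 * v)) * t := by
    have h7 : w ≤ (1 + (84 * u + 80 * v)) * (1 - 14 * u - 11 * v) := by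
      have : (84 * u + 80 * v) * (14 * u + 11 * v) ≤ 1 / 7 * (14 * u + 11 * v) := by
        gcongr; linarith
      rw [hw]; nlinarith
    calc w * (2 - ρ) ≤ (1 + (84 * u + 80 * v)) * (1 - 14 * u - 11 * v) * (2 - ρ) := by
          gcongr; linarith
      _ = (1 + (84 * u + 80 * v)) * ((2 - ρ) * (1 - 14 * u - 11 * v)) := by ring
      _ ≤ _ := by gcongr
  have h1ε : 0 ≤ 1 - ε := by linarith
  calc a / (p₁ + p₂ - a) ≤ (1 - ε) * F * (ρ * w) / (F * t) := by gcongr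
    _ = (1 - ε) * ρ * (w / t) := by field_simp
    _ ≤ (1 - ε) * ρ * ((1 + (84 * u + 80 * v)) / (2 - ρ)) := by
        have : w / t ≤ (1 + (84 * u + 80 * v)) / (2 - ρ) := by
          rw [div_le_div_iff₀ ht0 (by linarith)]; exact key
        gcongr
    _ = _ := by ring

/-- The margin by which the adjusted volume coefficient exceeds the gap coefficient; `p`, `q` are
the effects of curvature and noise. -/
lemma adj_arith {p q ε Q θ : ℝ} (hp : 0 ≤ p) (hq : 0 ≤ q) (hQ : 0 ≤ Q) (hε : 7 * (p + q) ≤ ε)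
    (hθ : θ ≤ (1 - ε) * Q * (1 + (p + q))) :
    5 / 7 * ε * Q ≤ (1 + p)⁻¹ * (1 + q)⁻¹ * Q - θ := by
  have h1 : 1 - p ≤ (1 + p)⁻¹ := by
    rw [← one_div, le_div_iff₀ (by linarith)]; nlinarith
  have h2 : 1 - q ≤ (1 + q)⁻¹ := by
    rw [← one_div, le_div_iff₀ (by linarith)]; nlinarith
  have h4 : (1 + p)⁻¹ ≤ 1 := inv_le_one_of_one_le₀ (by linarith)
  have h3 : 1 - (p + q) ≤ (1 + p)⁻¹ * (1 + q)⁻¹ := by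
    have hpp : 0 ≤ (1 + p)⁻¹ := by positivity
    have hqq : (1 + q)⁻¹ ≤ 1 := inv_le_one_of_one_le₀ (by linarith)
    nlinarith
  have h5 : (1 - (p + q)) * Q ≤ (1 + p)⁻¹ * (1 + q)⁻¹ * Q := by gcongr
  have h6 : 0 ≤ (p + q) * ε * Q := by
    have : 0 ≤ ε := by linarith
    positivity
  nlinarith

/-- The volume distortion of the projection to a tangent space, times the enlargement of the balls
by the noise. -/
lemma pow_mul_pow_le {d : ℕ} {x y u v : ℝ} (hx : 0 ≤ x) (hy : 0 ≤ y) (hu : d * x ≤ u)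
    (hv : d * y ≤ v) (hsmall : 7 * (84 * u + 80 * v) ≤ 1) :
    (1 + 7 * x) ^ d * (1 + 2 * y) ^ d ≤ 1 + 8 * u + 3 * v := by
  have h1 : (1 + 7 * x) ^ d ≤ Real.exp (7 * x) ^ d := by
    gcongr; linarith [Real.add_one_le_exp (7 * x)]
  have h2 : (1 + 2 * y) ^ d ≤ Real.exp (2 * y) ^ d := by
    gcongr; linarith [Real.add_one_le_exp (2 * y)]
  have hu0 : 0 ≤ u := le_trans (by positivity) hu
  have hv0 : 0 ≤ v := le_trans (by positivity) hv
  set t := 7 * u + 2 * v with ht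
  have ht0 : 0 ≤ t := by positivity
  have ht1 : t ≤ 1 / 50 := by linarith
  have h3 : Real.exp t ≤ 1 + t + t ^ 2 := by
    have := Real.abs_exp_sub_one_sub_id_le (x := t) (by rw [abs_of_nonneg ht0]; linarith)
    linarith [(abs_le.1 this).2]
  calc (1 + 7 * x) ^ d * (1 + 2 * y) ^ d ≤ Real.exp (7 * x) ^ d * Real.exp (2 * y) ^ d := by
        gcongr
    _ = Real.exp (7 * (d * x) + 2 * (d * y)) := by
        rw [← Real.exp_nat_mul, ← Real.exp_nat_mul, ← Real.exp_add]; congr 1; ring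
    _ ≤ Real.exp t := Real.exp_le_exp.2 (by rw [ht]; linarith)
    _ ≤ 1 + t + t ^ 2 := h3
    _ ≤ _ := by nlinarith

end Arithmetic

/-! ### The effect of noise on masses -/

section Noise

variable {E : Type*} [NormedAddCommGroup E] [MeasurableSpace E] [BorelSpace E]
  [SecondCountableTopology E] {Ω : Type*} [MeasurableSpace Ω] {Q : Measure Ω} {X₀ ξ : Ω → E}
  {rξ : ℝ}

lemma map_add_le (hX₀ : Measurable X₀) (hξ : Measurable ξ) (hξr : ∀ᵐ ω ∂Q, ‖ξ ω‖ ≤ rξ)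
    {S S' : Set E} (hS : MeasurableSet S) (hS' : MeasurableSet S')
    (h : ∀ p e, ‖e‖ ≤ rξ → p + e ∈ S → p ∈ S') :
    Q.map (fun ω => X₀ ω + ξ ω) S ≤ Q.map X₀ S' := by
  rw [Measure.map_apply (show Measurable fun ω => X₀ ω + ξ ω from hX₀.add hξ) hS,
    Measure.map_apply hX₀ hS']
  refine measure_mono_ae ?_
  filter_upwards [hξr] with ω hω hmem using h _ _ hω hmem

lemma le_map_add (hX₀ : Measurable X₀) (hξ : Measurable ξ) (hξr : ∀ᵐ ω ∂Q, ‖ξ ω‖ ≤ rξ)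
    {S S' : Set E} (hS : MeasurableSet S) (hS' : MeasurableSet S')
    (h : ∀ p e, ‖e‖ ≤ rξ → p ∈ S' → p + e ∈ S) :
    Q.map X₀ S' ≤ Q.map (fun ω => X₀ ω + ξ ω) S := by
  rw [Measure.map_apply (show Measurable fun ω => X₀ ω + ξ ω from hX₀.add hξ) hS,
    Measure.map_apply hX₀ hS']
  refine measure_mono_ae ?_
  filter_upwards [hξr] with ω hω hmem using h _ _ hω hmem

end Noise

/-! ### Masses of balls compared with Euclidean space -/

section Dimension

variable {E : Type*} [NormedAddCommGroup E] [InnerProductSpace ℝ E] [FiniteDimensional ℝ E] {d : ℕ}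
  {M : Set E} {κ : ℝ}

/-- A submanifold of positive reach and dimension `0` has no two distinct points close together. -/
lemma dim_pos_of_norm_sub_lt (hMc : IsCompact M) (hM : IsC2Submanifold d M) (hκ : 0 < κ)
    (hreach : ENNReal.ofReal (1 / κ) ≤ reach M) {p q : E} (hp : p ∈ M) (hq : q ∈ M) (hpq : p ≠ q)
    (hlt : κ * ‖p - q‖ < 2) : 0 < d := by
  rcases Nat.eq_zero_or_pos d with rfl | hd
  · exfalso
    obtain ⟨T, hT⟩ := hM.exists_isTangent hq
    obtain ⟨B, N, h⟩ := exists_isFrame hT.finrank_eq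
    have h1 := h.norm_normal_sub_le hMc hκ hreach hT hp
    have h2 := h.norm_le_add (p - q)
    rw [Subsingleton.elim (B (p - q)) 0, norm_zero, zero_add] at h2
    have h3 : 0 < ‖p - q‖ := norm_pos_iff.2 (sub_ne_zero.2 hpq)
    nlinarith
  · exact hd

end Dimension

section Masses

variable {E : Type*} [NormedAddCommGroup E] [InnerProductSpace ℝ E] [MeasurableSpace E]
  [BorelSpace E] [FiniteDimensional ℝ E] {d : ℕ}
  {M : Set E} {κ : ℝ}

/-- The volume of the unit ball in dimension `d`. -/
noncomputable def unitBallVol (d : ℕ) : ℝ :=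
  volume.real (closedBall (0 : EuclideanSpace ℝ (Fin d)) 1)

lemma unitBallVol_pos (d : ℕ) : 0 < unitBallVol d :=
  ENNReal.toReal_pos (measure_closedBall_pos _ _ one_pos).ne' measure_closedBall_lt_top.ne

lemma volume_unitBall (d : ℕ) :
    volume (closedBall (0 : EuclideanSpace ℝ (Fin d)) 1) = ENNReal.ofReal (unitBallVol d) :=
  (ENNReal.ofReal_toReal measure_closedBall_lt_top.ne).symm

/-- The chord between the projected centres, in units of the enlarged radius `R`. -/
lemma sub_mul_le_of_chord {κ r x y s c a R : ℝ} (hκ : 0 ≤ κ) (hr : 0 < r) (hx : x = κ * r)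
    (hx0 : 0 ≤ x) (hy0 : 0 ≤ y) (hys : y ≤ 1 / 1000)
    (hs2 : s < 2) (hc0 : 0 ≤ c) (hc1 : (s - 2 * y) * r ≤ c) (hc2 : c ≤ (s + 2 * y) * r)
    (ha : c - κ / 2 * c ^ 2 ≤ a) (hR : R = r * (1 + 2 * y)) :
    (s - (6 * y + 3 * x)) * R ≤ a := by
  have h3 : c ≤ 21 / 10 * r := hc2.trans (mul_le_mul_of_nonneg_right (by linarith) hr.le)
  have h4 : κ / 2 * c ^ 2 ≤ 3 * x * r := by
    calc κ / 2 * c ^ 2 ≤ κ / 2 * (21 / 10 * r) ^ 2 := by gcongr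
      _ = 441 / 200 * (x * r) := by rw [hx]; ring
      _ ≤ 3 * (x * r) := mul_le_mul_of_nonneg_right (by norm_num) (mul_nonneg hx0 hr.le)
      _ = _ := by ring
  have h6 : (s - (6 * y + 3 * x)) * (1 + 2 * y) ≤ s - 2 * y - 3 * x := by
    have h7 : s * y ≤ 2 * y := mul_le_mul_of_nonneg_right hs2.le hy0
    have h8 : 0 ≤ x * y := mul_nonneg hx0 hy0
    nlinarith [mul_nonneg hy0 hy0]
  have h5 : (s - (6 * y + 3 * x)) * R ≤ (s - 2 * y - 3 * x) * r := by
    calc _ = (s - (6 * y + 3 * x)) * (1 + 2 * y) * r := by rw [hR]; ring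
      _ ≤ _ := mul_le_mul_of_nonneg_right h6 hr.le
  linarith

/-- The volume of the cap is stable under a change of its height, relative to its size. -/
lemma capInt_le_mul {k : ℕ} {s s' b' x y u v G : ℝ} (hs0 : 0 ≤ s) (hsb : s ≤ b') (hb2 : b' < 2)
    (hG : G = (1 - (b' / 2) ^ 2) ^ (((k : ℝ) + 2) / 2)) (hu0 : 0 ≤ u) (hv0 : 0 ≤ v)
    (hGx : ((k : ℝ) + 2) * x = u * G) (hGy : ((k : ℝ) + 2) * y = v * G) (hs's : s' ≤ s)
    (hss' : s - s' ≤ 6 * y + 3 * x) :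
    capInt k (s' / 2) ≤ capInt k (s / 2) * (1 + 3 / 2 * u + 3 * v) := by
  have hk0 : (0 : ℝ) < (k : ℝ) + 2 := by positivity
  have h1 := capInt_le_add k (h := s' / 2) (h' := s / 2) (by linarith)
  have h3 : G / ((k : ℝ) + 2) ≤ capInt k (s / 2) := by
    refine le_trans ?_ (le_capInt k (by linarith) (by linarith))
    rw [hG]
    refine div_le_div_of_nonneg_right (Real.rpow_le_rpow ?_ ?_ (by linarith)) hk0.le
    · nlinarith
    · nlinarith
  have h4 : 3 / 2 * x + 3 * y = G / ((k : ℝ) + 2) * (3 / 2 * u + 3 * v) := by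
    rw [eq_comm, div_mul_eq_mul_div, div_eq_iff hk0.ne']; linarith
  have h5 : G / ((k : ℝ) + 2) * (3 / 2 * u + 3 * v)
      ≤ capInt k (s / 2) * (3 / 2 * u + 3 * v) :=
    mul_le_mul_of_nonneg_right h3 (by linarith)
  linarith

/-- Volume of the intersection of two balls of a manifold, relative to the intersection of two balls
of radius `r` in `ℝ^(k+1)` whose centres are `s r` apart. -/
lemma measure_inter_le {k : ℕ} (hMc : IsCompact M) (hM : IsC2Submanifold (k + 1) M) (hκ : 0 < κ)
    (hreach : ENNReal.ofReal (1 / κ) ≤ reach M) {p q : E} (hp : p ∈ M) (hq : q ∈ M)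
    {r y s b' u v G : ℝ} (hr : 0 < r) (hy0 : 0 ≤ y) (hs0 : 0 ≤ s) (hsb : s ≤ b') (hb2 : b' < 2)
    (hpq1 : (s - 2 * y) * r ≤ ‖p - q‖) (hpq2 : ‖p - q‖ ≤ (s + 2 * y) * r)
    (hG : G = (1 - (b' / 2) ^ 2) ^ (((k : ℝ) + 2) / 2)) (hu0 : 0 ≤ u) (hv0 : 0 ≤ v)
    (hGx : ((k : ℝ) + 2) * (κ * r) = u * G) (hGy : ((k : ℝ) + 2) * y = v * G)
    (huv : 7 * (84 * u + 80 * v) ≤ 1) :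
    Measure.euclideanHausdorffMeasure (k + 1)
        (M ∩ (closedBall p (r * (1 + 2 * y)) ∩ closedBall q (r * (1 + 2 * y))))
      ≤ ENNReal.ofReal (unitBallVol (k + 1) * r ^ (k + 1) *
          (capInt k (s / 2) / capInt k 0 * (1 + 10 * u + 7 * v))) := by
  have hx0 : 0 < κ * r := mul_pos hκ hr
  have hk0 : (0 : ℝ) ≤ k := Nat.cast_nonneg k
  obtain ⟨x, hx⟩ : ∃ x, x = κ * r := ⟨_, rfl⟩
  rw [← hx] at hx0 hGx
  have hG1 : G ≤ 1 := by
    rw [hG]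
    exact Real.rpow_le_one (by nlinarith) (by nlinarith [sq_nonneg (b' / 2)]) (by linarith)
  have hux : ((k : ℝ) + 2) * x ≤ u := by
    rw [hGx]; exact mul_le_of_le_one_right hu0 hG1
  have hvy : ((k : ℝ) + 2) * y ≤ v := by
    rw [hGy]; exact mul_le_of_le_one_right hv0 hG1
  have hkx := mul_nonneg hk0 hx0.le
  have hky := mul_nonneg hk0 hy0
  have hxs : x ≤ 1 / 1000 := by linarith
  have hys : y ≤ 1 / 1000 := by linarith
  obtain ⟨R, hR⟩ : ∃ R, R = r * (1 + 2 * y) := ⟨_, rfl⟩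
  rw [← hR]
  have hR0 : 0 < R := by rw [hR]; exact mul_pos hr (by linarith)
  have hκR : κ * R ≤ 7 / 6 * x := by
    have h1 : κ * R = x * (1 + 2 * y) := by rw [hR, hx]; ring
    rw [h1, mul_comm]
    exact mul_le_mul_of_nonneg_right (by linarith) hx0.le
  have hκR0 : 0 < κ * R := mul_pos hκ hR0
  obtain ⟨a, ha, hmeas⟩ := measure_inter_closedBall_le hMc hM hκ hreach hp hq hR0.le (R := R)
    (by linarith)
  -- the centres of the projected balls are at distance at least `s' R`
  obtain ⟨s', hs'⟩ : ∃ s', s' = max 0 (s - (6 * y + 3 * x)) := ⟨_, rfl⟩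
  have hs'0 : 0 ≤ s' := hs'.symm ▸ le_max_left _ _
  have hs's : s' ≤ s := hs'.symm ▸ max_le hs0 (by linarith)
  have hss' : s - s' ≤ 6 * y + 3 * x := by
    linarith [hs'.symm ▸ le_max_right 0 (s - (6 * y + 3 * x))]
  have hs'a : s' * R ≤ ‖a‖ := by
    rcases le_total (s - (6 * y + 3 * x)) 0 with h1 | h1
    · rw [hs', max_eq_left h1, zero_mul]; exact norm_nonneg _
    · rw [hs', max_eq_right h1]
      exact sub_mul_le_of_chord hκ.le hr hx hx0.le hy0 hys (by linarith) (norm_nonneg _) hpq1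
        hpq2 ha hR
  have hlens := volume_lens_radius_le hR0 hs'0 (by linarith) hs'a
  have hc0 : 0 < capInt k 0 := capInt_pos k le_rfl one_pos
  have hcs : 0 < capInt k (s / 2) := capInt_pos k (by linarith) (by linarith)
  have hcs' : 0 < capInt k (s' / 2) := capInt_pos k (by linarith) (by linarith)
  have hcap := capInt_le_mul hs0 hsb hb2 hG hu0 hv0 hGx hGy hs's hss'
  have hpow : (1 + 6 * κ * R) ^ (k + 1) * (1 + 2 * y) ^ (k + 1) ≤ 1 + 8 * u + 3 * v := by
    have h1 := pow_mul_pow_le (d := k + 1) (u := u) (v := v) hx0.le hy0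
      (by push_cast; linarith) (by push_cast; linarith) huv
    refine le_trans (mul_le_mul_of_nonneg_right (pow_le_pow_left₀ (by linarith) (by linarith) _)
      (pow_nonneg (by linarith) _)) h1
  have hw : (1 + 3 / 2 * u + 3 * v) * (1 + 8 * u + 3 * v) ≤ 1 + 10 * u + 7 * v := by
    have h1 : u * u ≤ u * (1 / 588) := mul_le_mul_of_nonneg_left (by linarith) hu0
    have h2 : u * v ≤ u * (1 / 560) := mul_le_mul_of_nonneg_left (by linarith) hu0
    have h3 : v * v ≤ v * (1 / 560) := mul_le_mul_of_nonneg_left (by linarith) hv0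
    nlinarith
  have hω := unitBallVol_pos (k + 1)
  have hRk : R ^ (k + 1) = r ^ (k + 1) * (1 + 2 * y) ^ (k + 1) := by rw [hR, mul_pow]
  have hA : 0 ≤ (1 + 6 * κ * R) ^ (k + 1) := pow_nonneg (by linarith) _
  have hB : 0 ≤ (1 + 2 * y) ^ (k + 1) := pow_nonneg (by linarith) _
  have hr1 : 0 < r ^ (k + 1) := pow_pos hr _
  refine hmeas.trans ((mul_le_mul_right hlens _).trans ?_)
  rw [volume_unitBall, ← ENNReal.ofReal_mul (by positivity), ← ENNReal.ofReal_mul hA]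
  refine ENNReal.ofReal_le_ofReal ?_
  rw [hRk]
  generalize (1 + 6 * κ * R) ^ (k + 1) = A at *
  generalize (1 + 2 * y) ^ (k + 1) = B at *
  generalize r ^ (k + 1) = r1 at *
  generalize unitBallVol (k + 1) = w at *
  generalize capInt k (s' / 2) = c' at *
  generalize capInt k (s / 2) = c at *
  generalize capInt k 0 = c0 at *
  have h1 : c' * (A * B) ≤ c * (1 + 10 * u + 7 * v) := by
    calc c' * (A * B) ≤ c * (1 + 3 / 2 * u + 3 * v) * (1 + 8 * u + 3 * v) :=
          mul_le_mul hcap hpow (mul_nonneg hA hB) (hcs'.le.trans hcap)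
      _ = c * ((1 + 3 / 2 * u + 3 * v) * (1 + 8 * u + 3 * v)) := by ring
      _ ≤ _ := mul_le_mul_of_nonneg_left hw hcs.le
  calc A * (c' / c0 * (r1 * B) * w) = w * r1 / c0 * (c' * (A * B)) := by ring
    _ ≤ w * r1 / c0 * (c * (1 + 10 * u + 7 * v)) :=
        mul_le_mul_of_nonneg_left h1 (div_pos (mul_pos hω hr1) hc0).le
    _ = _ := by ring

/-- Lower bound for the volume of the balls of a manifold, relative to `ℝ^d`. -/
lemma le_measure_closedBall (hMc : IsCompact M) (hM : IsC2Submanifold d M) (hκ : 0 < κ)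
    (hreach : ENNReal.ofReal (1 / κ) ≤ reach M) {p : E} (hp : p ∈ M) {r y u v : ℝ}
    (hr : 0 < r) (hy0 : 0 ≤ y) (hu : d * (κ * r) ≤ u) (hv : d * y ≤ v) (hx : κ * r ≤ 1 / 1000)
    (hy : y ≤ 1 / 1000) :
    ENNReal.ofReal (unitBallVol d * r ^ d * (1 - 2 * u - 2 * v)) ≤
      Measure.euclideanHausdorffMeasure d (closedBall p (r * (1 - 2 * y - κ * r)) ∩ M) := by
  have hx0 : 0 < κ * r := by positivity
  set r' := r * (1 - 2 * y - κ * r) with hr'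
  have hr'0 : 0 < r' := mul_pos hr (by linarith)
  have hr'r : r' ≤ r := by rw [hr']; nlinarith
  have hκr' : κ * r' ≤ κ * r := by gcongr
  rw [inter_comm]
  refine le_trans ?_ (volume_closedBall_le_measure hMc hM hκ hreach hp hr'0 (by linarith))
  have hnn : 0 ≤ r' * (1 - κ * r') := mul_nonneg hr'0.le (by linarith)
  rw [Measure.addHaar_closedBall' _ _ hnn, finrank_euclideanSpace_fin, volume_unitBall,
    ← ENNReal.ofReal_mul (by positivity)]
  refine ENNReal.ofReal_le_ofReal ?_
  have hω := unitBallVol_pos d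
  have h1 : r * (1 - (2 * y + 2 * (κ * r))) ≤ r' * (1 - κ * r') := by
    have h2 : r' * (1 - κ * r) ≤ r' * (1 - κ * r') := by gcongr
    refine le_trans ?_ h2
    rw [hr', mul_assoc]
    gcongr
    nlinarith [mul_nonneg hy0 hx0.le, mul_pos hx0 hx0]
  have h3 : 1 - 2 * u - 2 * v ≤ (1 - (2 * y + 2 * (κ * r))) ^ d := by
    have := one_add_mul_le_pow (a := -(2 * y + 2 * (κ * r))) (by linarith) d
    rw [← sub_eq_add_neg] at this
    linarith
  calc unitBallVol d * r ^ d * (1 - 2 * u - 2 * v)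
      ≤ unitBallVol d * r ^ d * (1 - (2 * y + 2 * (κ * r))) ^ d := by gcongr
    _ = (r * (1 - (2 * y + 2 * (κ * r)))) ^ d * unitBallVol d := by rw [mul_pow]; ring
    _ ≤ (r' * (1 - κ * r')) ^ d * unitBallVol d := by
        have : 0 ≤ r * (1 - (2 * y + 2 * (κ * r))) := mul_nonneg hr.le (by linarith)
        gcongr

end Masses

/-! ### The gap coefficient of two points near different clusters -/

section Gap

variable {E : Type*} [NormedAddCommGroup E] [InnerProductSpace ℝ E] [MeasurableSpace E]
  [BorelSpace E] [FiniteDimensional ℝ E] {d : ℕ} {M : Set E} {κ : ℝ}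
  {Ω : Type*} [MeasurableSpace Ω] {Q : Measure Ω} {X₀ ξ : Ω → E} {f : E → ℝ} {rξ : ℝ}

/-- Noisy balls around points close to a cluster have at least the mass of a smaller ball of the
manifold around a cluster point. -/
lemma le_measure_closedBall_of_thick (hX₀ : Measurable X₀) (hξ : Measurable ξ)
    (hlaw : Q.map X₀ = ((Measure.euclideanHausdorffMeasure d).restrict M).withDensity
      (fun x => ENNReal.ofReal (f x)))
    (hξr : ∀ᵐ ω ∂Q, ‖ξ ω‖ ≤ rξ) {x c : E} (hxc : dist x c ≤ rξ) {r r' f₀ : ℝ}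
    (hr' : r' + 2 * rξ ≤ r)
    (hthick : ENNReal.ofReal f₀ * Measure.euclideanHausdorffMeasure d (closedBall c r' ∩ M) ≤
      ∫⁻ y in closedBall c r' ∩ M, ENNReal.ofReal (f y) ∂(Measure.euclideanHausdorffMeasure d)) :
    ENNReal.ofReal f₀ * Measure.euclideanHausdorffMeasure d (closedBall c r' ∩ M) ≤
      Q.map (fun ω => X₀ ω + ξ ω) (closedBall x r) := by
  refine hthick.trans (le_trans (le_of_eq ?_) (le_map_add hX₀ hξ hξr measurableSet_closedBall
    (measurableSet_closedBall (x := c) (ε := r')) ?_))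
  · rw [hlaw, withDensity_apply _ measurableSet_closedBall,
      Measure.restrict_restrict measurableSet_closedBall]
  · intro p e he hp
    rw [mem_closedBall] at hp ⊢
    have h1 : dist (p + e) p ≤ rξ := by rwa [dist_eq_norm, add_sub_cancel_left]
    have h2 := dist_triangle4 (p + e) p c x
    rw [dist_comm c x] at h2
    linarith

/-- Between two clusters the density is at most `D`, so that the mass of the intersection of two
noisy balls is at most `D` times a volume. A point of a cluster that is within the separation
distance of both centres lies on one of the two spheres, which have no volume. -/
lemma measure_inter_le_of_gap (hX₀ : Measurable X₀) (hξ : Measurable ξ) (hMm : MeasurableSet M)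
    (hlaw : Q.map X₀ = ((Measure.euclideanHausdorffMeasure d).restrict M).withDensity
      (fun x => ENNReal.ofReal (f x)))
    (hξr : ∀ᵐ ω ∂Q, ‖ξ ω‖ ≤ rξ) {x y c c' : E} (hxc : dist x c ≤ rξ) (hyc : dist y c' ≤ rξ)
    {r R D : ℝ} (hR : r + 2 * rξ ≤ R) {ι : Type*} {C : ι → Set E} {a a' : ι} (ha : a ≠ a')
    (hc : c ∈ C a) (hc' : c' ∈ C a')
    (hsep : ∀ a a', a ≠ a' → ∀ x ∈ C a, ∀ y ∈ C a', R ≤ dist x y)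
    (hgap : ∀ᵐ x ∂((Measure.euclideanHausdorffMeasure d).restrict M),
      x ∉ ⋃ a, C a → f x ≤ D)
    (h₁ : Measure.euclideanHausdorffMeasure d (M ∩ sphere c R) = 0)
    (h₂ : Measure.euclideanHausdorffMeasure d (M ∩ sphere c' R) = 0) :
    Q.map (fun ω => X₀ ω + ξ ω) (closedBall x r ∩ closedBall y r) ≤
      ENNReal.ofReal D *
        Measure.euclideanHausdorffMeasure d (M ∩ (closedBall c R ∩ closedBall c' R)) := by
  have hm : ∀ (p q : E) (t : ℝ), MeasurableSet (closedBall p t ∩ closedBall q t) := fun p q t =>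
    measurableSet_closedBall.inter measurableSet_closedBall
  refine (map_add_le hX₀ hξ hξr (hm x y r) (hm c c' R) ?_).trans ?_
  · intro p e he hp
    have h1 : dist p (p + e) ≤ rξ := by rwa [dist_self_add_right]
    have h2 := dist_triangle4 p (p + e) x c
    have h3 := dist_triangle4 p (p + e) y c'
    have h4 := mem_closedBall.1 hp.1
    have h5 := mem_closedBall.1 hp.2
    exact ⟨mem_closedBall.2 (by linarith), mem_closedBall.2 (by linarith)⟩
  · have hnull : ∀ p : E, Measure.euclideanHausdorffMeasure d (M ∩ sphere p R) = 0 →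
        ∀ᵐ x ∂((Measure.euclideanHausdorffMeasure d).restrict M), x ∉ sphere p R := fun p hp => by
      rw [ae_iff]
      simp only [not_not]
      change (Measure.euclideanHausdorffMeasure d).restrict M (sphere p R) = 0
      rwa [Measure.restrict_apply' hMm, inter_comm]
    rw [hlaw, withDensity_apply _ (hm c c' R)]
    calc ∫⁻ p in closedBall c R ∩ closedBall c' R, ENNReal.ofReal (f p)
          ∂((Measure.euclideanHausdorffMeasure d).restrict M)
        ≤ ∫⁻ _ in closedBall c R ∩ closedBall c' R, ENNReal.ofReal D
          ∂((Measure.euclideanHausdorffMeasure d).restrict M) := by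
          refine setLIntegral_mono_ae measurable_const.aemeasurable ?_
          filter_upwards [hgap, hnull c h₁, hnull c' h₂] with p hp hs hs' hpA
          refine ENNReal.ofReal_le_ofReal (hp fun hpC => ?_)
          obtain ⟨a₀, ha₀⟩ := mem_iUnion.1 hpC
          rcases ne_or_eq a₀ a with h | h
          · exact hs (le_antisymm hpA.1 (hsep a₀ a h p ha₀ c hc))
          · exact hs' (le_antisymm hpA.2 (hsep a₀ a' (h ▸ ha) p ha₀ c' hc'))
      _ = _ := by
          rw [setLIntegral_const, Measure.restrict_apply' hMm, inter_comm]

/-- The gap coefficient of two points close to different clusters is bounded by the volume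
coefficient, up to the effects of curvature and noise and to the depth `ε` of the gap. -/
theorem gapCoef_le (hMc : IsCompact M) (hM : IsC2Submanifold d M) (hκ : 0 < κ)
    (hreach : ENNReal.ofReal (1 / κ) ≤ reach M) [IsProbabilityMeasure Q]
    (hX₀ : Measurable X₀) (hξ : Measurable ξ)
    (hlaw : Q.map X₀ = ((Measure.euclideanHausdorffMeasure d).restrict M).withDensity
      (fun x => ENNReal.ofReal (f x)))
    (hξr : ∀ᵐ ω ∂Q, ‖ξ ω‖ ≤ rξ) {P : Measure E} (hP : P = Q.map (fun ω => X₀ ω + ξ ω))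
    {r b' : ℝ} (hr0 : 0 < r) (hrξ : rξ ≤ r / 20) (hκr : κ * r ≤ 1 / 48) (hb' : b' < 2)
    {ι : Type*} {C : ι → Set E} (hCM : ∀ a, C a ⊆ M)
    (hsep : ∀ a a', a ≠ a' → ∀ x ∈ C a, ∀ y ∈ C a', r + 2 * rξ ≤ dist x y)
    {f₀ : ℝ} (hf₀ : 0 < f₀)
    (hthick : ∀ a, ∀ x ∈ C a, ∀ r' < r,
      ENNReal.ofReal f₀ * Measure.euclideanHausdorffMeasure d (closedBall x r' ∩ M) ≤
        ∫⁻ y in closedBall x r' ∩ M, ENNReal.ofReal (f y) ∂(Measure.euclideanHausdorffMeasure d))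
    {ε : ℝ} (hε1 : ε < 1)
    (hgap : ∀ᵐ x ∂((Measure.euclideanHausdorffMeasure d).restrict M),
      x ∉ ⋃ a, C a → f x ≤ (1 - ε) * f₀)
    {x y : E} (hxy : dist x y ≤ b' * r) {a a' : ι} (ha : a ≠ a')
    (hx : ∃ c ∈ C a, dist x c ≤ rξ) (hy : ∃ c ∈ C a', dist y c ≤ rξ)
    (hε : 7 * (epsM d κ b' r + epsXi d rξ b' r) ≤ ε) :
    0 < d ∧ 0 < epsM d κ b' r ∧ 0 ≤ epsXi d rξ b' r ∧
      0 < P.real (closedBall x r ∪ closedBall y r) ∧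
      P.real (closedBall x r ∩ closedBall y r) / P.real (closedBall x r ∪ closedBall y r) ≤
        (1 - ε) * volCoef d (dist x y / r) * (1 + (epsM d κ b' r + epsXi d rξ b' r)) := by
  obtain ⟨c, hc, hxc⟩ := hx
  obtain ⟨c', hc', hyc⟩ := hy
  have hrξ0 : 0 ≤ rξ := by
    obtain ⟨ω, hω⟩ := hξr.exists
    exact (norm_nonneg _).trans hω
  have hcM := hCM a hc
  have hcM' := hCM a' hc'
  have hcc1 : dist c c' ≤ dist x y + 2 * rξ := by
    have := dist_triangle4 c x y c'
    rw [dist_comm c x] at this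
    linarith
  have hcc2 : dist x y ≤ dist c c' + 2 * rξ := by
    have := dist_triangle4 x c c' y
    rw [dist_comm c' y] at this
    linarith
  have hcc3 := hsep a a' ha c hc c' hc'
  have hb'r : b' * r < 2 * r := mul_lt_mul_of_pos_right hb' hr0
  have hd : 0 < d := by
    refine dim_pos_of_norm_sub_lt hMc hM hκ hreach hcM hcM' (dist_pos.1 (by linarith)) ?_
    rw [← dist_eq_norm]
    calc κ * dist c c' ≤ κ * (3 * r) := by gcongr; linarith
      _ < 2 := by linarith
  obtain ⟨k, rfl⟩ : ∃ k, d = k + 1 := ⟨d - 1, by omega⟩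
  refine ⟨hd, ?_⟩
  have hk0 : (0 : ℝ) ≤ k := Nat.cast_nonneg k
  obtain ⟨s, hs⟩ : ∃ s, s = dist x y / r := ⟨_, rfl⟩
  obtain ⟨η, hη⟩ : ∃ η, η = rξ / r := ⟨_, rfl⟩
  have hsr : dist x y = s * r := by rw [hs, div_mul_cancel₀ _ hr0.ne']
  have hηr : rξ = η * r := by rw [hη, div_mul_cancel₀ _ hr0.ne']
  have hs0 : 0 ≤ s := hs ▸ div_nonneg dist_nonneg hr0.le
  have hη0 : 0 ≤ η := hη ▸ div_nonneg hrξ0 hr0.le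
  have hsb : s ≤ b' := by rw [hs, div_le_iff₀ hr0]; exact hxy
  have hx0 : 0 < κ * r := mul_pos hκ hr0
  obtain ⟨G, hG⟩ : ∃ G, G = (1 - (b' / 2) ^ 2) ^ (((k : ℝ) + 2) / 2) := ⟨_, rfl⟩
  have hb'0 : 0 ≤ b' := hs0.trans hsb
  have hbase : 0 < 1 - (b' / 2) ^ 2 := by nlinarith
  have hG0 : 0 < G := hG ▸ Real.rpow_pos_of_pos hbase _
  have hG1 : G ≤ 1 := by
    rw [hG]
    exact Real.rpow_le_one hbase.le (by linarith [sq_nonneg (b' / 2)]) (by linarith)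
  obtain ⟨u, hu⟩ : ∃ u, u = ((k : ℝ) + 2) * (κ * r) / G := ⟨_, rfl⟩
  obtain ⟨v, hv⟩ : ∃ v, v = ((k : ℝ) + 2) * η / G := ⟨_, rfl⟩
  have hGx : ((k : ℝ) + 2) * (κ * r) = u * G := by rw [hu, div_mul_cancel₀ _ hG0.ne']
  have hGy : ((k : ℝ) + 2) * η = v * G := by rw [hv, div_mul_cancel₀ _ hG0.ne']
  have hu0 : 0 < u := hu ▸ by positivity
  have hv0 : 0 ≤ v := hv ▸ by positivity
  have hcast : (((k + 1 : ℕ) : ℝ) + 1) = (k : ℝ) + 2 := by push_cast; ring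
  have hM84 : epsM (k + 1) κ b' r = 84 * u := by
    rw [epsM, hcast, ← hG, hu]; ring
  have hX80 : epsXi (k + 1) rξ b' r = 80 * v := by
    rw [epsXi, hcast, ← hG, hv, ← hη]; ring
  rw [hM84, hX80] at hε ⊢
  have huv : 7 * (84 * u + 80 * v) ≤ 1 := by linarith
  have hux : ((k : ℝ) + 2) * (κ * r) ≤ u := hGx ▸ mul_le_of_le_one_right hu0.le hG1
  have hvy : ((k : ℝ) + 2) * η ≤ v := hGy ▸ mul_le_of_le_one_right hv0 hG1
  have hkx := mul_nonneg hk0 hx0.le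
  have hkη := mul_nonneg hk0 hη0
  refine ⟨by linarith, by linarith, ?_⟩
  have : IsProbabilityMeasure P := by
    rw [hP]
    exact Measure.isProbabilityMeasure_map (hX₀.add hξ).aemeasurable
  have hMm : MeasurableSet M := hMc.isClosed.measurableSet
  have hF : 0 < f₀ * (unitBallVol (k + 1) * r ^ (k + 1)) :=
    mul_pos hf₀ (mul_pos (unitBallVol_pos _) (pow_pos hr0 _))
  -- mass of one ball
  have hball : ∀ a, ∀ c ∈ C a, ∀ x, dist x c ≤ rξ →
      f₀ * (unitBallVol (k + 1) * r ^ (k + 1)) * (1 - 2 * u - 2 * v)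
        ≤ P.real (closedBall x r) := by
    intro a c hc x hxc
    refine (ENNReal.ofReal_le_iff_le_toReal (measure_ne_top _ _)).1 ?_
    have h1 := le_measure_closedBall hMc hM hκ hreach (hCM a hc) (u := u) (v := v) hr0 hη0
      (by push_cast; linarith) (by push_cast; linarith) (by linarith) (by linarith)
    have hr' : r * (1 - 2 * η - κ * r) = r - 2 * rξ - r * (κ * r) := by rw [hηr]; ring
    have hpos : 0 < r * (κ * r) := mul_pos hr0 hx0
    have h2 := le_measure_closedBall_of_thick hX₀ hξ hlaw hξr hxc (r := r)
      (r' := r * (1 - 2 * η - κ * r)) (by linarith) (hthick a c hc _ (by linarith))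
    rw [hP]
    refine le_trans ?_ h2
    rw [mul_assoc, ENNReal.ofReal_mul hf₀.le]
    gcongr
  -- mass of the intersection
  have hR : r + 2 * rξ = r * (1 + 2 * η) := by rw [hηr]; ring
  have hR0 : 0 < r + 2 * rξ := by linarith
  have hκR : 6 * κ * (r + 2 * rξ) ≤ 1 / 2 := by
    have h1 : κ * rξ ≤ κ * (r / 20) := by gcongr
    linarith
  have hρ : 0 < capInt k (s / 2) := capInt_pos k (by linarith) (by linarith)
  have hρ0 : 0 < capInt k 0 := capInt_pos k le_rfl one_pos
  have hinter : P.real (closedBall x r ∩ closedBall y r) ≤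
      (1 - ε) * (f₀ * (unitBallVol (k + 1) * r ^ (k + 1))) *
        (capInt k (s / 2) / capInt k 0 * (1 + 10 * u + 7 * v)) := by
    have h1 := measure_inter_le hMc hM hκ hreach hcM hcM' (s := s) hr0 hη0 hs0 hsb hb'
      (by rw [← dist_eq_norm, sub_mul, mul_assoc, ← hηr]; linarith)
      (by rw [← dist_eq_norm, add_mul, mul_assoc, ← hηr]; linarith) hG hu0.le hv0 hGx hGy huv
    have h2 := measure_inter_le_of_gap (r := r) hX₀ hξ hMm hlaw hξr hxc hyc le_rfl ha hc hc'
      hsep hgap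
      (measure_inter_sphere_eq_zero hMc hM hκ hreach hcM hR0 hκR)
      (measure_inter_sphere_eq_zero hMc hM hκ hreach hcM' hR0 hκR)
    rw [hR] at h2
    have hD : 0 ≤ (1 - ε) * f₀ := mul_nonneg (by linarith) hf₀.le
    refine ENNReal.toReal_le_of_le_ofReal ?_ ?_
    · have : 0 ≤ 1 - ε := by linarith
      positivity
    · rw [hP]
      refine (h2.trans (mul_le_mul_right h1 _)).trans (le_of_eq ?_)
      rw [← ENNReal.ofReal_mul hD]
      congr 1
      ring
  have hsum := measureReal_union_add_inter (μ := P)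
    (s := closedBall x r) (measurableSet_closedBall (x := y) (ε := r))
  have hz : P.real (closedBall x r ∪ closedBall y r) = P.real (closedBall x r) +
      P.real (closedBall y r) - P.real (closedBall x r ∩ closedBall y r) := by linarith
  rw [hz, ← hs, volCoef_eq k hs0 (by linarith)]
  have hfin := gap_arith hF (div_pos hρ hρ0)
    ((div_le_one hρ0).2 (capInt_antitone k (by linarith))) hu0.le hv0 hε hε1 hinter
    (hball a c hc x hxc) (hball a' c' hc' y hyc)
  have hq : capInt k (s / 2) / (2 * capInt k 0 - capInt k (s / 2)) =
      capInt k (s / 2) / capInt k 0 / (2 - capInt k (s / 2) / capInt k 0) := by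
    rw [div_div, mul_sub, mul_div_cancel₀ _ hρ0.ne', mul_comm]
  rw [hq]
  exact hfin

end Gap

end AWC

theorem theorem2
    -- the manifold
    (D d : ℕ) (M : Set (EuclideanSpace ℝ (Fin D)))
    (hMc : IsCompact M) (hM : AWC.IsC2Submanifold d M)
    (κ : ℝ) (hκ : 0 < κ) (hreach : ENNReal.ofReal (1 / κ) ≤ AWC.reach M)
    -- the distribution `P` of `X₀ + ξ`, where `X₀` has density `f` on `M` and `‖ξ‖ ≤ rξ`
    {Ω : Type*} [MeasurableSpace Ω] (Q : Measure Ω) [IsProbabilityMeasure Q]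
    (X₀ ξ : Ω → EuclideanSpace ℝ (Fin D)) (hX₀ : Measurable X₀) (hξ : Measurable ξ)
    (f : EuclideanSpace ℝ (Fin D) → ℝ) (hf : Measurable f) (hf0 : ∀ x, 0 ≤ f x)
    (hlaw : Q.map X₀ =
      ((Measure.euclideanHausdorffMeasure d).restrict M).withDensity
        (fun x => ENNReal.ofReal (f x)))
    (rξ : ℝ) (hξr : ∀ᵐ ω ∂Q, ‖ξ ω‖ ≤ rξ)
    (P : Measure (EuclideanSpace ℝ (Fin D))) (hP : P = Q.map (fun ω => X₀ ω + ξ ω))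
    -- the radii `h 0 < h 1 < …`; the step considered is `k = m + 1`, its previous radius is `h m`;
    -- distances in the volume coefficient of step `l + 1` are in units of `h l` or of `h (l + 1)`
    (b b' : ℝ) (h g : ℕ → ℝ) (h0 : 0 < h 0) (hstep : ∀ l, h (l + 1) = b * h l) (m : ℕ)
    (hg : g = h ∨ g = fun l => h (l + 1))
    (hrξ : rξ ≤ h m / max 20 (5 * (d : ℝ)))
    (hr : h m ≤ 1 / (max 48 (6 * (d : ℝ)) * κ))
    (hb1 : 1 < b) (hb' : b' < 2)
    (hb : b ≤ b' / ((1 + 3 * κ * h m) * (1 + 5 * (rξ / h m))))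
    -- the clusters: disjointness, spatial separation, thickness, depth of the gap
    (K : ℕ) (C : Fin K → Set (EuclideanSpace ℝ (Fin D))) (hCM : ∀ a, C a ⊆ M)
    (hdisj : ∀ a a', a ≠ a' → Disjoint (C a) (C a'))
    (hsep : ∀ a a', a ≠ a' → ∀ x ∈ C a, ∀ y ∈ C a', h m + 2 * rξ ≤ dist x y)
    (f₀ : ℝ) (hf₀ : 0 < f₀)
    (hthick : ∀ a, ∀ x ∈ C a, ∀ r' < h m,
      ENNReal.ofReal f₀ *
          Measure.euclideanHausdorffMeasure d (Metric.closedBall x r' ∩ M) ≤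
        ∫⁻ y in Metric.closedBall x r' ∩ M, ENNReal.ofReal (f y)
          ∂(Measure.euclideanHausdorffMeasure d))
    (ε : ℝ) (hε1 : ε < 1)
    (hgap : ∀ᵐ x ∂((Measure.euclideanHausdorffMeasure d).restrict M),
      x ∉ ⋃ a, C a → f x ≤ (1 - ε) * f₀)
    -- the two points
    (xi xj : EuclideanSpace ℝ (Fin D)) (hdist : dist xi xj ≤ h (m + 1))
    (ai aj : Fin K) (ha : ai ≠ aj)
    (hxi : ∃ c ∈ C ai, dist xi c ≤ rξ) (hxj : ∃ c ∈ C aj, dist xj c ≤ rξ)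
    -- sample size and depth
    (n : ℕ) (α β z : ℝ) (hβ : 0 < β) (hαβ : β < α)
    (hz : z = P.real (Metric.closedBall xi (h m) ∪ Metric.closedBall xj (h m)))
    (hn : 2 * β / z ^ 2 ≤ (n : ℝ) / Real.log n)
    (hε : max (7 * (AWC.epsM d κ b' (h m) + AWC.epsXi d rξ b' (h m)))
        (Real.sqrt (2 * α * Real.log n / (z * AWC.volCoef d b ^ 2 * n))) ≤ ε)
    (i j : Fin (n + 2)) (hij : i ≠ j) :
    -- the statistic of step `m + 1` computed from the weights that result when no gap was detected
    1 - 3 * (n : ℝ) ^ (-β) ≤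
        (AWC.condSampleLaw P i j xi xj).real
          {X | (Real.sqrt α - Real.sqrt β) ^ 2 * Real.log n ≤
            AWC.testStat (AWC.ballWeight (h m) X)
              (AWC.adjVolCoef d κ rξ b' (h m) (g m) (X i) (X j)) i j} ∧
      -- the statistic of step `m + 1` in a run of the algorithm with an arbitrary threshold
      ∀ lam : ℝ,
        1 - 3 * (n : ℝ) ^ (-β) ≤
          (AWC.condSampleLaw P i j xi xj).real
            {X | AWC.NoGapUpTo (fun l => AWC.adjVolCoef d κ rξ b' (h l) (g l)) h lam X m →
              (Real.sqrt α - Real.sqrt β) ^ 2 * Real.log n ≤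
                AWC.testStat
                  (AWC.weight (fun l => AWC.adjVolCoef d κ rξ b' (h l) (g l)) h lam X m)
                  (AWC.adjVolCoef d κ rξ b' (h m) (g m) (X i) (X j)) i j} := by
  -- the hypotheses on the radii
  have hpos : ∀ l, 0 < h l := fun l => by
    induction l with
    | zero => exact h0
    | succ l ih => rw [hstep]; exact mul_pos (by linarith) ih
  have hr0 := hpos m
  have hrξ0 : 0 ≤ rξ := by
    obtain ⟨ω, hω⟩ := hξr.exists
    exact (norm_nonneg _).trans hω
  have hrξ' : rξ ≤ h m / 20 := hrξ.trans (by gcongr; exact le_max_left _ _)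
  have hκr : κ * h m ≤ 1 / 48 := by
    have h1 : 48 * κ ≤ max 48 (6 * (d : ℝ)) * κ := by gcongr; exact le_max_left _ _
    have h2 := hr.trans (one_div_le_one_div_of_le (by positivity) h1)
    rw [le_div_iff₀ (by positivity)] at h2
    linarith
  have hbb' : b ≤ b' := by
    have h1 : 1 ≤ (1 + 3 * κ * h m) * (1 + 5 * (rξ / h m)) := by
      have h3 : 0 ≤ 3 * κ * h m := by positivity
      have h4 : 0 ≤ 5 * (rξ / h m) := by positivity
      exact one_le_mul_of_one_le_of_one_le (by linarith) (by linarith)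
    have h2 : b * ((1 + 3 * κ * h m) * (1 + 5 * (rξ / h m))) ≤ b' :=
      (le_div_iff₀ (by linarith)).1 hb
    nlinarith
  have hdist' : dist xi xj ≤ b * h m := hstep m ▸ hdist
  have hP1 : IsProbabilityMeasure P := by
    rw [hP]
    exact Measure.isProbabilityMeasure_map (hX₀.add hξ).aemeasurable
  obtain ⟨hd, hM0, hX0, hz0, hθ⟩ := AWC.gapCoef_le hMc hM hκ hreach hX₀ hξ hlaw hξr hP hr0 hrξ' hκr
    hb' hCM hsep hf₀ hthick hε1 hgap (hdist'.trans (by gcongr)) ha hxi hxj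
    ((le_max_left _ _).trans hε)
  obtain ⟨k, rfl⟩ : ∃ k, d = k + 1 := ⟨d - 1, by omega⟩
  have hs0 : 0 ≤ dist xi xj / h m := by positivity
  have hsb : dist xi xj / h m ≤ b := (div_le_iff₀ hr0).2 hdist'
  have hg0 : 0 < g m ∧ h m ≤ g m := by
    rcases hg with rfl | rfl
    · exact ⟨hr0, le_rfl⟩
    · refine ⟨hpos _, ?_⟩
      simp only [hstep]
      nlinarith
  have hsg0 : 0 ≤ dist xi xj / g m := div_nonneg dist_nonneg hg0.1.le
  have hsg : dist xi xj / g m ≤ dist xi xj / h m := by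
    have := hg0.2
    gcongr
  have hq1 := AWC.volCoef_antitone k hsg0 hsg (by linarith)
  have hq2 := AWC.volCoef_antitone k hs0 hsb (by linarith)
  have hqb := AWC.volCoef_pos k (s := b) (by linarith) (by linarith)
  have hqg := AWC.volCoef_le_one k hsg0 (by linarith)
  have hqg0 := (hqb.le.trans hq2).trans hq1
  have hε0 : 0 < ε := by linarith [(le_max_left _ _).trans hε]
  -- the adjusted volume coefficient exceeds the gap coefficient
  have hadj := AWC.adj_arith hM0.le hX0 (hqb.le.trans hq2) ((le_max_left _ _).trans hε) hθ
  have hinvM : (1 + AWC.epsM (k + 1) κ b' (h m))⁻¹ < 1 := inv_lt_one_of_one_lt₀ (by linarith)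
  have hinvX : (1 + AWC.epsXi (k + 1) rξ b' (h m))⁻¹ ≤ 1 := inv_le_one_of_one_le₀ (by linarith)
  have hinvM0 : 0 < (1 + AWC.epsM (k + 1) κ b' (h m))⁻¹ := inv_pos.2 (by linarith)
  have hinvX0 : 0 < (1 + AWC.epsXi (k + 1) rξ b' (h m))⁻¹ := inv_pos.2 (by linarith)
  have hq : AWC.adjVolCoef (k + 1) κ rξ b' (h m) (g m) xi xj < 1 := by
    rw [AWC.adjVolCoef]
    calc _ ≤ (1 + AWC.epsM (k + 1) κ b' (h m))⁻¹ * 1 * 1 := by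
          gcongr
      _ < 1 := by linarith
  have hle : (1 + AWC.epsM (k + 1) κ b' (h m))⁻¹ * (1 + AWC.epsXi (k + 1) rξ b' (h m))⁻¹ *
        AWC.volCoef (k + 1) (dist xi xj / h m)
      ≤ AWC.adjVolCoef (k + 1) κ rξ b' (h m) (g m) xi xj := by
    rw [AWC.adjVolCoef]; gcongr
  have hsq : √(α * Real.log n / (n * z)) ≤ 5 / 7 * ε * AWC.volCoef (k + 1) b := by
    have h1 := (Real.sqrt_le_iff.1 ((le_max_right _ _).trans hε)).2
    refine Real.sqrt_le_iff.2 ⟨by positivity, ?_⟩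
    have h2 : α * Real.log n / (n * z) = 2 * α * Real.log n /
        (z * AWC.volCoef (k + 1) b ^ 2 * n) * (AWC.volCoef (k + 1) b ^ 2 / 2) := by
      have := hqb.ne'
      field_simp
    have h3 : 0 < AWC.volCoef (k + 1) b ^ 2 := by positivity
    rw [h2]
    calc _ ≤ ε ^ 2 * (AWC.volCoef (k + 1) b ^ 2 / 2) := by gcongr
      _ ≤ _ := by nlinarith [mul_pos (pow_pos hε0 2) h3]
  rw [← hz] at hz0 hθ hadj
  have hsub : P.real (Metric.closedBall xi (h m) ∩ Metric.closedBall xj (h m)) ≤ z := by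
    rw [hz]
    exact measureReal_mono fun p hp => Or.inl hp.1
  have main := AWC.le_measureReal_testStat (P := P)
    (q := AWC.adjVolCoef (k + 1) κ rξ b' (h m) (g m)) hij hβ hαβ hz0 hz
    (θ := P.real (Metric.closedBall xi (h m) ∩ Metric.closedBall xj (h m)) / z)
    (div_nonneg measureReal_nonneg hz0.le) ((div_le_one hz0).2 hsub)
    (mul_div_cancel₀ _ hz0.ne').symm hn hq (by
      have h1 : 5 / 7 * ε * AWC.volCoef (k + 1) b
          ≤ 5 / 7 * ε * AWC.volCoef (k + 1) (dist xi xj / h m) := by gcongr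
      linarith)
  refine ⟨main, fun lam => main.trans ?_⟩
  have : IsFiniteMeasure (AWC.condSampleLaw P i j xi xj) := by
    have : ∀ l, IsProbabilityMeasure
        (if l = i then Measure.dirac xi else if l = j then Measure.dirac xj else P) := fun l => by
      split_ifs <;> infer_instance
    rw [AWC.condSampleLaw]
    infer_instance
  refine measureReal_mono fun X hX hgapX => ?_
  rw [AWC.weight_eq_ballWeight hr0.le hgapX]
  exact hX
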